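/- A mixed unit interval graph is the intersection graph of finitely many real intervals of length one, each of which may be open, closed, or open at one end and closed at the other. An extended bubble model $\mathcal B$ with vertex set $V$ assigns to every vertex $v \in V$ a column $j(v)\in\{1,\dots,k\}$, a row $i(v)\in\{1,\dots,r_{j(v)}\}$, and one of four quadrants, which records whether the left end and whether the right end of an interval is closed. The set $B^q_{i,j}$ (possibly empty) of the vertices in column $j$, row $i$ and quadrant $q$ is a bubble of the model. In the graph of the model, distinct vertices $u,v$ are adjacent if and only if, possibly after exchanging $u$ and $v$, either $j(u)=j(v)$; or $j(u)=j(v)+1$ and $i(u)<i(v)$; or $j(u)=j(v)+1$, $i(u)=i(v)$, the quadrant of $u$ is left-closed and the quadrant of $v$ is right-closed. For a mixed unit interval graph $G$, let $p(G)$ be the minimum, over all extended bubble models of $G$, of the maximum number of non-empty bubbles $B^q_{i,j}$ in a column $j$ of the model. Two adjacent vertices $u,v$ of a graph $G$ are twins if $N_G(u)\setminus\{v\}=N_G(v)\setminus\{u\}$, and a bubble of $G$ is a maximal non-empty set of pairwise twins. A bubble partition of $G$ is a partition $\mathcal V$ of $V(G)$ into unions of bubbles such that contracting every set of $\mathcal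 V$ to a single vertex turns $G$ into a tree. Its width is the largest number of bubbles of $G$ contained in a set of $\mathcal V$. Let $\mathrm{bw}_1(G)$ be the smallest width of a bubble partition all of whose sets are cliques ($\infty$ if there is none). Theorem. 1. There is an FPT algorithm for MaxCut on mixed unit interval graphs parameterized by $p(G)$, with running time $O^*(4^{p(G)})$: there are a program $P$ for a random access machine with logarithmic cost and constants $C,c\in\mathbb N$ such that for every $n \ge 0$ and every mixed unit interval graph $G$ on $n$ vertices, the program $P$, given only the adjacency matrix of $G$, halts after cost at most $C\cdot 4^{p(G)}\cdot(n+1)^c$ and outputs a vertex set $S$ for which the number of edges of $G$ with exactly one endpoint in $S$ is maximum. 2. Every mixed unit interval graph $G$ has an extended bubble model. If $G$ is connected, then $\mathrm{bw}_1(G)\le p(G)$. In general, $\mathrm{bw}_1(G[K])\le p(G)$ for the vertex set $K$ of every connected component of $G$. -/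

import Mathlib

namespace MaxCutBubbles

/-! ### Mixed unit interval graphs -/

/-- The interval of length one with left end `a`; the two Booleans say whether the left,
respectively the right, end belongs to it. -/
def unitIntervalAt (a : ℝ) (leftClosed rightClosed : Bool) : Set ℝ :=
  {x | (a < x ∧ x < a + 1) ∨ (x = a ∧ leftClosed = true) ∨ (x = a + 1 ∧ rightClosed = true)}

/-- `G` is the intersection graph of unit intervals, each of which is open, closed, or open at one
end and closed at the other. -/
def IsMixedUnitInterval {V : Type*} (G : SimpleGraph V) : Prop :=
  ∃ (a : V → ℝ) (l r : V → Bool), ∀ u v : V, G.Adj u v ↔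
    u ≠ v ∧ (unitIntervalAt (a u) (l u) (r u) ∩ unitIntervalAt (a v) (l v) (r v)).Nonempty

/-! ### Extended bubble models -/

/-- The four quadrants of a cell: the first entry says whether the left end of the intervals of the
quadrant is closed, the second entry whether their right end is closed. -/
abbrev Quadrant : Type := Bool × Bool

/-- An extended two-dimensional bubble model with vertex set `V`: a near-partition of `V` into
bubbles indexed by a column, a row of this column, and a quadrant. It is given by the unique indices
of every vertex, so the bubbles are pairwise disjoint and cover `V`, and any of them may be empty. -/
structure ExtendedBubbleModel (V : Type*) where
  numCols : ℕ
  numCols_pos : 0 < numCols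
  numRows : Fin numCols → ℕ
  numRows_pos : ∀ j, 0 < numRows j
  col : V → Fin numCols
  row : (v : V) → Fin (numRows (col v))
  quadrant : V → Quadrant

namespace ExtendedBubbleModel

variable {V : Type*} (B : ExtendedBubbleModel V)

/-- The bubble in column `j`, row `i` and quadrant `q`. -/
def bubble (j : Fin B.numCols) (i : Fin (B.numRows j)) (q : Quadrant) : Set V :=
  {v | B.col v = j ∧ (B.row v : ℕ) = i ∧ B.quadrant v = q}

/-- `u` lies in the column right after that of `v`, and either `u` lies in a row of smaller index
or they lie in rows of the same index, where the intervals of `v` contain their right end and those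
of `u` contain their left end. -/
def NextColumnAdj (u v : V) : Prop :=
  (B.col u : ℕ) = B.col v + 1 ∧
    ((B.row u : ℕ) < B.row v ∨
      ((B.row u : ℕ) = B.row v ∧ (B.quadrant u).1 = true ∧ (B.quadrant v).2 = true))

/-- The graph of an extended bubble model. -/
def graph : SimpleGraph V where
  Adj u v := u ≠ v ∧ (B.col u = B.col v ∨ B.NextColumnAdj u v ∨ B.NextColumnAdj v u)
  symm := ⟨fun _ _ h => ⟨h.1.symm, h.2.imp Eq.symm Or.symm⟩⟩
  loopless := ⟨fun _ h => h.1 rfl⟩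

/-- The maximum number of non-empty bubbles in a column. -/
noncomputable def maxColumn : ℕ :=
  Finset.univ.sup fun j : Fin B.numCols =>
    {c : Fin (B.numRows j) × Quadrant | (B.bubble j c.1 c.2).Nonempty}.ncard

end ExtendedBubbleModel

/-- `p(G)`: the maximum number of non-empty bubbles in a column of an extended bubble model of `G`,
for a model of `G` that makes this number smallest. -/
noncomputable def p {V : Type*} (G : SimpleGraph V) : ℕ :=
  sInf {w | ∃ B : ExtendedBubbleModel V, B.graph = G ∧ B.maxColumn = w}

/-! ### Bubble partitions and bubble width -/

/-- Adjacent vertices with the same neighbours apart from each other. -/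
def Twins {V : Type*} (G : SimpleGraph V) (u v : V) : Prop :=
  G.Adj u v ∧ G.neighborSet u \ {v} = G.neighborSet v \ {u}

/-- A bubble of a graph: a maximal non-empty set of pairwise twins. -/
def IsBubble {V : Type*} (G : SimpleGraph V) (U : Set V) : Prop :=
  Maximal (fun W : Set V => W.Nonempty ∧ W.Pairwise (Twins G)) U

/-- The simple graph obtained by contracting every set of `P` to a single vertex. -/
def contract {V : Type*} (G : SimpleGraph V) (P : Set (Set V)) : SimpleGraph P where
  Adj X Y := X ≠ Y ∧ ∃ x ∈ (X : Set V), ∃ y ∈ (Y : Set V), G.Adj x y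
  symm := ⟨fun _ _ ⟨h, x, hx, y, hy, e⟩ => ⟨h.symm, y, hy, x, hx, e.symm⟩⟩
  loopless := ⟨fun _ h => h.1 rfl⟩

/-- A partition of the vertex set into unions of bubbles whose contraction yields a tree. -/
structure IsBubblePartition {V : Type*} (G : SimpleGraph V) (P : Set (Set V)) : Prop where
  isPartition : Setoid.IsPartition P
  unionOfBubbles : ∀ X ∈ P, ∃ 𝓑 : Set (Set V), (∀ U ∈ 𝓑, IsBubble G U) ∧ X = ⋃₀ 𝓑
  isTree : (contract G P).IsTree

/-- The independence number of a partition: the largest independence number of a graph induced by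
one of its sets. -/
noncomputable def independence {V : Type*} (G : SimpleGraph V) (P : Set (Set V)) : ℕ∞ :=
  ⨆ X ∈ P, ((G.induce X).indepNum : ℕ∞)

/-- The width of a partition: the largest number of bubbles in one of its sets. -/
noncomputable def width {V : Type*} (G : SimpleGraph V) (P : Set (Set V)) : ℕ∞ :=
  ⨆ X ∈ P, {U : Set V | IsBubble G U ∧ U ⊆ X}.encard

/-- The `α`-bubble width: the smallest width of a bubble partition of independence number at most
`α`, and `⊤` if there is none. -/
noncomputable def bw (α : ℕ) {V : Type*} (G : SimpleGraph V) : ℕ∞ :=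
  ⨅ (P : Set (Set V)) (_ : IsBubblePartition G P ∧ independence G P ≤ α), width G P

/-! ### Maximum cuts -/

/-- The number of edges with exactly one endpoint in `S`. -/
noncomputable def cutSize {V : Type*} (G : SimpleGraph V) (S : Set V) : ℕ :=
  {e ∈ G.edgeSet | ∃ u ∈ S, ∃ v ∉ S, e = s(u, v)}.ncard

/-- `S` is a maximum cut of `G`. -/
def IsMaxCut {V : Type*} (G : SimpleGraph V) (S : Set V) : Prop :=
  ∀ T : Set V, cutSize G T ≤ cutSize G S

/-! ### Random access machines with logarithmic cost -/

/-- A configuration: registers, which instructions name directly, and a memory, which is accessed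
through addresses held in registers. -/
structure RamState where
  reg : ℕ → ℕ
  mem : ℕ → ℕ

/-- Truncated subtraction and integer division are the ones of the natural numbers. -/
inductive RamOp where
  | add | sub | mul | div

def RamOp.apply : RamOp → ℕ → ℕ → ℕ
  | .add, x, y => x + y
  | .sub, x, y => x - y
  | .mul, x, y => x * y
  | .div, x, y => x / y

/-- Programs of the random access machine, with structured control flow. -/
inductive RamProg where
  /-- `r := c` -/
  | const (r c : ℕ)
  /-- `r := a op b` for registers `a` and `b` -/
  | arith (op : RamOp) (r a b : ℕ)
  /-- `r := mem[a]`, the address being the content of register `a` -/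
  | load (r a : ℕ)
  /-- `mem[a] := b`, the address being the content of register `a` -/
  | store (a b : ℕ)
  | seq (P Q : RamProg)
  /-- run `P` if register `r` holds zero, and `Q` otherwise -/
  | ifZero (r : ℕ) (P Q : RamProg)
  /-- run `P` as long as register `r` does not hold zero -/
  | loop (r : ℕ) (P : RamProg)

/-- `Runs P s t s'`: started in `s`, the program `P` halts in `s'`, at total cost `t`. Every
instruction and every test costs one plus the lengths in binary of the numbers that it reads,
addresses included. -/
inductive RamProg.Runs : RamProg → RamState → ℕ → RamState → Prop
  | const (r c : ℕ) (s : RamState) :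
      Runs (.const r c) s (1 + c.size) ⟨Function.update s.reg r c, s.mem⟩
  | arith (op : RamOp) (r a b : ℕ) (s : RamState) :
      Runs (.arith op r a b) s (1 + (s.reg a).size + (s.reg b).size)
        ⟨Function.update s.reg r (op.apply (s.reg a) (s.reg b)), s.mem⟩
  | load (r a : ℕ) (s : RamState) :
      Runs (.load r a) s (1 + (s.reg a).size + (s.mem (s.reg a)).size)
        ⟨Function.update s.reg r (s.mem (s.reg a)), s.mem⟩
  | store (a b : ℕ) (s : RamState) :
      Runs (.store a b) s (1 + (s.reg a).size + (s.reg b).size)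
        ⟨s.reg, Function.update s.mem (s.reg a) (s.reg b)⟩
  | seq {P Q : RamProg} {s₁ s₂ s₃ : RamState} {t₁ t₂ : ℕ} :
      Runs P s₁ t₁ s₂ → Runs Q s₂ t₂ s₃ → Runs (.seq P Q) s₁ (t₁ + t₂) s₃
  | ifTrue {r : ℕ} {P Q : RamProg} {s s' : RamState} {t : ℕ} :
      s.reg r = 0 → Runs P s t s' → Runs (.ifZero r P Q) s (1 + (s.reg r).size + t) s'
  | ifFalse {r : ℕ} {P Q : RamProg} {s s' : RamState} {t : ℕ} :
      s.reg r ≠ 0 → Runs Q s t s' → Runs (.ifZero r P Q) s (1 + (s.reg r).size + t) s'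
  | loopDone {r : ℕ} {P : RamProg} {s : RamState} :
      s.reg r = 0 → Runs (.loop r P) s (1 + (s.reg r).size) s
  | loopStep {r : ℕ} {P : RamProg} {s₁ s₂ s₃ : RamState} {t₁ t₂ : ℕ} :
      s₁.reg r ≠ 0 → Runs P s₁ t₁ s₂ → Runs (.loop r P) s₂ t₂ s₃ →
      Runs (.loop r P) s₁ (1 + (s₁.reg r).size + t₁ + t₂) s₃

open Classical in
/-- The input: register `0` holds the number `n` of vertices, `mem[u * n + v]` is the entry of the
adjacency matrix at `(u, v)`, and everything else is zero. -/
noncomputable def graphInput {n : ℕ} (G : SimpleGraph (Fin n)) : RamState where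
  reg r := if r = 0 then n else 0
  mem x := if ∃ u v : Fin n, G.Adj u v ∧ x = u * n + v then 1 else 0

/-- The output: a set of vertices, read off from its indicator in `mem[0], …, mem[n - 1]`. -/
def vertexSetOutput (n : ℕ) (s : RamState) : Set (Fin n) :=
  {v | s.mem v = 1}

/-- On every `n`-vertex graph `G` of the class `𝓒`, given by its adjacency matrix only, the program
`P` halts after cost at most `T n G` and outputs a maximum cut of `G`. -/
def FindsMaxCutInTime (P : RamProg) (𝓒 : ∀ n : ℕ, SimpleGraph (Fin n) → Prop)
    (T : ∀ n : ℕ, SimpleGraph (Fin n) → ℕ) : Prop :=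
  ∀ (n : ℕ) (G : SimpleGraph (Fin n)), 𝓒 n G → ∃ (t : ℕ) (s : RamState),
    P.Runs (graphInput G) t s ∧ t ≤ T n G ∧ IsMaxCut G (vertexSetOutput n s)

end MaxCutBubbles

/-! Bubble width. Place an interval with left end `a` in column `⌊a⌋`, in a row given by the rank of
the fractional part of `a`, and in the quadrant given by its end types: this is a bubble model. Take
an optimal one. Vertices of one bubble are equal or twins, but twins may lie in different columns,
so columns need not be unions of bubbles of the graph. This is repaired by the `level` of a vertex,
the smallest column that meets its class of twins. Every class has a representative in the column of
its level, so levels inherit the properties of columns: a level set is a clique, adjacent vertices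
have levels at most one apart, and a level set has at most as many classes as its column has
non-empty bubbles. For a connected graph the contraction of the level sets is connected, and
numbered by levels it is acyclic, hence a tree. Components are handled by restricting the model.

MaxCut. Two facts about a model bound the running time, although the program never sees one. The
vertex that is least by column, row and right end type is simplicial among the remaining vertices
(`exists_simplicial`), so simplicial vertices can be eliminated greedily. A clique lies in two
consecutive columns, so it meets at most `2 * p G` classes of twins (`card_le_two_mul_maxColumn`).

Some maximum cut is canonical (`exists_isCanonical_max`): it meets every class in an initial
segment, and no two adjacent classes are both split by it. On a clique it is therefore described by
one bit per class and one threshold, which leaves at most `4 ^ p G * (n + 1)` codes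
(`exists_trace_eq`).

Eliminating a simplicial vertex `v` creates a table indexed by the subsets of its remaining
neighbours, and merges the tables of the active neighbours of `v` into it. Only entries at coded
subsets are computed; all others stay zero. The invariant `IsTable` asks every entry to be realised
by some cut, and entries at traces of canonical sets to be at least optimal. Value and witness share
one number, `2 ^ n * value + bits witness`, so a sum joins disjoint witnesses and a maximum compares
values first. At the end the sum of the tables, modulo `2 ^ n`, is a maximum cut.

For the cost, a calculus of polynomial-time computable expressions (`Ctx.Computable`) supplies all
straight-line pieces; only the loop over codes is exponential. -/

namespace MaxCutBubbles

/-! ### Vertices with the same closed neighbourhood -/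

/-- Adjacent or equal. -/
def ClosedAdj {V : Type*} (G : SimpleGraph V) (u v : V) : Prop :=
  G.Adj u v ∨ u = v

/-- `u` and `v` have the same closed neighbourhood, that is, they are equal or twins. -/
def SameNbhd {V : Type*} (G : SimpleGraph V) (u v : V) : Prop :=
  ∀ w, ClosedAdj G u w ↔ ClosedAdj G v w

section ClosedNeighbourhoods

variable {V : Type*} {G : SimpleGraph V} {u v w x y : V}

theorem ClosedAdj.symm (h : ClosedAdj G u v) : ClosedAdj G v u :=
  h.imp SimpleGraph.Adj.symm Eq.symm

theorem SameNbhd.refl (G : SimpleGraph V) (u : V) : SameNbhd G u u := fun _ => Iff.rfl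

theorem SameNbhd.symm (h : SameNbhd G u v) : SameNbhd G v u := fun w => (h w).symm

theorem SameNbhd.trans (h : SameNbhd G u v) (h' : SameNbhd G v w) : SameNbhd G u w :=
  fun x => (h x).trans (h' x)

theorem SameNbhd.closedAdj (h : SameNbhd G u v) : ClosedAdj G u v :=
  (h v).2 (Or.inr rfl)

theorem SameNbhd.closedAdj_congr (h : SameNbhd G u v) (h' : SameNbhd G x y) :
    ClosedAdj G u x ↔ ClosedAdj G v y :=
  (h x).trans ⟨fun e => ((h' v).1 e.symm).symm, fun e => ((h' v).2 e.symm).symm⟩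

theorem Twins.sameNbhd (h : Twins G u v) : SameNbhd G u v := by
  intro w
  have hw := Set.ext_iff.1 h.2 w
  simp only [Set.mem_sdiff, SimpleGraph.mem_neighborSet, Set.mem_singleton_iff] at hw
  have huv := h.1
  have hvu := h.1.symm
  unfold ClosedAdj
  by_cases h1 : w = v
  · subst h1
    simp [huv]
  · by_cases h2 : w = u
    · subst h2
      simp [hvu]
    · have h3 : u ≠ w := fun e => h2 e.symm
      have h4 : v ≠ w := fun e => h1 e.symm
      simp only [h1, h2, h3, h4, or_false, not_false_eq_true, and_true] at hw ⊢
      exact hw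

theorem SameNbhd.twins (h : SameNbhd G u v) (hne : u ≠ v) : Twins G u v := by
  refine ⟨h.closedAdj.resolve_right hne, ?_⟩
  ext w
  have hw := h w
  simp only [Set.mem_sdiff, SimpleGraph.mem_neighborSet, Set.mem_singleton_iff]
  unfold ClosedAdj at hw
  constructor
  · rintro ⟨h1, h2⟩
    exact ⟨(hw.1 (Or.inl h1)).resolve_right fun e => h2 e.symm, fun e => G.ne_of_adj h1 e.symm⟩
  · rintro ⟨h1, h2⟩
    exact ⟨(hw.2 (Or.inl h1)).resolve_right fun e => h2 e.symm, fun e => G.ne_of_adj h1 e.symm⟩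

/-- Being equal or twins is an equivalence relation, so maximality forces a pairwise-twin set to be
the whole class of any of its elements. -/
theorem IsBubble.exists_eq {U : Set V} (h : IsBubble G U) : ∃ u, U = {v | SameNbhd G u v} := by
  obtain ⟨u, hu⟩ := h.1.1
  have hsub : U ⊆ {v | SameNbhd G u v} := by
    intro v hv
    by_cases e : u = v
    · exact e ▸ SameNbhd.refl G u
    · exact (h.1.2 hu hv e).sameNbhd
  refine ⟨u, hsub.antisymm (h.2 ⟨⟨u, SameNbhd.refl G u⟩, ?_⟩ hsub)⟩
  intro x hx y hy hxy
  exact (SameNbhd.trans (SameNbhd.symm hx) hy).twins hxy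

theorem isBubble_setOf_sameNbhd (G : SimpleGraph V) (u : V) :
    IsBubble G {v | SameNbhd G u v} := by
  refine ⟨⟨⟨u, SameNbhd.refl G u⟩, ?_⟩, ?_⟩
  · intro x hx y hy hxy
    exact (SameNbhd.trans (SameNbhd.symm hx) hy).twins hxy
  · rintro W ⟨-, hW⟩ hsub v hv
    have hu : u ∈ W := hsub (SameNbhd.refl G u)
    by_cases e : u = v
    · exact e ▸ SameNbhd.refl G u
    · exact (hW hu hv e).sameNbhd

end ClosedNeighbourhoods

/-! ### Bubble models and bubble width -/

namespace ExtendedBubbleModel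

variable {V : Type*} (B : ExtendedBubbleModel V) {u v w : V}

theorem closedAdj_iff :
    ClosedAdj B.graph u v ↔ B.col u = B.col v ∨ B.NextColumnAdj u v ∨ B.NextColumnAdj v u := by
  unfold ClosedAdj
  change (u ≠ v ∧ _) ∨ _ ↔ _
  by_cases h : u = v
  · subst h
    simp
  · simp [h]

theorem col_near_of_closedAdj (h : ClosedAdj B.graph u v) :
    (B.col u : ℕ) = B.col v ∨ (B.col u : ℕ) = B.col v + 1 ∨ (B.col v : ℕ) = B.col u + 1 := by
  rcases B.closedAdj_iff.1 h with h | h | h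
  · exact Or.inl (congrArg _ h)
  · exact Or.inr (Or.inl h.1)
  · exact Or.inr (Or.inr h.1)

/-- Adjacency in the model reads nothing but column, row index and quadrant. The converse fails:
twins may even lie in different columns. -/
theorem sameNbhd_of_same_bubble (hc : B.col u = B.col v) (hr : (B.row u : ℕ) = B.row v)
    (hq : B.quadrant u = B.quadrant v) : SameNbhd B.graph u v := by
  intro w
  rw [closedAdj_iff, closedAdj_iff]
  unfold NextColumnAdj
  rw [hr, hq, hc]

theorem nonempty_bubbles_finite (j : Fin B.numCols) :
    {c : Fin (B.numRows j) × Quadrant | (B.bubble j c.1 c.2).Nonempty}.Finite :=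
  Set.toFinite _

theorem ncard_nonempty_bubbles_le (j : Fin B.numCols) :
    {c : Fin (B.numRows j) × Quadrant | (B.bubble j c.1 c.2).Nonempty}.ncard ≤ B.maxColumn :=
  Finset.le_sup (f := fun j : Fin B.numCols =>
    {c : Fin (B.numRows j) × Quadrant | (B.bubble j c.1 c.2).Nonempty}.ncard) (Finset.mem_univ j)

/-- A column meets at most as many classes of twins as it has non-empty bubbles. -/
theorem encard_classes_of_column_le (j : Fin B.numCols) (𝒰 : Set (Set V))
    (h : ∀ U ∈ 𝒰, ∃ u, B.col u = j ∧ U = {v | SameNbhd B.graph u v}) :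
    𝒰.encard ≤ B.maxColumn := by
  classical
  rcases isEmpty_or_nonempty V with hV | ⟨⟨v₀⟩⟩
  · have : 𝒰 = ∅ := by
      refine Set.eq_empty_of_forall_notMem fun U hU => ?_
      obtain ⟨u, -⟩ := h U hU
      exact hV.elim u
    simp [this]
  let g : Fin (B.numRows j) × Quadrant → Set V := fun c =>
    {v | SameNbhd B.graph (if hc : (B.bubble j c.1 c.2).Nonempty then hc.some else v₀) v}
  have hsub : 𝒰 ⊆ g '' {c | (B.bubble j c.1 c.2).Nonempty} := by
    intro U hU
    obtain ⟨u, rfl, rfl⟩ := h U hU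
    have hne : (B.bubble (B.col u) (B.row u) (B.quadrant u)).Nonempty := ⟨u, rfl, rfl, rfl⟩
    refine ⟨(B.row u, B.quadrant u), hne, ?_⟩
    obtain ⟨h1, h2, h3⟩ := hne.some_mem
    have hs := B.sameNbhd_of_same_bubble h1 h2 h3
    ext v
    simp only [g, dif_pos hne, Set.mem_ofPred_eq]
    exact ⟨hs.symm.trans, hs.trans⟩
  calc 𝒰.encard ≤ (g '' {c | (B.bubble j c.1 c.2).Nonempty}).encard := Set.encard_le_encard hsub
    _ ≤ {c : Fin (B.numRows j) × Quadrant | (B.bubble j c.1 c.2).Nonempty}.encard :=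
        Set.encard_image_le _ _
    _ = _ := (B.nonempty_bubbles_finite j).cast_ncard_eq.symm
    _ ≤ _ := by exact_mod_cast B.ncard_nonempty_bubbles_le j

/-- The smallest index of a column that contains a vertex with the closed neighbourhood of `v`. -/
noncomputable def level (v : V) : ℕ :=
  sInf ((fun w => (B.col w : ℕ)) '' {w | SameNbhd B.graph v w})

/-- Closed adjacency depends only on classes of twins, so it can be tested on these representatives,
whose columns are the levels. -/
theorem exists_col_eq_level (v : V) : ∃ w, SameNbhd B.graph v w ∧ (B.col w : ℕ) = B.level v :=
  Nat.sInf_mem (s := (fun w => (B.col w : ℕ)) '' {w | SameNbhd B.graph v w})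
    ⟨_, v, SameNbhd.refl _ v, rfl⟩

theorem level_congr (h : SameNbhd B.graph u v) : B.level u = B.level v := by
  unfold level
  congr 2
  ext w
  exact ⟨h.symm.trans, h.trans⟩

theorem closedAdj_of_level_eq (h : B.level u = B.level v) : ClosedAdj B.graph u v := by
  obtain ⟨u', hu, hu'⟩ := B.exists_col_eq_level u
  obtain ⟨v', hv, hv'⟩ := B.exists_col_eq_level v
  rw [hu.closedAdj_congr hv, closedAdj_iff]
  exact Or.inl (Fin.ext (by omega))

theorem level_near_of_adj (h : B.graph.Adj u v) :
    B.level u = B.level v ∨ B.level u = B.level v + 1 ∨ B.level v = B.level u + 1 := by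
  obtain ⟨u', hu, hu'⟩ := B.exists_col_eq_level u
  obtain ⟨v', hv, hv'⟩ := B.exists_col_eq_level v
  have := B.col_near_of_closedAdj ((hu.closedAdj_congr hv).1 (Or.inl h))
  omega

/-- The partition into the sets of vertices of the same level. -/
def levelPartition : Set (Set V) := (Setoid.ker B.level).classes

end ExtendedBubbleModel

/-- A graph whose vertices can be numbered injectively such that the numbers of adjacent vertices
are consecutive is acyclic. -/
theorem isAcyclic_of_adj_consecutive {V : Type*} {G : SimpleGraph V} (f : V → ℕ)
    (hf : Function.Injective f) (h : ∀ u v, G.Adj u v → f u = f v + 1 ∨ f v = f u + 1) :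
    G.IsAcyclic := by
  -- By injectivity, `s(u, v)` is the only edge between the vertices numbered at most `f u` and the
  -- others; once it is deleted, no walk leaves the former set.
  have key : ∀ u v, G.Adj u v → f v = f u + 1 →
      ¬ (G.deleteEdges {s(u, v)}).Reachable u v := by
    rintro u v - hfv ⟨p⟩
    have hp : ∀ {x y : V}, (G.deleteEdges {s(u, v)}).Walk x y → f x ≤ f u → f y ≤ f u := by
      intro x y p
      induction p with
      | nil => exact id
      | @cons a b c hab _ ih =>
        intro ha
        refine ih ?_
        rw [SimpleGraph.deleteEdges_adj] at hab
        rcases h _ _ hab.1 with h1 | h1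
        · omega
        · by_contra hb
          have e1 : a = u := hf (by omega)
          have e2 : b = v := hf (by omega)
          exact hab.2 (by rw [e1, e2]; rfl)
    have := hp p le_rfl
    omega
  rw [SimpleGraph.isAcyclic_iff_forall_adj_isBridge]
  intro u v huv
  rw [SimpleGraph.isBridge_iff]
  rcases h u v huv with h1 | h1
  · intro hr
    refine key v u huv.symm h1 ?_
    rw [Sym2.eq_swap]
    exact hr.symm
  · exact key u v huv h1

namespace ExtendedBubbleModel

variable {V : Type*} (B : ExtendedBubbleModel V)

theorem isBubblePartition_levelPartition (hG : B.graph.Connected) :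
    IsBubblePartition B.graph B.levelPartition where
  isPartition := Setoid.isPartition_classes _
  unionOfBubbles := by
    rintro X ⟨v, rfl⟩
    refine ⟨{U | IsBubble B.graph U ∧ U ⊆ {w | B.level w = B.level v}}, fun U hU => hU.1, ?_⟩
    refine Set.Subset.antisymm ?_ (Set.sUnion_subset fun U hU => hU.2)
    intro w hw
    refine ⟨{x | SameNbhd B.graph w x}, ⟨isBubble_setOf_sameNbhd _ w, ?_⟩, SameNbhd.refl _ w⟩
    intro x hx
    exact (B.level_congr hx).symm.trans hw
  isTree := by
    have hcls : ∀ v, {w | B.level w = B.level v} ∈ B.levelPartition := fun v => ⟨v, rfl⟩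
    let π : V → B.levelPartition := fun v => ⟨_, hcls v⟩
    have hπ : ∀ X : B.levelPartition, ∀ x ∈ (X : Set V), π x = X := by
      rintro ⟨X, v, rfl⟩ x hx
      refine Subtype.ext ?_
      change {w | B.level w = B.level x} = {w | B.level w = B.level v}
      have : B.level x = B.level v := hx
      rw [this]
    have hne : ∀ X : B.levelPartition, (X : Set V).Nonempty := by
      rintro ⟨X, v, rfl⟩
      exact ⟨v, rfl⟩
    have hreach : ∀ {u v : V}, B.graph.Walk u v →
        (contract B.graph B.levelPartition).Reachable (π u) (π v) := by
      intro u v p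
      induction p with
      | nil => exact SimpleGraph.Reachable.refl _
      | @cons a b c hab _ ih =>
        refine SimpleGraph.Reachable.trans ?_ ih
        by_cases e : π a = π b
        · rw [e]
        · exact SimpleGraph.Adj.reachable ⟨e, a, rfl, b, rfl, hab⟩
    constructor
    · obtain ⟨v₀⟩ := hG.nonempty
      have : Nonempty B.levelPartition := ⟨π v₀⟩
      refine SimpleGraph.Connected.mk fun X Y => ?_
      obtain ⟨x, hx⟩ := hne X
      obtain ⟨y, hy⟩ := hne Y
      rw [← hπ X x hx, ← hπ Y y hy]
      obtain ⟨p⟩ := hG.preconnected x y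
      exact hreach p
    -- A set is numbered by the common level of its elements. Distinct sets have distinct levels,
    -- and adjacent sets have consecutive ones.
    · have hlev : ∀ X : B.levelPartition, ∀ x ∈ (X : Set V), B.level (hne X).some = B.level x := by
        rintro ⟨X, v, rfl⟩ x hx
        have h1 : B.level (hne ⟨_, v, rfl⟩).some = B.level v :=
          (hne ⟨{w | B.level w = B.level v}, v, rfl⟩).some_mem
        exact h1.trans (Eq.symm hx)
      have hinj : Function.Injective fun X : B.levelPartition => B.level (hne X).some := by
        intro X Y hXY
        rw [← hπ X _ (hne X).some_mem, ← hπ Y _ (hne Y).some_mem]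
        refine Subtype.ext ?_
        change {w | B.level w = B.level _} = {w | B.level w = B.level _}
        rw [show B.level (hne X).some = B.level (hne Y).some from hXY]
      refine isAcyclic_of_adj_consecutive _ hinj ?_
      rintro X Y ⟨hXY, x, hx, y, hy, hxy⟩
      have h0 : B.level (hne X).some ≠ B.level (hne Y).some := fun e => hXY (hinj e)
      have := B.level_near_of_adj hxy
      rw [← hlev X x hx, ← hlev Y y hy] at this
      exact this.resolve_left h0

theorem independence_levelPartition_le : independence B.graph B.levelPartition ≤ 1 := by
  refine iSup₂_le fun X hX => ?_
  obtain ⟨v, rfl⟩ := hX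
  norm_cast
  refine csSup_le' ?_
  rintro m ⟨s, hs⟩
  rw [← hs.card_eq, Finset.card_le_one]
  intro a ha b hb
  by_contra hab
  refine hs.isIndepSet ha hb hab ?_
  have hl : B.level a = B.level b := Eq.trans a.2 (Eq.symm b.2)
  exact (B.closedAdj_of_level_eq hl).resolve_right fun e => hab (Subtype.ext e)

/-- Each class inside a level set has a representative in the one column of that level, and
twins-or-equal classes there are no more numerous than its non-empty bubbles. -/
theorem width_levelPartition_le : width B.graph B.levelPartition ≤ B.maxColumn := by
  refine iSup₂_le fun X hX => ?_
  obtain ⟨v, rfl⟩ := hX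
  obtain ⟨v', -, hv'⟩ := B.exists_col_eq_level v
  refine B.encard_classes_of_column_le (B.col v') _ ?_
  rintro U ⟨hU, hUX⟩
  obtain ⟨u, rfl⟩ := hU.exists_eq
  obtain ⟨u', hu, hu'⟩ := B.exists_col_eq_level u
  have hl : B.level u = B.level v := hUX (SameNbhd.refl _ u)
  refine ⟨u', Fin.ext (by omega), ?_⟩
  ext w
  exact ⟨hu.symm.trans, hu.trans⟩

theorem bw_one_le_maxColumn (hG : B.graph.Connected) : bw 1 B.graph ≤ B.maxColumn :=
  (iInf₂_le B.levelPartition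
    ⟨B.isBubblePartition_levelPartition hG,
      by exact_mod_cast B.independence_levelPartition_le⟩).trans
    B.width_levelPartition_le

/-- The restriction of a model to a set of vertices. -/
def restrict (s : Set V) : ExtendedBubbleModel s where
  numCols := B.numCols
  numCols_pos := B.numCols_pos
  numRows := B.numRows
  numRows_pos := B.numRows_pos
  col v := B.col v
  row v := B.row v
  quadrant v := B.quadrant v

theorem graph_restrict (s : Set V) : (B.restrict s).graph = B.graph.induce s := by
  ext u v
  change (u ≠ v ∧ _) ↔ ((u : V) ≠ v ∧ _)
  exact and_congr Subtype.coe_ne_coe.symm Iff.rfl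

theorem maxColumn_restrict_le (s : Set V) : (B.restrict s).maxColumn ≤ B.maxColumn := by
  refine Finset.sup_le fun j _ => le_trans ?_ (B.ncard_nonempty_bubbles_le j)
  refine Set.ncard_le_ncard ?_ (B.nonempty_bubbles_finite j)
  rintro c ⟨v, hv⟩
  exact ⟨v, hv⟩

/-- A clique contains at most twice as many classes of twins as a column has bubbles. -/
theorem card_le_two_mul_maxColumn (K : Finset V)
    (hK : ∀ u ∈ K, ∀ v ∈ K, ClosedAdj B.graph u v)
    (hd : ∀ u ∈ K, ∀ v ∈ K, SameNbhd B.graph u v → u = v) : K.card ≤ 2 * B.maxColumn := by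
  classical
  rcases K.eq_empty_or_nonempty with rfl | hne
  · simp
  -- Adjacent vertices are at most one column apart, so a clique lies in the leftmost column that it
  -- meets and the next one, if that exists.
  obtain ⟨v₀, hv₀, hmin⟩ := K.exists_min_image (fun v => (B.col v : ℕ)) hne
  have hcol : ∀ j : Fin B.numCols, (K.filter fun v => B.col v = j).card ≤ B.maxColumn := by
    intro j
    have h1 := B.encard_classes_of_column_le j
      ((fun u => {v | SameNbhd B.graph u v}) '' (K.filter fun v => B.col v = j : Finset V)) (by
        rintro U ⟨u, hu, rfl⟩
        exact ⟨u, (Finset.mem_filter.1 hu).2, rfl⟩)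
    rw [Set.InjOn.encard_image, Set.encard_coe_eq_coe_finsetCard] at h1
    · exact_mod_cast h1
    · intro u hu v hv huv
      have hu' := Finset.mem_filter.1 hu
      have hv' := Finset.mem_filter.1 hv
      refine hd u hu'.1 v hv'.1 ?_
      have : v ∈ {w | SameNbhd B.graph u w} := by
        rw [show {w | SameNbhd B.graph u w} = {w | SameNbhd B.graph v w} from huv]
        exact SameNbhd.refl _ v
      exact this
  have hnear : ∀ v ∈ K, B.col v = B.col v₀ ∨ (B.col v : ℕ) = B.col v₀ + 1 := by
    intro v hv
    have h1 := B.col_near_of_closedAdj (hK v hv v₀ hv₀)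
    have h2 := hmin v hv
    rcases h1 with h | h | h
    · exact Or.inl (Fin.ext h)
    · exact Or.inr h
    · omega
  by_cases hj : (B.col v₀ : ℕ) + 1 < B.numCols
  · have hsub : K ⊆ (K.filter fun v => B.col v = B.col v₀) ∪
        (K.filter fun v => B.col v = ⟨B.col v₀ + 1, hj⟩) := by
      intro v hv
      rw [Finset.mem_union, Finset.mem_filter, Finset.mem_filter]
      rcases hnear v hv with h | h
      · exact Or.inl ⟨hv, h⟩
      · exact Or.inr ⟨hv, Fin.ext h⟩
    have := (Finset.card_le_card hsub).trans (Finset.card_union_le _ _)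
    have h1 := hcol (B.col v₀)
    have h2 := hcol ⟨B.col v₀ + 1, hj⟩
    omega
  · have hsub : K ⊆ K.filter fun v => B.col v = B.col v₀ := by
      intro v hv
      rw [Finset.mem_filter]
      refine ⟨hv, (hnear v hv).resolve_right fun h => ?_⟩
      have := (B.col v).isLt
      omega
    have := Finset.card_le_card hsub
    have h1 := hcol (B.col v₀)
    omega

/-- Every non-empty set of vertices contains a vertex that is simplicial in the graph induced by
this set. -/
theorem exists_simplicial (R : Finset V) (hR : R.Nonempty) :
    ∃ v ∈ R, ∀ x ∈ R, ∀ y ∈ R, B.graph.Adj v x → B.graph.Adj v y → x ≠ y → B.graph.Adj x y := by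
  classical
  -- The vertex is leftmost, then of smallest row, then right-open if possible. Within its column it
  -- thus sees the least of the next column.
  obtain ⟨v, hv, hmin⟩ := R.exists_min_image (fun v => toLex ((B.col v : ℕ),
    toLex ((B.row v : ℕ), if (B.quadrant v).2 = true then 1 else 0))) hR
  refine ⟨v, hv, fun x hx y hy hvx hvy hxy => ⟨hxy, ?_⟩⟩
  have hcol : ∀ w ∈ R, (B.col v : ℕ) ≤ B.col w := by
    intro w hw
    have := hmin w hw
    rw [Prod.Lex.toLex_le_toLex] at this
    rcases this with h | h
    · exact h.le
    · exact h.1.le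
  have hrow : ∀ w ∈ R, B.col w = B.col v → (B.row v : ℕ) < B.row w ∨
      (B.row v : ℕ) = B.row w ∧ ((B.quadrant v).2 = true → (B.quadrant w).2 = true) := by
    intro w hw hwv
    have := hmin w hw
    rw [Prod.Lex.toLex_le_toLex] at this
    rcases this with h | h
    · exact absurd h (by simp [hwv])
    · have h := h.2
      rw [Prod.Lex.toLex_le_toLex] at h
      refine h.imp id (And.imp id fun h' hq => ?_)
      by_contra hn
      simp [hq, hn] at h'
  -- By minimality of `v`, every remaining vertex in the column of `v` sees all the neighbours of
  -- `v` in the next column.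
  have hnext : ∀ a ∈ R, ∀ b, B.col a = B.col v → B.NextColumnAdj b v → B.NextColumnAdj b a := by
    rintro a ha b hav ⟨h1, h2⟩
    refine ⟨by rw [hav]; exact h1, ?_⟩
    rcases hrow a ha hav with h3 | ⟨h3, h4⟩
    · left
      rcases h2 with h2 | h2 <;> omega
    · rcases h2 with h2 | ⟨h2, h5, h6⟩
      · left
        omega
      · right
        exact ⟨h2.trans h3, h5, h4 h6⟩
  have hcase : ∀ w ∈ R, B.graph.Adj v w → B.col w = B.col v ∨ B.NextColumnAdj w v := by
    rintro w hw ⟨-, h | h | h⟩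
    · exact Or.inl h.symm
    · have := hcol w hw
      have := h.1
      omega
    · exact Or.inr h
  rcases hcase x hx hvx with h1 | h1 <;> rcases hcase y hy hvy with h2 | h2
  · exact Or.inl (h1.trans h2.symm)
  · exact Or.inr (Or.inr (hnext x hx y h1 h2))
  · exact Or.inr (Or.inl (hnext y hy x h2 h1))
  · exact Or.inl (Fin.ext (h1.1.trans h2.1.symm))

end ExtendedBubbleModel

/-! ### Bubble models of mixed unit interval graphs -/

theorem unitIntervalAt_inter_nonempty_iff {a b : ℝ} {l r l' r' : Bool} :
    (unitIntervalAt a l r ∩ unitIntervalAt b l' r').Nonempty ↔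
      |a - b| < 1 ∨ (a = b + 1 ∧ l = true ∧ r' = true) ∨ (b = a + 1 ∧ l' = true ∧ r = true) := by
  constructor
  · rintro ⟨x, h1, h2⟩
    simp only [unitIntervalAt, Set.mem_ofPred_eq] at h1 h2
    by_contra hn
    push Not at hn
    obtain ⟨h3, h4, h5⟩ := hn
    rcases le_abs.1 h3 with h | h
    · rcases h1 with h1 | ⟨rfl, h1⟩ | ⟨rfl, h1⟩
      · rcases h2 with h2 | ⟨rfl, h2⟩ | ⟨rfl, h2⟩ <;> linarith
      · rcases h2 with h2 | ⟨h2, h2'⟩ | ⟨rfl, h2'⟩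
        · linarith
        · linarith
        · exact absurd h2' (h4 rfl h1)
      · rcases h2 with h2 | ⟨rfl, h2⟩ | ⟨h2', h2⟩ <;> linarith
    · rcases h2 with h2 | ⟨rfl, h2⟩ | ⟨rfl, h2⟩
      · rcases h1 with h1 | ⟨rfl, h1⟩ | ⟨rfl, h1⟩ <;> linarith
      · rcases h1 with h1 | ⟨h1, h1'⟩ | ⟨rfl, h1'⟩
        · linarith
        · linarith
        · exact absurd h1' (h5 rfl h2)
      · rcases h1 with h1 | ⟨rfl, h1⟩ | ⟨h1', h1⟩ <;> linarith
  · rintro (h | ⟨rfl, h1, h2⟩ | ⟨rfl, h1, h2⟩)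
    · rw [abs_lt] at h
      -- The midpoint between the centres of the two intervals is interior to both.
      refine ⟨(a + b + 1) / 2, Or.inl ?_, Or.inl ?_⟩ <;> constructor <;> linarith
    · exact ⟨b + 1, Or.inr (Or.inl ⟨rfl, h1⟩), Or.inr (Or.inr ⟨rfl, h2⟩)⟩
    · exact ⟨a + 1, Or.inr (Or.inr ⟨rfl, h2⟩), Or.inr (Or.inl ⟨rfl, h1⟩)⟩

/-- The number of elements with a smaller value. -/
theorem card_filter_lt_lt_iff {V : Type*} [Fintype V] (f : V → ℝ) (u v : V) :
    (Finset.univ.filter fun w => f w < f u).card < (Finset.univ.filter fun w => f w < f v).card ↔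
      f u < f v := by
  have hmono : ∀ u v, f u ≤ f v → (Finset.univ.filter fun w => f w < f u) ⊆
      (Finset.univ.filter fun w => f w < f v) := by
    intro u v h w hw
    simp only [Finset.mem_filter, Finset.mem_univ, true_and] at hw ⊢
    linarith
  constructor
  · intro h
    by_contra hn
    exact absurd (Finset.card_le_card (hmono v u (not_lt.1 hn))) (not_le.2 h)
  · intro h
    refine Finset.card_lt_card ⟨hmono u v h.le, fun hsub => ?_⟩
    have : u ∈ Finset.univ.filter fun w => f w < f u := hsub (by simpa using h)
    simp at this

/-- Left ends with equal integer parts differ by less than one, so the intervals meet. If the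
integer parts differ by one, the fractional parts decide, and in case of a tie the two touching
ends. If they differ by more, the intervals are disjoint. -/
theorem IsMixedUnitInterval.exists_model {V : Type*} [Finite V] {G : SimpleGraph V}
    (hG : IsMixedUnitInterval G) : ∃ B : ExtendedBubbleModel V, B.graph = G := by
  classical
  have := Fintype.ofFinite V
  obtain ⟨a, l, r, h⟩ := hG
  -- Finitely many vertices have bounded integer parts; shifting by `lo` makes them valid column
  -- indices.
  obtain ⟨lo, hlo⟩ := (Set.finite_range fun v => ⌊a v⌋).bddBelow
  obtain ⟨hi, hhi⟩ := (Set.finite_range fun v => ⌊a v⌋).bddAbove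
  have hlo' : ∀ v, lo ≤ ⌊a v⌋ := fun v => hlo ⟨v, rfl⟩
  have hhi' : ∀ v, ⌊a v⌋ ≤ hi := fun v => hhi ⟨v, rfl⟩
  let B : ExtendedBubbleModel V :=
    { numCols := (hi - lo).toNat + 1
      numCols_pos := Nat.succ_pos _
      numRows := fun _ => Fintype.card V + 1
      numRows_pos := fun _ => Nat.succ_pos _
      col := fun v => ⟨(⌊a v⌋ - lo).toNat, by have := hlo' v; have := hhi' v; omega⟩
      row := fun v => ⟨(Finset.univ.filter fun w => Int.fract (a w) < Int.fract (a v)).card,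
        Nat.lt_succ_of_le (Finset.card_le_univ _)⟩
      quadrant := fun v => (l v, r v) }
  have hcol : ∀ v, ((B.col v : ℕ) : ℤ) = ⌊a v⌋ - lo := fun v => by
    have := hlo' v
    change (((⌊a v⌋ - lo).toNat : ℕ) : ℤ) = _
    omega
  have hlt : ∀ u v, (B.row u : ℕ) < B.row v ↔ Int.fract (a u) < Int.fract (a v) :=
    fun u v => card_filter_lt_lt_iff (fun w => Int.fract (a w)) u v
  have heq : ∀ u v, (B.row u : ℕ) = B.row v ↔ Int.fract (a u) = Int.fract (a v) := by
    intro u v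
    have h1 := hlt u v
    have h2 := hlt v u
    constructor
    · intro e
      have h3 : ¬ Int.fract (a u) < Int.fract (a v) := fun h => by have := h1.2 h; omega
      have h4 : ¬ Int.fract (a v) < Int.fract (a u) := fun h => by have := h2.2 h; omega
      linarith
    · intro e
      have h3 : ¬ (B.row u : ℕ) < B.row v := fun h => by have := h1.1 h; linarith
      have h4 : ¬ (B.row v : ℕ) < B.row u := fun h => by have := h2.1 h; linarith
      omega
  have hnext : ∀ u v, B.NextColumnAdj u v ↔ ⌊a u⌋ = ⌊a v⌋ + 1 ∧
      (a u - a v < 1 ∨ (a u = a v + 1 ∧ l u = true ∧ r v = true)) := by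
    intro u v
    unfold ExtendedBubbleModel.NextColumnAdj
    rw [hlt, heq]
    have h1 := hcol u
    have h2 := hcol v
    have h3 : (B.col u : ℕ) = B.col v + 1 ↔ ⌊a u⌋ = ⌊a v⌋ + 1 := by omega
    rw [h3]
    refine and_congr_right fun hf => ?_
    have hf' : (⌊a u⌋ : ℝ) = ⌊a v⌋ + 1 := by exact_mod_cast hf
    have e1 := Int.floor_add_fract (a u)
    have e2 := Int.floor_add_fract (a v)
    refine or_congr ?_ (and_congr ?_ Iff.rfl)
    · constructor <;> intro h <;> linarith
    · constructor <;> intro h <;> linarith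
  refine ⟨B, ?_⟩
  ext u v
  rw [h u v, unitIntervalAt_inter_nonempty_iff]
  change (u ≠ v ∧ _) ↔ _
  rw [hnext, hnext]
  refine and_congr_right fun _ => ?_
  have hc : B.col u = B.col v ↔ ⌊a u⌋ = ⌊a v⌋ := by
    have h1 := hcol u
    have h2 := hcol v
    rw [Fin.ext_iff]
    omega
  rw [hc, abs_lt]
  have f1 := Int.floor_le (a u)
  have f2 := Int.lt_floor_add_one (a u)
  have f3 := Int.floor_le (a v)
  have f4 := Int.lt_floor_add_one (a v)
  constructor
  · rintro (e | ⟨e, h | h⟩ | ⟨e, h | h⟩)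
    · have e' : (⌊a u⌋ : ℝ) = ⌊a v⌋ := by exact_mod_cast e
      left
      constructor <;> linarith
    · have e' : (⌊a u⌋ : ℝ) = ⌊a v⌋ + 1 := by exact_mod_cast e
      left
      constructor <;> linarith
    · exact Or.inr (Or.inl h)
    · have e' : (⌊a v⌋ : ℝ) = ⌊a u⌋ + 1 := by exact_mod_cast e
      left
      constructor <;> linarith
    · exact Or.inr (Or.inr h)
  · rintro (⟨h1, h2⟩ | h | h)
    · have g1 : ⌊a u⌋ < ⌊a v⌋ + 2 := by
        have : (⌊a u⌋ : ℝ) < ((⌊a v⌋ + 2 : ℤ) : ℝ) := by push_cast; linarith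
        exact_mod_cast this
      have g2 : ⌊a v⌋ < ⌊a u⌋ + 2 := by
        have : (⌊a v⌋ : ℝ) < ((⌊a u⌋ + 2 : ℤ) : ℝ) := by push_cast; linarith
        exact_mod_cast this
      have g3 : ⌊a u⌋ = ⌊a v⌋ ∨ ⌊a u⌋ = ⌊a v⌋ + 1 ∨ ⌊a v⌋ = ⌊a u⌋ + 1 := by omega
      rcases g3 with e | e | e
      · exact Or.inl e
      · exact Or.inr (Or.inl ⟨e, Or.inl (by linarith)⟩)
      · exact Or.inr (Or.inr ⟨e, Or.inl (by linarith)⟩)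
    · refine Or.inr (Or.inl ⟨?_, Or.inr h⟩)
      rw [h.1, Int.floor_add_one]
    · refine Or.inr (Or.inr ⟨?_, Or.inr h⟩)
      rw [h.1, Int.floor_add_one]

/-- The set that defines `p G` is non-empty by `exists_model`, so its infimum is attained and is not
the default value zero of an empty infimum. -/
theorem IsMixedUnitInterval.exists_maxColumn_eq_p {V : Type*} [Finite V] {G : SimpleGraph V}
    (hG : IsMixedUnitInterval G) :
    ∃ B : ExtendedBubbleModel V, B.graph = G ∧ B.maxColumn = p G := by
  obtain ⟨B, hB⟩ := hG.exists_model
  exact Nat.sInf_mem (s := {w | ∃ B : ExtendedBubbleModel V, B.graph = G ∧ B.maxColumn = w})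
    ⟨_, B, hB, rfl⟩

theorem IsMixedUnitInterval.bw_one_le_p {V : Type*} [Finite V] {G : SimpleGraph V}
    (hG : IsMixedUnitInterval G) (hc : G.Connected) : bw 1 G ≤ p G := by
  obtain ⟨B, rfl, hB⟩ := hG.exists_maxColumn_eq_p
  rw [← hB]
  exact B.bw_one_le_maxColumn hc

theorem IsMixedUnitInterval.bw_one_induce_le_p {V : Type*} [Finite V] {G : SimpleGraph V}
    (hG : IsMixedUnitInterval G) (K : G.ConnectedComponent) :
    bw 1 (G.induce K.supp) ≤ p G := by
  obtain ⟨B, rfl, hB⟩ := hG.exists_maxColumn_eq_p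
  rw [← hB, ← B.graph_restrict]
  refine ((B.restrict K.supp).bw_one_le_maxColumn ?_).trans
    (by exact_mod_cast B.maxColumn_restrict_le _)
  rw [B.graph_restrict]
  exact K.connected_toSimpleGraph

/-! ### Binary lengths -/

theorem size_le_self (x : ℕ) : x.size ≤ x :=
  Nat.size_le.2 Nat.lt_two_pow_self

theorem size_add_le (x y : ℕ) : (x + y).size ≤ x.size + y.size + 1 := by
  rw [Nat.size_le]
  have hx := Nat.lt_size_self x
  have hy := Nat.lt_size_self y
  have h1 : 2 ^ x.size ≤ 2 ^ (x.size + y.size) := Nat.pow_le_pow_right (by norm_num) (by omega)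
  have h2 : 2 ^ y.size ≤ 2 ^ (x.size + y.size) := Nat.pow_le_pow_right (by norm_num) (by omega)
  rw [pow_succ]
  omega

theorem size_mul_le (x y : ℕ) : (x * y).size ≤ x.size + y.size := by
  rw [Nat.size_le, pow_add]
  exact Nat.mul_lt_mul'' (Nat.lt_size_self x) (Nat.lt_size_self y)

theorem RamOp.size_apply_le (o : RamOp) (x y : ℕ) : (o.apply x y).size ≤ x.size + y.size + 1 := by
  cases o
  · exact size_add_le x y
  · exact (Nat.size_le_size (Nat.sub_le x y)).trans (by omega)
  · exact (size_mul_le x y).trans (by omega)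
  · exact (Nat.size_le_size (Nat.div_le_self x y)).trans (by omega)

theorem size_sum_range_le (f : ℕ → ℕ) (m z : ℕ) (h : ∀ i < m, (f i).size ≤ z) :
    (∑ i ∈ Finset.range m, f i).size ≤ m + z := by
  induction m with
  | zero => simp
  | succ m ih =>
    rw [Finset.sum_range_succ, Nat.size_le]
    have h1 := Nat.size_le.1 (ih fun i hi => h i (by omega))
    have h2 := Nat.size_le.1 (h m (by omega))
    have h3 : 2 ^ z ≤ 2 ^ (m + z) := Nat.pow_le_pow_right (by norm_num) (by omega)
    rw [show m + 1 + z = m + z + 1 by omega, pow_succ]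
    omega

theorem size_prod_range_le (f : ℕ → ℕ) (m z : ℕ) (h : ∀ i < m, (f i).size ≤ z) :
    (∏ i ∈ Finset.range m, f i).size ≤ m * z + 1 := by
  induction m with
  | zero => simp
  | succ m ih =>
    rw [Finset.prod_range_succ]
    refine (size_mul_le _ _).trans ?_
    have h1 := ih fun i hi => h i (by omega)
    have h2 := h m (by omega)
    rw [add_mul]
    omega

/-- The number `1` if `q` holds, and `0` otherwise. -/
noncomputable def ind (q : Prop) : ℕ :=
  open Classical in if q then 1 else 0

theorem ind_true {q : Prop} (h : q) : ind q = 1 := if_pos h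

theorem ind_false {q : Prop} (h : ¬ q) : ind q = 0 := if_neg h

theorem ind_le_one (q : Prop) : ind q ≤ 1 := by
  by_cases h : q
  · rw [ind_true h]
  · rw [ind_false h]
    exact Nat.zero_le _

/-! ### Functions computed by a random access machine in polynomial time -/

/-- A class of situations, given by their parameters `γ`, in which a program may be run: register
`0` holds `n γ`, the memory is `mem γ`, and the values of `len` further variables are held in
registers. All these numbers are at most `size γ` bits long. -/
structure Ctx (Γ : Type) where
  ok : Γ → Prop
  size : Γ → ℕ
  n : Γ → ℕ
  mem : Γ → ℕ → ℕ
  len : ℕ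
  var : ℕ → Γ → ℕ
  n_le : ∀ γ, ok γ → n γ ≤ size γ
  size_mem_le : ∀ γ, ok γ → ∀ x, (mem γ x).size ≤ size γ
  size_var_le : ∀ γ, ok γ → ∀ j < len, (var j γ).size ≤ size γ

namespace Ctx

variable {Γ : Type} (C : Ctx Γ)

/-- The context with a further variable, which ranges over the numbers below `n`. -/
def ext : Ctx (Γ × ℕ) where
  ok p := C.ok p.1 ∧ p.2 < C.n p.1
  size p := C.size p.1
  n p := C.n p.1
  mem p := C.mem p.1
  len := C.len + 1
  var j p := match j with
    | 0 => p.2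
    | j + 1 => C.var j p.1
  n_le p h := C.n_le p.1 h.1
  size_mem_le p h := C.size_mem_le p.1 h.1
  size_var_le p h j hj := match j with
    | 0 => (size_le_self _).trans (h.2.le.trans (C.n_le p.1 h.1))
    | j + 1 => C.size_var_le p.1 h.1 j (Nat.lt_of_succ_lt_succ hj)

/-- Bounded by a polynomial in the size of the situation. -/
def Poly (f : Γ → ℕ) : Prop :=
  ∃ c, ∀ γ, C.ok γ → f γ ≤ (C.size γ + 2) ^ c

variable {C}

theorem Poly.mono {f g : Γ → ℕ} (hg : C.Poly g) (h : ∀ γ, C.ok γ → f γ ≤ g γ) : C.Poly f :=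
  hg.imp fun _ hc γ hγ => (h γ hγ).trans (hc γ hγ)

theorem Poly.const (a : ℕ) : C.Poly fun _ => a :=
  ⟨a, fun _ _ => Nat.lt_two_pow_self.le.trans (Nat.pow_le_pow_left (by omega) a)⟩

theorem Poly.size : C.Poly C.size :=
  ⟨1, fun _ _ => by rw [pow_one]; omega⟩

theorem Poly.mul {f g : Γ → ℕ} (hf : C.Poly f) (hg : C.Poly g) : C.Poly fun γ => f γ * g γ := by
  obtain ⟨a, ha⟩ := hf
  obtain ⟨b, hb⟩ := hg
  exact ⟨a + b, fun γ hγ => by rw [pow_add]; exact Nat.mul_le_mul (ha γ hγ) (hb γ hγ)⟩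

theorem Poly.add {f g : Γ → ℕ} (hf : C.Poly f) (hg : C.Poly g) : C.Poly fun γ => f γ + g γ := by
  obtain ⟨a, ha⟩ := hf
  obtain ⟨b, hb⟩ := hg
  refine ⟨a + b + 1, fun γ hγ => ?_⟩
  have h1 : (C.size γ + 2) ^ a ≤ (C.size γ + 2) ^ (a + b) :=
    Nat.pow_le_pow_right (by omega) (by omega)
  have h2 : (C.size γ + 2) ^ b ≤ (C.size γ + 2) ^ (a + b) :=
    Nat.pow_le_pow_right (by omega) (by omega)
  calc f γ + g γ ≤ (C.size γ + 2) ^ (a + b) * 2 := by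
        have := ha γ hγ
        have := hb γ hγ
        omega
    _ ≤ (C.size γ + 2) ^ (a + b + 1) := by
        rw [pow_succ]
        exact Nat.mul_le_mul_left _ (by omega)

theorem Poly.n : C.Poly C.n := Poly.size.mono C.n_le

/-- Extending a context by a bounded variable leaves the size unchanged, so a polynomial bound is
automatically uniform in that variable. This bounds the rounds of a loop all at once. -/
theorem Poly.of_ext {f : Γ × ℕ → ℕ} (hf : C.ext.Poly f) :
    ∃ g : Γ → ℕ, C.Poly g ∧ ∀ γ, C.ok γ → ∀ i < C.n γ, f (γ, i) ≤ g γ := by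
  obtain ⟨c, hc⟩ := hf
  exact ⟨fun γ => (C.size γ + 2) ^ c, ⟨c, fun _ _ => le_rfl⟩, fun γ hγ i hi => hc (γ, i) ⟨hγ, hi⟩⟩

theorem Poly.comp_fst {f : Γ → ℕ} (hf : C.Poly f) : C.ext.Poly fun p => f p.1 :=
  hf.imp fun _ hc p hp => hc p.1 hp.1

variable (C)

/-- The state `s` is as described by `γ`, with the variables held in the registers `loc` below
`k`. -/
structure Holds (loc : ℕ → ℕ) (k : ℕ) (γ : Γ) (s : RamState) : Prop where
  pos : 0 < k
  reg_zero : s.reg 0 = C.n γ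
  mem_eq : s.mem = C.mem γ
  loc_lt : ∀ j < C.len, loc j < k
  reg_loc : ∀ j < C.len, s.reg (loc j) = C.var j γ

end Ctx

/-- Started in `s`, the program halts at cost at most `T` with `x` in register `k`, and changes
neither the memory nor the registers below `k`. -/
def Evaluates (P : RamProg) (s : RamState) (k T x : ℕ) : Prop :=
  ∃ t s', P.Runs s t s' ∧ t ≤ T ∧ s'.mem = s.mem ∧ (∀ j < k, s'.reg j = s.reg j) ∧ s'.reg k = x

namespace Ctx

variable {Γ : Type} (C : Ctx Γ)

/-- There is a program that computes `F` in polynomial time from the variables and the memory. -/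
def Computable (F : Γ → ℕ) : Prop :=
  C.Poly (fun γ => (F γ).size) ∧ ∃ (P : (ℕ → ℕ) → ℕ → RamProg) (T : Γ → ℕ), C.Poly T ∧
    ∀ loc k γ s, C.ok γ → C.Holds loc k γ s → Evaluates (P loc k) s k (T γ) (F γ)

/-- There is a program that decides `q` in polynomial time from the variables and the memory. -/
def Decides (q : Γ → Prop) : Prop :=
  C.Computable fun γ => ind (q γ)

variable {C}

theorem Holds.of_agree {loc : ℕ → ℕ} {k k' : ℕ} {γ : Γ} {s s' : RamState} (h : C.Holds loc k γ s)
    (hk : k ≤ k') (hm : s'.mem = s.mem) (hr : ∀ j < k, s'.reg j = s.reg j) :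
    C.Holds loc k' γ s' where
  pos := h.pos.trans_le hk
  reg_zero := (hr 0 h.pos).trans h.reg_zero
  mem_eq := hm.trans h.mem_eq
  loc_lt j hj := (h.loc_lt j hj).trans_le hk
  reg_loc j hj := (hr _ (h.loc_lt j hj)).trans (h.reg_loc j hj)

theorem Computable.congr {F F' : Γ → ℕ} (hF : C.Computable F) (h : ∀ γ, C.ok γ → F γ = F' γ) :
    C.Computable F' := by
  obtain ⟨hZ, P, T, hT, hP⟩ := hF
  refine ⟨hZ.mono fun γ hγ => by rw [h γ hγ], P, T, hT, fun loc k γ s hγ hs => ?_⟩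
  rw [← h γ hγ]
  exact hP loc k γ s hγ hs

theorem Decides.congr {q q' : Γ → Prop} (hq : C.Decides q) (h : ∀ γ, C.ok γ → (q γ ↔ q' γ)) :
    C.Decides q' :=
  Computable.congr hq fun γ hγ => by rw [propext (h γ hγ)]

/-! ### Closure properties of polynomial-time computability -/

theorem Computable.const (a : ℕ) : C.Computable fun _ => a := by
  refine ⟨Poly.const _, fun _ k => .const k a, fun _ => 1 + a.size, Poly.const _,
    fun loc k γ s _ _ => ⟨_, _, .const k a s, le_rfl, rfl, fun j hj => ?_, ?_⟩⟩
  · exact Function.update_of_ne (by omega) _ _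
  · exact Function.update_self _ _ _

/-- Copies register `a` to register `k`. -/
def copyProg (k a : ℕ) : RamProg :=
  .seq (.const k 0) (.arith .add k a k)

theorem runs_copyProg (k a : ℕ) (hk : a ≠ k) (s : RamState) :
    (copyProg k a).Runs s (2 + (s.reg a).size) ⟨Function.update s.reg k (s.reg a), s.mem⟩ := by
  have h := RamProg.Runs.seq (.const k 0 s) (.arith .add k a k _)
  have e1 : (Function.update s.reg k 0) a = s.reg a := Function.update_of_ne hk _ _
  have e2 : (Function.update s.reg k 0) k = 0 := Function.update_self _ _ _
  simp only [e1, e2, RamOp.apply, add_zero, Function.update_idem, Nat.size_zero] at h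
  rw [show 2 + (s.reg a).size = 1 + (1 + (s.reg a).size) by omega]
  exact h

theorem evaluates_copyProg (k a : ℕ) (hk : a < k) (s : RamState) :
    Evaluates (copyProg k a) s k (2 + (s.reg a).size) (s.reg a) :=
  ⟨_, _, runs_copyProg k a hk.ne s, le_rfl, rfl, fun _ hj => Function.update_of_ne hj.ne _ _,
    Function.update_self _ _ _⟩

theorem Computable.var (j : ℕ) (hj : j < C.len) : C.Computable (C.var j) := by
  refine ⟨Poly.size.mono fun γ hγ => C.size_var_le γ hγ j hj, fun loc k => copyProg k (loc j),
    fun γ => 2 + C.size γ, (Poly.const 2).add Poly.size, fun loc k γ s hγ hs => ?_⟩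
  obtain ⟨t, s', h1, h2, h3⟩ := evaluates_copyProg k (loc j) (hs.loc_lt j hj) s
  rw [hs.reg_loc j hj] at h2 h3
  have := C.size_var_le γ hγ j hj
  exact ⟨t, s', h1, by dsimp only; omega, h3⟩

theorem Computable.n : C.Computable C.n := by
  refine ⟨Poly.size.mono fun γ hγ => (size_le_self _).trans (C.n_le γ hγ), fun _ k => copyProg k 0,
    fun γ => 2 + C.size γ, (Poly.const 2).add Poly.size, fun loc k γ s hγ hs => ?_⟩
  obtain ⟨t, s', h1, h2, h3⟩ := evaluates_copyProg k 0 hs.pos s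
  rw [hs.reg_zero] at h2 h3
  have := (size_le_self (C.n γ)).trans (C.n_le γ hγ)
  exact ⟨t, s', h1, by dsimp only; omega, h3⟩

/-- The new variable has index zero, so the old program is reused with the register assignment
shifted by one. -/
theorem Computable.fst {F : Γ → ℕ} (hF : C.Computable F) : C.ext.Computable fun p => F p.1 := by
  obtain ⟨hZ, P, T, hT, hP⟩ := hF
  refine ⟨hZ.comp_fst, fun loc k => P (fun j => loc (j + 1)) k, fun p => T p.1, hT.comp_fst,
    fun loc k p s hp hs => hP _ k p.1 s hp.1 ?_⟩
  exact ⟨hs.pos, hs.reg_zero, hs.mem_eq, fun j hj => hs.loc_lt (j + 1) (Nat.succ_lt_succ hj),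
    fun j hj => hs.reg_loc (j + 1) (Nat.succ_lt_succ hj)⟩

theorem Computable.snd : C.ext.Computable fun p => p.2 :=
  Computable.var (C := C.ext) 0 (Nat.succ_pos _)

/-- The first value waits in register `k` while the second is computed from `k + 1` upwards. The
cost of the operation itself is controlled by the bound on bit lengths that is part of `Computable`.
-/
theorem Computable.op (o : RamOp) {F F' : Γ → ℕ} (hF : C.Computable F) (hF' : C.Computable F') :
    C.Computable fun γ => o.apply (F γ) (F' γ) := by
  obtain ⟨hZ, P, T, hT, hP⟩ := hF
  obtain ⟨hZ', P', T', hT', hP'⟩ := hF'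
  refine ⟨((hZ.add hZ').add (Poly.const 1)).mono fun γ _ => o.size_apply_le _ _,
    fun loc k => .seq (P loc k) (.seq (P' loc (k + 1)) (.arith o k k (k + 1))),
    fun γ => T γ + (T' γ + (1 + (F γ).size + (F' γ).size)),
    hT.add (hT'.add (((Poly.const 1).add hZ).add hZ')), fun loc k γ s hγ hs => ?_⟩
  obtain ⟨t₁, s₁, r₁, c₁, m₁, p₁, v₁⟩ := hP loc k γ s hγ hs
  obtain ⟨t₂, s₂, r₂, c₂, m₂, p₂, v₂⟩ := hP' loc (k + 1) γ s₁ hγ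
    (hs.of_agree (Nat.le_succ k) m₁ p₁)
  have e : s₂.reg k = F γ := (p₂ k (Nat.lt_succ_self k)).trans v₁
  refine ⟨_, _, .seq r₁ (.seq r₂ (.arith o k k (k + 1) s₂)), ?_, m₂.trans m₁, fun j hj => ?_, ?_⟩
  · rw [e, v₂]
    dsimp only
    omega
  · exact (Function.update_of_ne hj.ne _ _).trans ((p₂ j (by omega)).trans (p₁ j hj))
  · dsimp only
    rw [← e, ← v₂]
    exact Function.update_self _ _ _

theorem Computable.add {F F' : Γ → ℕ} (hF : C.Computable F) (hF' : C.Computable F') :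
    C.Computable fun γ => F γ + F' γ := Computable.op .add hF hF'

theorem Computable.sub {F F' : Γ → ℕ} (hF : C.Computable F) (hF' : C.Computable F') :
    C.Computable fun γ => F γ - F' γ := Computable.op .sub hF hF'

theorem Computable.mul {F F' : Γ → ℕ} (hF : C.Computable F) (hF' : C.Computable F') :
    C.Computable fun γ => F γ * F' γ := Computable.op .mul hF hF'

theorem Computable.div {F F' : Γ → ℕ} (hF : C.Computable F) (hF' : C.Computable F') :
    C.Computable fun γ => F γ / F' γ := Computable.op .div hF hF'

theorem Computable.load {F : Γ → ℕ} (hF : C.Computable F) :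
    C.Computable fun γ => C.mem γ (F γ) := by
  obtain ⟨hZ, P, T, hT, hP⟩ := hF
  refine ⟨Poly.size.mono fun γ hγ => C.size_mem_le γ hγ _,
    fun loc k => .seq (P loc k) (.load k k), fun γ => T γ + (1 + (F γ).size + C.size γ),
    hT.add (((Poly.const 1).add hZ).add Poly.size), fun loc k γ s hγ hs => ?_⟩
  obtain ⟨t₁, s₁, r₁, c₁, m₁, p₁, v₁⟩ := hP loc k γ s hγ hs
  refine ⟨_, _, .seq r₁ (.load k k s₁), ?_, m₁, fun j hj => ?_, ?_⟩
  · rw [v₁, m₁, hs.mem_eq]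
    have := C.size_mem_le γ hγ (F γ)
    dsimp only
    omega
  · exact (Function.update_of_ne hj.ne _ _).trans (p₁ j hj)
  · dsimp only
    rw [← v₁, ← hs.mem_eq, ← m₁]
    exact Function.update_self _ _ _

/-- One round of `foldProg`. -/
def foldBody (o : RamOp) (Q : RamProg) (k : ℕ) : RamProg :=
  .seq Q (.seq (.arith o k k (k + 3)) (.seq (.const (k + 3) 1)
    (.seq (.arith .add (k + 1) (k + 1) (k + 3)) (.arith .sub (k + 2) (k + 2) (k + 3)))))

/-- Computes in register `k` the value `(init o x₀) o x₁ o … o xₙ₋₁` for `n` in register `0`, where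
`Q` computes `xᵢ` in register `k + 3` from `i` in register `k + 1`. -/
def foldProg (o : RamOp) (init : ℕ) (Q : RamProg) (k : ℕ) : RamProg :=
  .seq (.const k init) (.seq (.const (k + 1) 0) (.seq (copyProg (k + 2) 0)
    (.loop (k + 2) (foldBody o Q k))))

/-- Register `k + 3` first holds the operand and, once that is consumed, the constant one that
updates both counters. -/
theorem runs_foldBody (o : RamOp) {Q : RamProg} {k t : ℕ} {s s' : RamState} (h : Q.Runs s t s') :
    (foldBody o Q k).Runs s
      (t + ((1 + (s'.reg k).size + (s'.reg (k + 3)).size) + (2 + ((2 + (s'.reg (k + 1)).size) +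
        (2 + (s'.reg (k + 2)).size)))))
      ⟨fun j => if j = k then o.apply (s'.reg k) (s'.reg (k + 3)) else if j = k + 3 then 1 else
        if j = k + 1 then s'.reg (k + 1) + 1 else if j = k + 2 then s'.reg (k + 2) - 1 else
        s'.reg j, s'.mem⟩ := by
  have h' := RamProg.Runs.seq h (.seq (.arith o k k (k + 3) s') (.seq (.const (k + 3) 1 _)
    (.seq (.arith .add (k + 1) (k + 1) (k + 3) _) (.arith .sub (k + 2) (k + 2) (k + 3) _))))
  convert h' using 1
  · rfl
  · simp [RamOp.apply]
    omega
  · refine congrArg (fun r => RamState.mk r s'.mem) (funext fun j => ?_)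
    simp only [Function.update_apply, RamOp.apply]
    split_ifs <;> omega

/-- Induction on the number `r` of remaining rounds. `Inv` stands for whatever `Q` relies on; it
survives a round because it depends only on the memory and on registers below `k`. A round costs at
most `U` for `Q` and `8` for the fixed costs, plus five numbers of length at most `z`: accumulator,
operand, index, and the remaining count twice. -/
theorem exists_runs_foldLoop (o : RamOp) (Q : RamProg) (k m U z : ℕ) (A x : ℕ → ℕ)
    (Inv : RamState → Prop)
    (hInv : ∀ s s' : RamState, Inv s → s'.mem = s.mem → (∀ j < k, s'.reg j = s.reg j) → Inv s')
    (hA : ∀ i < m, A (i + 1) = o.apply (A i) (x i)) (hz : ∀ i ≤ m, (A i).size ≤ z)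
    (hx : ∀ i < m, (x i).size ≤ z) (hm : m ≤ z)
    (hQ : ∀ s, Inv s → ∀ i < m, s.reg (k + 1) = i → Evaluates Q s (k + 3) U (x i)) :
    ∀ r i s, i + r = m → Inv s → s.reg k = A i → s.reg (k + 1) = i → s.reg (k + 2) = r →
      ∃ t s', (RamProg.loop (k + 2) (foldBody o Q k)).Runs s t s' ∧
        t ≤ (r + 1) * (U + 5 * z + 8) ∧ s'.mem = s.mem ∧ (∀ j < k, s'.reg j = s.reg j) ∧
        s'.reg k = A m := by
  intro r
  induction r with
  | zero =>
    intro i s hi hs h0 h1 h2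
    refine ⟨_, s, .loopDone h2, ?_, rfl, fun _ _ => rfl, ?_⟩
    · rw [h2]
      simp
    · rw [h0, ← hi, add_zero]
  | succ r ih =>
    intro i s hi hs h0 h1 h2
    obtain ⟨t₁, s₁, r₁, c₁, m₁, p₁, v₁⟩ := hQ s hs i (by omega) h1
    have e0 : s₁.reg k = A i := (p₁ k (by omega)).trans h0
    have e1 : s₁.reg (k + 1) = i := (p₁ (k + 1) (by omega)).trans h1
    have e2 : s₁.reg (k + 2) = r + 1 := (p₁ (k + 2) (by omega)).trans h2
    have hb := runs_foldBody o (k := k) r₁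
    rw [e0, e1, e2, v₁] at hb
    set s₂ : RamState := ⟨fun j => if j = k then o.apply (A i) (x i) else if j = k + 3 then 1 else
        if j = k + 1 then i + 1 else if j = k + 2 then r + 1 - 1 else s₁.reg j, s₁.mem⟩ with hs₂
    have hlow : ∀ j < k, s₂.reg j = s.reg j := by
      intro j hj
      rw [← p₁ j (by omega)]
      simp only [hs₂]
      rw [if_neg (by omega), if_neg (by omega), if_neg (by omega), if_neg (by omega)]
    obtain ⟨t₃, s₃, r₃, c₃, m₃, p₃, v₃⟩ := ih (i + 1) s₂ (by omega)
      (hInv s s₂ hs m₁ hlow) (by simp [hs₂, hA i (by omega)]) (by simp [hs₂])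
      (by simp [hs₂])
    refine ⟨_, s₃, .loopStep (by omega) hb r₃, ?_, m₃.trans m₁,
      fun j hj => (p₃ j hj).trans (hlow j hj), v₃⟩
    rw [h2]
    have g1 := hz i (by omega)
    have g2 := hx i (by omega)
    have g3 := size_le_self i
    have g4 := size_le_self (r + 1)
    have : (r + 1 + 1) * (U + 5 * z + 8) = (U + 5 * z + 8) + (r + 1) * (U + 5 * z + 8) := by ring
    omega

/-- All intermediate values `A γ i` enter the cost, so each of them, and not only the last, has to
be short. -/
theorem Computable.fold (o : RamOp) (init : ℕ) (A : Γ → ℕ → ℕ) {F : Γ → ℕ → ℕ}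
    (hF : C.ext.Computable fun p => F p.1 p.2) (h0 : ∀ γ, A γ 0 = init)
    (hA : ∀ γ i, A γ (i + 1) = o.apply (A γ i) (F γ i)) {z : Γ → ℕ} (hz : C.Poly z)
    (hAz : ∀ γ, C.ok γ → ∀ i ≤ C.n γ, (A γ i).size ≤ z γ) :
    C.Computable fun γ => A γ (C.n γ) := by
  obtain ⟨hZ, P, T, hT, hP⟩ := hF
  obtain ⟨y, hy, hy'⟩ := hZ.of_ext
  obtain ⟨U, hU, hU'⟩ := hT.of_ext
  refine ⟨hz.mono fun γ hγ => hAz γ hγ _ le_rfl,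
    fun loc k => foldProg o init
      (P (fun j => match j with | 0 => k + 1 | j + 1 => loc j) (k + 3)) k,
    fun γ => (1 + init.size) + (1 + ((2 + C.n γ) +
      (C.n γ + 1) * (U γ + 5 * (z γ + y γ + C.n γ) + 8))), ?_, fun loc k γ s hγ hs => ?_⟩
  · exact (Poly.const _).add ((Poly.const _).add (((Poly.const _).add Poly.n).add
      ((Poly.n.add (Poly.const _)).mul ((hU.add ((Poly.const 5).mul ((hz.add hy).add
        Poly.n))).add (Poly.const _)))))
  · have hk := hs.pos
    set s₃ : RamState := ⟨Function.update (Function.update (Function.update s.reg k init)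
      (k + 1) 0) (k + 2) (C.n γ), s.mem⟩ with hs₃
    have hlow : ∀ j < k, s₃.reg j = s.reg j := by
      intro j hj
      simp only [hs₃]
      rw [Function.update_of_ne (by omega), Function.update_of_ne (by omega),
        Function.update_of_ne (by omega)]
    obtain ⟨t, s', hr, hc, hm, hp, hv⟩ := exists_runs_foldLoop o
      (P (fun j => match j with | 0 => k + 1 | j + 1 => loc j) (k + 3)) k (C.n γ) (U γ)
      (z γ + y γ + C.n γ) (A γ) (F γ) (fun s => C.Holds loc k γ s)
      (fun s s' h hm hp => h.of_agree le_rfl hm hp) (fun i _ => hA γ i)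
      (fun i hi => (hAz γ hγ i hi).trans (by omega))
      (fun i hi => (hy' γ hγ i hi).trans (by omega)) (by omega)
      (by
        intro s hs i hi hsi
        obtain ⟨t, s', hr, hc, h⟩ := hP (fun j => match j with | 0 => k + 1 | j + 1 => loc j)
          (k + 3) (γ, i) s ⟨hγ, hi⟩ {
            pos := by omega
            reg_zero := hs.reg_zero
            mem_eq := hs.mem_eq
            loc_lt := fun j hj => match j with
              | 0 => by simp
              | j + 1 => (hs.loc_lt j (Nat.lt_of_succ_lt_succ hj)).trans (by omega)
            reg_loc := fun j hj => match j with
              | 0 => hsi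
              | j + 1 => hs.reg_loc j (Nat.lt_of_succ_lt_succ hj) }
        exact ⟨t, s', hr, hc.trans (hU' γ hγ i hi), h⟩)
      (C.n γ) 0 s₃ (by omega) (hs.of_agree le_rfl rfl hlow) (by simp [hs₃, h0])
      (by simp [hs₃]) (by simp [hs₃])
    have hcopy := runs_copyProg (k + 2) 0 (by omega)
      ⟨Function.update (Function.update s.reg k init) (k + 1) 0, s.mem⟩
    have e0 : Function.update (Function.update s.reg k init) (k + 1) 0 0 = C.n γ := by
      rw [Function.update_of_ne (by omega), Function.update_of_ne (by omega), hs.reg_zero]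
    simp only [e0] at hcopy
    refine ⟨_, s', .seq (.const k init s) (.seq (.const (k + 1) 0 _) (.seq hcopy hr)), ?_,
      hm, fun j hj => (hp j hj).trans (hlow j hj), hv⟩
    have := size_le_self (C.n γ)
    simp only [Nat.size_zero]
    omega

theorem Computable.sum {F : Γ → ℕ → ℕ} (hF : C.ext.Computable fun p => F p.1 p.2) :
    C.Computable fun γ => ∑ i ∈ Finset.range (C.n γ), F γ i := by
  obtain ⟨y, hy, hy'⟩ := hF.1.of_ext
  refine Computable.fold .add 0 (fun γ m => ∑ i ∈ Finset.range m, F γ i) hF (fun γ => by simp)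
    (fun γ i => Finset.sum_range_succ _ _) (Poly.n.add hy) fun γ hγ m hm => ?_
  refine (size_sum_range_le _ m (y γ) fun i hi => hy' γ hγ i (by omega)).trans ?_
  simpa using hm

theorem Computable.prod {F : Γ → ℕ → ℕ} (hF : C.ext.Computable fun p => F p.1 p.2) :
    C.Computable fun γ => ∏ i ∈ Finset.range (C.n γ), F γ i := by
  obtain ⟨y, hy, hy'⟩ := hF.1.of_ext
  refine Computable.fold .mul 1 (fun γ m => ∏ i ∈ Finset.range m, F γ i) hF (fun γ => by simp)
    (fun γ i => Finset.prod_range_succ _ _) ((Poly.n.mul hy).add (Poly.const 1)) fun γ hγ m hm => ?_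
  refine (size_prod_range_le _ m (y γ) fun i hi => hy' γ hγ i (by omega)).trans ?_
  simpa using Nat.mul_le_mul_right (y γ) hm

/-! ### Decidable properties -/

theorem Decides.fst {q : Γ → Prop} (hq : C.Decides q) : C.ext.Decides fun p => q p.1 :=
  Computable.fst hq

theorem Decides.not {q : Γ → Prop} (hq : C.Decides q) : C.Decides fun γ => ¬ q γ :=
  ((Computable.const 1).sub hq).congr fun γ _ => by
    by_cases h : q γ
    · rw [ind_true h, ind_false (not_not.2 h)]
    · rw [ind_false h, ind_true h]

theorem Decides.and {q q' : Γ → Prop} (hq : C.Decides q) (hq' : C.Decides q') :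
    C.Decides fun γ => q γ ∧ q' γ :=
  (Computable.mul hq hq').congr fun γ _ => by
    by_cases h : q γ
    · by_cases h' : q' γ
      · rw [ind_true h, ind_true h', ind_true ⟨h, h'⟩]
      · rw [ind_false h', ind_false (not_and_of_not_right _ h'), mul_zero]
    · rw [ind_false h, ind_false (not_and_of_not_left _ h), zero_mul]

theorem Decides.or {q q' : Γ → Prop} (hq : C.Decides q) (hq' : C.Decides q') :
    C.Decides fun γ => q γ ∨ q' γ :=
  (hq.not.and hq'.not).not.congr fun _ _ => by tauto

theorem Decides.imp {q q' : Γ → Prop} (hq : C.Decides q) (hq' : C.Decides q') :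
    C.Decides fun γ => q γ → q' γ :=
  (hq.not.or hq').congr fun γ _ => by tauto

theorem Decides.iff {q q' : Γ → Prop} (hq : C.Decides q) (hq' : C.Decides q') :
    C.Decides fun γ => q γ ↔ q' γ :=
  ((hq.imp hq').and (hq'.imp hq)).congr fun γ _ => by tauto

/-- With truncated subtraction, `1 - (F - F')` is the indicator of `F ≤ F'`. -/
theorem Decides.le {F F' : Γ → ℕ} (hF : C.Computable F) (hF' : C.Computable F') :
    C.Decides fun γ => F γ ≤ F' γ :=
  ((Computable.const 1).sub (hF.sub hF')).congr fun γ _ => by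
    by_cases h : F γ ≤ F' γ
    · rw [ind_true h]
      omega
    · rw [ind_false h]
      omega

theorem Decides.lt {F F' : Γ → ℕ} (hF : C.Computable F) (hF' : C.Computable F') :
    C.Decides fun γ => F γ < F' γ :=
  (Decides.le hF' hF).not.congr fun _ _ => not_le

theorem Decides.eq {F F' : Γ → ℕ} (hF : C.Computable F) (hF' : C.Computable F') :
    C.Decides fun γ => F γ = F' γ :=
  ((Decides.le hF hF').and (Decides.le hF' hF)).congr fun γ _ => by omega

theorem prod_range_ind (m : ℕ) (q : ℕ → Prop) :
    ∏ i ∈ Finset.range m, ind (q i) = ind (∀ i < m, q i) := by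
  by_cases h : ∀ i < m, q i
  · rw [ind_true h]
    exact Finset.prod_eq_one fun i hi => ind_true (h i (Finset.mem_range.1 hi))
  · rw [ind_false h]
    push Not at h
    obtain ⟨i, hi, hq⟩ := h
    exact Finset.prod_eq_zero (Finset.mem_range.2 hi) (ind_false hq)

/-- A bounded universal quantifier is a product of indicators. -/
theorem Decides.forall {q : Γ → ℕ → Prop} (hq : C.ext.Decides fun p => q p.1 p.2) :
    C.Decides fun γ => ∀ i < C.n γ, q γ i :=
  (Computable.prod (F := fun γ i => ind (q γ i)) hq).congr fun _ _ => prod_range_ind _ _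

theorem Decides.exists {q : Γ → ℕ → Prop} (hq : C.ext.Decides fun p => q p.1 p.2) :
    C.Decides fun γ => ∃ i < C.n γ, q γ i :=
  (Decides.forall (q := fun γ i => ¬ q γ i) hq.not).not.congr fun _ _ => by push Not; rfl

/-- Both branches are evaluated and weighted with the indicators of the condition and of its
negation; no jump is needed, as both are cheap. -/
theorem Computable.ite {q : Γ → Prop} [∀ γ, Decidable (q γ)] {F F' : Γ → ℕ}
    (hq : C.Decides q) (hF : C.Computable F)
    (hF' : C.Computable F') : C.Computable fun γ => if q γ then F γ else F' γ :=
  ((Computable.mul hq hF).add (Computable.mul hq.not hF')).congr fun γ _ => by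
    by_cases h : q γ
    · rw [ind_true h, ind_false (not_not.2 h), if_pos h]
      ring
    · rw [ind_false h, ind_true h, if_neg h]
      ring

theorem Computable.sum_filter {q : Γ → ℕ → Prop} [∀ γ, DecidablePred (q γ)] {F : Γ → ℕ → ℕ}
    (hq : C.ext.Decides fun p => q p.1 p.2) (hF : C.ext.Computable fun p => F p.1 p.2) :
    C.Computable fun γ => ∑ i ∈ (Finset.range (C.n γ)).filter (q γ), F γ i :=
  (Computable.sum (F := fun γ i => if q γ i then F γ i else 0)
    (Computable.ite hq hF (Computable.const 0))).congr fun _ _ => (Finset.sum_filter _ _).symm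

theorem Computable.card_filter {q : Γ → ℕ → Prop} [∀ γ, DecidablePred (q γ)]
    (hq : C.ext.Decides fun p => q p.1 p.2) :
    C.Computable fun γ => ((Finset.range (C.n γ)).filter (q γ)).card :=
  (Computable.sum_filter (F := fun _ _ => 1) hq (Computable.const 1)).congr fun γ _ => by simp

/-- The only bounded loops available run over the numbers below `n`, so the power is a product of
`n` factors, each of them one or two; this is why the exponent may not exceed `n`. -/
theorem Computable.two_pow {F : Γ → ℕ} (hF : C.Computable F) (h : ∀ γ, C.ok γ → F γ ≤ C.n γ) :
    C.Computable fun γ => 2 ^ F γ := by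
  refine (Computable.prod (F := fun γ i => if i < F γ then 2 else 1)
    (Computable.ite (Decides.lt Computable.snd hF.fst) (Computable.const 2)
      (Computable.const 1))).congr fun γ hγ => ?_
  rw [Finset.prod_ite, Finset.prod_const, Finset.prod_const_one, mul_one]
  congr 1
  have : (Finset.range (C.n γ)).filter (fun i => i < F γ) = Finset.range (F γ) := by
    ext i
    have := h γ hγ
    simp only [Finset.mem_filter, Finset.mem_range]
    omega
  rw [this, Finset.card_range]

theorem Computable.mod {F F' : Γ → ℕ} (hF : C.Computable F) (hF' : C.Computable F') :
    C.Computable fun γ => F γ % F' γ :=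
  (hF.sub (hF'.mul (hF.div hF'))).congr fun γ _ => by
    have := Nat.div_add_mod (F γ) (F' γ)
    omega

theorem Computable.max {F F' : Γ → ℕ} (hF : C.Computable F) (hF' : C.Computable F') :
    C.Computable fun γ => max (F γ) (F' γ) :=
  (hF.add (hF'.sub hF)).congr fun _ _ => by omega

theorem Decides.testBit {F F' : Γ → ℕ} (hF : C.Computable F) (hF' : C.Computable F')
    (h : ∀ γ, C.ok γ → F' γ ≤ C.n γ) : C.Decides fun γ => (F γ).testBit (F' γ) = true :=
  (Decides.eq ((hF.div (hF'.two_pow h)).mod (Computable.const 2)) (Computable.const 1)).congr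
    fun γ _ => by rw [Nat.testBit_eq_decide_div_mod_eq]; simp

end Ctx

/-! ### Cuts of graphs on the numbers below `n` -/

open Finset

section Cuts

variable {n : ℕ} {G : SimpleGraph ℕ}

open Classical in
/-- The number of edges with exactly one endpoint in `S`. -/
noncomputable def cutCard (n : ℕ) (G : SimpleGraph ℕ) (S : Finset ℕ) : ℕ :=
  ((range n ×ˢ range n).filter fun e => G.Adj e.1 e.2 ∧ e.1 ∈ S ∧ e.2 ∉ S).card

open Classical in
/-- The number of non-neighbours in `T` exceeding that of neighbours in `T`, among the neighbours
of `x`: what the cut gains when `x` is added to `T`. -/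
noncomputable def gain (n : ℕ) (G : SimpleGraph ℕ) (x : ℕ) (T : Finset ℕ) : ℤ :=
  ∑ y ∈ (range n).filter (G.Adj x), if y ∈ T then -1 else 1

open Classical in
theorem cutCard_eq_sum (n : ℕ) (G : SimpleGraph ℕ) (S : Finset ℕ) :
    (cutCard n G S : ℤ) = ∑ x ∈ range n, ∑ y ∈ range n,
      if G.Adj x y ∧ x ∈ S ∧ y ∉ S then 1 else 0 := by
  rw [← sum_product', cutCard, card_filter]
  push_cast
  rfl

theorem cutCard_insert {x : ℕ} {T : Finset ℕ} (hx : x < n) (hxT : x ∉ T) :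
    (cutCard n G (insert x T) : ℤ) = cutCard n G T + gain n G x T := by
  classical
  -- Adding `x` affects only ordered pairs that contain `x`: those leading from `x` to its
  -- neighbours outside `T` appear, those leading from `T` to `x` disappear.
  have hterm : ∀ a b : ℕ, (if G.Adj a b ∧ a ∈ insert x T ∧ b ∉ insert x T then 1 else 0 : ℤ) =
      (if G.Adj a b ∧ a ∈ T ∧ b ∉ T then 1 else 0) +
      ((if a = x then (if G.Adj x b ∧ b ∉ T then 1 else 0) else 0) -
      (if b = x then (if G.Adj x a ∧ a ∈ T then 1 else 0) else 0)) := by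
    intro a b
    by_cases ha : a = x
    · subst ha
      by_cases hb : b = a
      · subst hb
        simp
      · by_cases h : G.Adj a b <;> by_cases hb' : b ∈ T <;> simp [h, hb, hb', hxT]
    · by_cases hb : b = x
      · subst hb
        by_cases h : G.Adj a b
        · by_cases ha' : a ∈ T <;> simp [h, h.symm, ha, ha', hxT]
        · have h' : ¬ G.Adj b a := fun e => h e.symm
          simp [h, h', ha]
      · simp [ha, hb]
  rw [cutCard_eq_sum, cutCard_eq_sum, gain]
  simp only [hterm, sum_add_distrib, sum_sub_distrib]
  congr 1
  have e1 : ∑ a ∈ range n, ∑ b ∈ range n,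
      (if a = x then (if G.Adj x b ∧ b ∉ T then 1 else 0) else 0 : ℤ) =
      ∑ b ∈ range n, if G.Adj x b ∧ b ∉ T then 1 else 0 := by
    rw [sum_comm]
    refine sum_congr rfl fun b _ => ?_
    rw [sum_ite_eq' (range n) x fun _ => (if G.Adj x b ∧ b ∉ T then 1 else 0 : ℤ),
      if_pos (mem_range.2 hx)]
  have e2 : ∑ a ∈ range n, ∑ b ∈ range n,
      (if b = x then (if G.Adj x a ∧ a ∈ T then 1 else 0) else 0 : ℤ) =
      ∑ a ∈ range n, if G.Adj x a ∧ a ∈ T then 1 else 0 := by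
    refine sum_congr rfl fun a _ => ?_
    rw [sum_ite_eq' (range n) x fun _ => (if G.Adj x a ∧ a ∈ T then 1 else 0 : ℤ),
      if_pos (mem_range.2 hx)]
  rw [e1, e2, ← sum_sub_distrib, sum_filter]
  refine sum_congr rfl fun y _ => ?_
  by_cases h : G.Adj x y <;> by_cases hy : y ∈ T <;> simp [h, hy]

theorem gain_insert_of_adj {x y : ℕ} {T : Finset ℕ} (hy : y < n) (hyT : y ∉ T) (h : G.Adj x y) :
    gain n G x (insert y T) = gain n G x T - 2 := by
  classical
  have hmem : y ∈ (range n).filter (G.Adj x) := mem_filter.2 ⟨mem_range.2 hy, h⟩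
  unfold gain
  rw [← add_sum_erase _ _ hmem, ← add_sum_erase _ _ hmem, if_pos (mem_insert_self y T),
    if_neg hyT]
  have : ∑ z ∈ ((range n).filter (G.Adj x)).erase y, (if z ∈ insert y T then -1 else 1 : ℤ) =
      ∑ z ∈ ((range n).filter (G.Adj x)).erase y, if z ∈ T then -1 else 1 := by
    refine sum_congr rfl fun z hz => ?_
    simp [mem_insert, ne_of_mem_erase hz]
  rw [this]
  ring

/-- Apart from each other, twins have the same neighbours, and each counts the other one, which is
outside `T`, as plus one. -/
theorem gain_congr {u v : ℕ} {T : Finset ℕ} (hu : u < n) (hv : v < n) (huT : u ∉ T) (hvT : v ∉ T)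
    (h : SameNbhd G u v) : gain n G u T = gain n G v T := by
  classical
  by_cases e : u = v
  · rw [e]
  have hadj : G.Adj u v := h.closedAdj.resolve_right e
  have hmu : v ∈ (range n).filter (G.Adj u) := mem_filter.2 ⟨mem_range.2 hv, hadj⟩
  have hmv : u ∈ (range n).filter (G.Adj v) := mem_filter.2 ⟨mem_range.2 hu, hadj.symm⟩
  have hset : ((range n).filter (G.Adj u)).erase v = ((range n).filter (G.Adj v)).erase u := by
    ext w
    have := (Set.ext_iff.1 (h.twins e).2 w)
    simp only [Set.mem_sdiff, SimpleGraph.mem_neighborSet, Set.mem_singleton_iff] at this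
    simp only [mem_erase, mem_filter]
    tauto
  unfold gain
  rw [← add_sum_erase _ _ hmu, ← add_sum_erase _ _ hmv, hset, if_neg huT, if_neg hvT]

open Classical in
/-- The number of vertices in `T` with the same closed neighbourhood as `x`. -/
noncomputable def twinCard (G : SimpleGraph ℕ) (x : ℕ) (T : Finset ℕ) : ℕ :=
  (T.filter (SameNbhd G x)).card

/-- The number of ordered pairs of vertices in `S` with the same closed neighbourhood. -/
noncomputable def twinPairs (G : SimpleGraph ℕ) (S : Finset ℕ) : ℕ :=
  ∑ x ∈ S, twinCard G x S

theorem twinCard_congr {u v : ℕ} (h : SameNbhd G u v) (T : Finset ℕ) :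
    twinCard G u T = twinCard G v T := by
  classical
  unfold twinCard
  congr 1
  exact filter_congr fun w _ => ⟨h.symm.trans, h.trans⟩

theorem twinCard_insert_of_sameNbhd {x y : ℕ} {T : Finset ℕ} (hy : y ∉ T) (h : SameNbhd G x y) :
    twinCard G x (insert y T) = twinCard G x T + 1 := by
  classical
  unfold twinCard
  rw [filter_insert, if_pos h, card_insert_of_notMem fun e => hy (mem_filter.1 e).1]

theorem twinCard_insert_of_not_sameNbhd {x y : ℕ} {T : Finset ℕ} (h : ¬ SameNbhd G x y) :
    twinCard G x (insert y T) = twinCard G x T := by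
  classical
  unfold twinCard
  rw [filter_insert, if_neg h]

/-- The increment grows with the number of twins already present. This convexity makes it profitable
to concentrate a cut on one of two split classes. -/
theorem twinPairs_insert {x : ℕ} {T : Finset ℕ} (hx : x ∉ T) :
    twinPairs G (insert x T) = twinPairs G T + (1 + 2 * twinCard G x T) := by
  classical
  unfold twinPairs
  rw [sum_insert hx, twinCard_insert_of_sameNbhd hx (SameNbhd.refl G x)]
  have h1 : ∀ y ∈ T, twinCard G y (insert x T) =
      twinCard G y T + if SameNbhd G x y then 1 else 0 := by
    intro y _
    by_cases h : SameNbhd G x y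
    · rw [twinCard_insert_of_sameNbhd hx h.symm, if_pos h]
    · rw [twinCard_insert_of_not_sameNbhd fun e => h e.symm, if_neg h, add_zero]
  rw [sum_congr rfl h1, sum_add_distrib, ← card_filter]
  change _ = _ + (1 + 2 * (T.filter (SameNbhd G x)).card)
  unfold twinCard
  ring

/-- Every class of twins meets `S` in an initial segment, and classes of twins that are neither
contained in `S` nor disjoint from `S` are not adjacent. -/
structure IsCanonical (G : SimpleGraph ℕ) (S : Finset ℕ) : Prop where
  initial : ∀ a b, SameNbhd G a b → a < b → b ∈ S → a ∈ S
  split : ∀ u u' w w', SameNbhd G u u' → u ∈ S → u' ∉ S → SameNbhd G w w' → w ∈ S → w' ∉ S →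
    G.Adj u w → SameNbhd G u w

/-- Among the maximum cuts, take one with the most pairs of twins on its side, and among those one
with the smallest sum of elements. The last criterion yields initial segments; the second one, by an
exchange between two adjacent split classes, leaves no such pair of classes. -/
theorem exists_isCanonical_max (hG : ∀ u v, G.Adj u v → u < n) :
    ∃ S ⊆ range n, IsCanonical G S ∧ ∀ T ⊆ range n, cutCard n G T ≤ cutCard n G S := by
  classical
  have hlt : ∀ {u v}, SameNbhd G u v → u ≠ v → u < n ∧ v < n := by
    intro u v h e
    have := h.closedAdj.resolve_right e
    exact ⟨hG _ _ this, hG _ _ this.symm⟩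
  obtain ⟨S, hS, hmax⟩ := (range n).powerset.exists_max_image
    (fun S => toLex (cutCard n G S, toLex (twinPairs G S, -((∑ i ∈ S, i : ℕ) : ℤ))))
    ⟨∅, empty_mem_powerset _⟩
  rw [mem_powerset] at hS
  have h1 : ∀ T ⊆ range n, cutCard n G T ≤ cutCard n G S := by
    intro T hT
    have := hmax T (mem_powerset.2 hT)
    rw [Prod.Lex.toLex_le_toLex] at this
    rcases this with h | h
    · exact h.le
    · exact h.1.le
  have h2 : ∀ T ⊆ range n, cutCard n G T = cutCard n G S → twinPairs G T ≤ twinPairs G S := by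
    intro T hT e
    have := hmax T (mem_powerset.2 hT)
    rw [Prod.Lex.toLex_le_toLex] at this
    have := (this.resolve_left (by simp [e])).2
    rw [Prod.Lex.toLex_le_toLex] at this
    rcases this with h | h
    · exact h.le
    · exact h.1.le
  have h3 : ∀ T ⊆ range n, cutCard n G T = cutCard n G S → twinPairs G T = twinPairs G S →
      ∑ i ∈ S, i ≤ ∑ i ∈ T, i := by
    intro T hT e e'
    have := hmax T (mem_powerset.2 hT)
    rw [Prod.Lex.toLex_le_toLex] at this
    have := (this.resolve_left (by simp [e])).2
    rw [Prod.Lex.toLex_le_toLex] at this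
    have := neg_le_neg_iff.1 (this.resolve_left (by simp [e'])).2
    exact_mod_cast this
  refine ⟨S, hS, ⟨?_, ?_⟩, h1⟩
  -- Replacing `b` by its smaller twin `a` changes neither the cut nor the number of twin pairs, but
  -- lowers the sum.
  · intro a b hab hlt' hb
    by_contra ha
    obtain ⟨han, hbn⟩ := hlt hab hlt'.ne
    obtain ⟨T, hbT, rfl⟩ : ∃ T, b ∉ T ∧ S = insert b T :=
      ⟨S.erase b, notMem_erase b S, (insert_erase hb).symm⟩
    have haT : a ∉ T := fun h => ha (mem_insert_of_mem h)
    have hT : T ⊆ range n := (subset_insert b T).trans hS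
    have hs : insert a T ⊆ range n := insert_subset (mem_range.2 han) hT
    have c1 := cutCard_insert (G := G) han haT
    have c2 := cutCard_insert (G := G) hbn hbT
    rw [gain_congr han hbn haT hbT hab] at c1
    have t1 := twinPairs_insert (G := G) haT
    have t2 := twinPairs_insert (G := G) hbT
    rw [twinCard_congr hab] at t1
    have := h3 _ hs (by omega) (by omega)
    rw [sum_insert haT, sum_insert hbT] at this
    omega
  -- With `S = T + u + w`, compare `S` with `T + w + w'` and `T + u + u'`.
  · intro u u' w w' huu hu hu' hww hw hw' huw
    by_contra hn
    have hun : u < n := hG _ _ huw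
    have hwn : w < n := hG _ _ huw.symm
    have euu : u ≠ u' := fun e => hu' (e ▸ hu)
    have eww : w ≠ w' := fun e => hw' (e ▸ hw)
    have huw' : u ≠ w := G.ne_of_adj huw
    obtain ⟨-, hun'⟩ := hlt huu euu
    obtain ⟨-, hwn'⟩ := hlt hww eww
    obtain ⟨T₀, hwT₀, rfl⟩ : ∃ T, w ∉ T ∧ S = insert w T :=
      ⟨S.erase w, notMem_erase w S, (insert_erase hw).symm⟩
    have huT₀ : u ∈ T₀ := (mem_insert.1 hu).resolve_left huw'
    obtain ⟨T, huT, rfl⟩ : ∃ T, u ∉ T ∧ T₀ = insert u T :=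
      ⟨T₀.erase u, notMem_erase u T₀, (insert_erase huT₀).symm⟩
    have hwT : w ∉ T := fun h => hwT₀ (mem_insert_of_mem h)
    have hu'T : u' ∉ T := fun h => hu' (mem_insert_of_mem (mem_insert_of_mem h))
    have hw'T : w' ∉ T := fun h => hw' (mem_insert_of_mem (mem_insert_of_mem h))
    have hu'T' : u' ∉ insert u T := fun h => hu' (mem_insert_of_mem h)
    have hw'T' : w' ∉ insert w T := fun h =>
      (mem_insert.1 h).elim (fun e => eww e.symm) hw'T
    have hT : T ⊆ range n := fun x hx => hS (mem_insert_of_mem (mem_insert_of_mem hx))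
    have s1 : insert w' (insert w T) ⊆ range n :=
      insert_subset (mem_range.2 hwn') (insert_subset (mem_range.2 hwn) hT)
    have s2 : insert u' (insert u T) ⊆ range n :=
      insert_subset (mem_range.2 hun') (insert_subset (mem_range.2 hun) hT)
    have auu : G.Adj u' u := (huu.closedAdj.resolve_right euu).symm
    have aww : G.Adj w' w := (hww.closedAdj.resolve_right eww).symm
    -- Let `g` be the gain with respect to `T`. Relative to `T`, the cuts of the three sets change
    -- by `g u + g w - 2`, `2 * g w - 2` and `2 * g u - 2`. The first is the mean of the others, so
    -- all three sets are maximum cuts.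
    have c0 := cutCard_insert (G := G) hwn hwT₀
    have c0' := cutCard_insert (G := G) hun huT
    rw [gain_insert_of_adj hun huT huw.symm] at c0
    have c1 := cutCard_insert (G := G) hwn' hw'T'
    have c1' := cutCard_insert (G := G) hwn hwT
    rw [gain_insert_of_adj hwn hwT aww, ← gain_congr hwn hwn' hwT hw'T hww] at c1
    have c2 := cutCard_insert (G := G) hun' hu'T'
    rw [gain_insert_of_adj hun huT auu, ← gain_congr hun hun' huT hu'T huu] at c2
    have m1 := h1 _ s1
    have m2 := h1 _ s2
    have p1 := h2 _ s1 (by omega)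
    have p2 := h2 _ s2 (by omega)
    -- If `u` and `w` have `a` and `b` twins in `T`, the pair counts increase by `2 * a + 2 * b +
    -- 2`, `4 * b + 4` and `4 * a + 4`. The last two sum to more than twice the first, so one of the
    -- exchanges improves on `S`.
    have t0 := twinPairs_insert (G := G) hwT₀
    have t0' := twinPairs_insert (G := G) huT
    rw [twinCard_insert_of_not_sameNbhd fun e => hn e.symm] at t0
    have t1 := twinPairs_insert (G := G) hw'T'
    have t1' := twinPairs_insert (G := G) hwT
    rw [← twinCard_congr hww, twinCard_insert_of_sameNbhd hwT (SameNbhd.refl G w)] at t1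
    have t2 := twinPairs_insert (G := G) hu'T'
    rw [← twinCard_congr huu, twinCard_insert_of_sameNbhd huT (SameNbhd.refl G u)] at t2
    omega

end Cuts

/-! ### The traces of canonical sets on a clique -/

/-- The number whose binary digits are given by `S`. -/
def bits (S : Finset ℕ) : ℕ :=
  ∑ i ∈ S, 2 ^ i

theorem testBit_bits (S : Finset ℕ) (i : ℕ) : (bits S).testBit i = true ↔ i ∈ S := by
  rw [← Nat.mem_bitIndices, ← List.mem_toFinset, bits, toFinset_bitIndices_sum_two_pow]

theorem bits_lt {n : ℕ} {S : Finset ℕ} (h : S ⊆ range n) : bits S < 2 ^ n :=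
  (sum_le_sum_of_subset h).trans_lt <| by
    rw [Nat.geomSum_eq le_rfl]
    have := Nat.one_le_two_pow (n := n)
    simp

theorem bits_injective : Function.Injective bits :=
  geomSum_injective le_rfl

section Traces

variable {n : ℕ} {G : SimpleGraph ℕ} {K S : Finset ℕ}

open Classical in
/-- The least elements of the classes of twins in `K`. -/
noncomputable def leaders (G : SimpleGraph ℕ) (K : Finset ℕ) : Finset ℕ :=
  K.filter fun w => ∀ w' ∈ K, SameNbhd G w w' → w ≤ w'

/-- The number of leaders that precede `l`. -/
noncomputable def rank (G : SimpleGraph ℕ) (K : Finset ℕ) (l : ℕ) : ℕ :=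
  ((leaders G K).filter fun l' => l' < l).card

open Classical in
/-- The subset of `K` that is described by a number `m * (n + 1) + t`: the vertices of the class of
twins of `t` up to `t`, and the further classes of twins according to the binary digits of `m`. -/
noncomputable def trace (n : ℕ) (G : SimpleGraph ℕ) (K : Finset ℕ) (code : ℕ) : Finset ℕ :=
  K.filter fun u => if SameNbhd G u (code % (n + 1)) then u ≤ code % (n + 1) else
    ∃ l ∈ leaders G K, SameNbhd G u l ∧ (code / (n + 1)).testBit (rank G K l) = true

theorem trace_subset (code : ℕ) : trace n G K code ⊆ K := by
  classical
  exact filter_subset _ _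

theorem rank_lt {l : ℕ} (h : l ∈ leaders G K) : rank G K l < (leaders G K).card :=
  card_lt_card ⟨filter_subset _ _, fun e => lt_irrefl l (mem_filter.1 (e h)).2⟩

theorem rank_lt_rank {l l' : ℕ} (h : l ∈ leaders G K) (hl : l < l') : rank G K l < rank G K l' := by
  refine card_lt_card ⟨fun x hx => ?_, fun e => ?_⟩
  · rw [mem_filter] at hx ⊢
    exact ⟨hx.1, hx.2.trans hl⟩
  · exact lt_irrefl l (mem_filter.1 (e (mem_filter.2 ⟨h, hl⟩))).2

theorem rank_injOn : Set.InjOn (rank G K) (leaders G K) := by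
  intro l hl l' hl' e
  rcases lt_trichotomy l l' with h | h | h
  · exact absurd e (rank_lt_rank hl h).ne
  · exact h
  · exact absurd e (rank_lt_rank hl' h).ne'

theorem exists_leader {u : ℕ} (hu : u ∈ K) : ∃ l ∈ leaders G K, SameNbhd G u l := by
  classical
  obtain ⟨l, hl, hmin⟩ := (K.filter (SameNbhd G u)).exists_min_image id
    ⟨u, mem_filter.2 ⟨hu, SameNbhd.refl G u⟩⟩
  rw [mem_filter] at hl
  refine ⟨l, mem_filter.2 ⟨hl.1, fun w hw h => hmin w (mem_filter.2 ⟨hw, hl.2.trans h⟩)⟩, hl.2⟩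

/-- Two different split classes that meet a clique would be adjacent, so a canonical set splits at
most one of them, in an initial segment that ends at some `t`. Every other class is inside or
outside `S` as a whole, which one bit at the rank of its leader records. -/
theorem exists_trace_eq (hG : ∀ u v, G.Adj u v → u < n) (hKn : K ⊆ range n) (hSn : S ⊆ range n)
    (hK : ∀ u ∈ K, ∀ v ∈ K, ClosedAdj G u v) (hS : IsCanonical G S) :
    ∃ code < 2 ^ (leaders G K).card * (n + 1), trace n G K code = S ∩ K := by
  classical
  obtain ⟨t, htn, ht, ht'⟩ : ∃ t ≤ n, (∀ u ∈ K, SameNbhd G u t → (u ≤ t ↔ u ∈ S)) ∧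
      ∀ u ∈ K, ∀ l ∈ K, ¬ SameNbhd G u t → SameNbhd G u l → (l ∈ S ↔ u ∈ S) := by
    by_cases hsplit : ∃ w ∈ K, ∃ a b, SameNbhd G w a ∧ SameNbhd G w b ∧ a ∈ S ∧ b ∉ S
    · obtain ⟨w, hw, a, b, hwa, hwb, ha, hb⟩ := hsplit
      obtain ⟨t, ht, hmax⟩ := (S.filter (SameNbhd G w)).exists_max_image id
        ⟨a, mem_filter.2 ⟨ha, hwa⟩⟩
      rw [mem_filter] at ht
      refine ⟨t, (mem_range.1 (hSn ht.1)).le, fun u hu hut => ⟨fun h => ?_, fun h =>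
        hmax u (mem_filter.2 ⟨h, ht.2.trans hut.symm⟩)⟩, fun u hu l hl hut hul => ?_⟩
      · rcases h.eq_or_lt with rfl | h
        · exact ht.1
        · exact hS.initial u t hut h ht.1
      -- A second split class in the clique would have to coincide with that of `w`, by `split`.
      · have key : ∀ x y, SameNbhd G u x → SameNbhd G u y → x ∈ S → y ∈ S := by
          intro x y hx hy hxS
          by_contra hyS
          refine hut (hx.trans (SameNbhd.trans (hS.split x y a b (hx.symm.trans hy) hxS hyS
            (hwa.symm.trans hwb) ha hb ?_) (hwa.symm.trans ht.2)))
          refine ((hx.symm.closedAdj_congr hwa.symm).2 (hK u hu w hw)).resolve_right ?_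
          rintro rfl
          exact hut (hx.trans (hwa.symm.trans ht.2))
        exact ⟨key l u hul (SameNbhd.refl G u), key u l (SameNbhd.refl G u) hul⟩
    · push Not at hsplit
      -- Without a split class the threshold is `n`, which is no vertex and hence has no twin in
      -- `K`.
      refine ⟨n, le_rfl, fun u hu hun => ?_, fun u hu l hl _ hul => ?_⟩
      · have hlt := mem_range.1 (hKn hu)
        have := hG _ _ (hun.closedAdj.resolve_right hlt.ne).symm
        omega
      · exact ⟨fun h => hsplit u hu l u hul (SameNbhd.refl G u) h,
          fun h => hsplit u hu u l (SameNbhd.refl G u) hul h⟩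
  set m := bits (((leaders G K).filter (· ∈ S)).image (rank G K)) with hm
  have hbit : ∀ l ∈ leaders G K, (m.testBit (rank G K l) = true ↔ l ∈ S) := by
    intro l hl
    rw [hm, testBit_bits, mem_image]
    constructor
    · rintro ⟨l', hl', e⟩
      rw [mem_filter] at hl'
      exact rank_injOn hl'.1 hl e ▸ hl'.2
    · exact fun h => ⟨l, mem_filter.2 ⟨hl, h⟩, rfl⟩
  have hmlt : m < 2 ^ (leaders G K).card := by
    refine bits_lt fun i hi => ?_
    obtain ⟨l, hl, rfl⟩ := mem_image.1 hi
    exact mem_range.2 (rank_lt (mem_filter.1 hl).1)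
  have hdiv : (m * (n + 1) + t) / (n + 1) = m := by
    rw [add_comm, Nat.add_mul_div_right _ _ (Nat.succ_pos n), Nat.div_eq_of_lt (by omega), zero_add]
  have hmod : (m * (n + 1) + t) % (n + 1) = t := by
    rw [add_comm, Nat.add_mul_mod_self_right, Nat.mod_eq_of_lt (by omega)]
  refine ⟨m * (n + 1) + t, ?_, ?_⟩
  · calc m * (n + 1) + t < (m + 1) * (n + 1) := by rw [add_mul]; omega
      _ ≤ _ := Nat.mul_le_mul_right _ hmlt
  · ext u
    rw [trace, mem_filter, mem_inter, hdiv, hmod, and_comm]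
    refine and_congr_left fun hu => ?_
    by_cases h : SameNbhd G u t
    · rw [if_pos h]
      exact ht u hu h
    · rw [if_neg h]
      have hlK : ∀ l ∈ leaders G K, l ∈ K := fun l hl => (mem_filter.1 hl).1
      constructor
      · rintro ⟨l, hl, hul, hb⟩
        exact (ht' u hu l (hlK l hl) h hul).1 ((hbit l hl).1 hb)
      · intro huS
        obtain ⟨l, hl, hul⟩ := exists_leader (G := G) hu
        exact ⟨l, hl, hul, (hbit l hl).2 ((ht' u hu l (hlK l hl) h hul).2 huS)⟩

end Traces

/-! ### Eliminating simplicial vertices -/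

section Touching

variable {n : ℕ} {G : SimpleGraph ℕ}

open Classical in
/-- The number of edges that have exactly one endpoint in `S` and at least one endpoint in `D`. -/
noncomputable def touch (n : ℕ) (G : SimpleGraph ℕ) (D S : Finset ℕ) : ℕ :=
  ((range n ×ˢ range n).filter fun e =>
    G.Adj e.1 e.2 ∧ e.1 ∈ S ∧ e.2 ∉ S ∧ (e.1 ∈ D ∨ e.2 ∈ D)).card

theorem touch_le (D S : Finset ℕ) : touch n G D S ≤ n * n := by
  classical
  exact (card_filter_le _ _).trans (by simp)

theorem touch_empty (S : Finset ℕ) : touch n G ∅ S = 0 := by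
  classical
  exact card_eq_zero.2 (filter_eq_empty_iff.2 fun e _ h => by simpa using h.2.2.2)

theorem touch_range (S : Finset ℕ) : touch n G (range n) S = cutCard n G S := by
  classical
  unfold touch cutCard
  congr 1
  refine filter_congr fun e he => ?_
  have := (mem_product.1 he).1
  tauto

/-- Only the sides of the vertices in `D` and of their neighbours matter for edges that touch `D`.
-/
theorem touch_congr {D S S' : Finset ℕ} (h : ∀ x, x ∈ D → (x ∈ S ↔ x ∈ S'))
    (h' : ∀ x ∈ D, ∀ y, G.Adj x y → (y ∈ S ↔ y ∈ S')) : touch n G D S = touch n G D S' := by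
  classical
  unfold touch
  congr 1
  refine filter_congr fun e _ => and_congr_right fun ha => ?_
  constructor
  · rintro ⟨h1, h2, h3 | h3⟩
    · exact ⟨(h _ h3).1 h1, fun k => h2 ((h' _ h3 _ ha).2 k), Or.inl h3⟩
    · exact ⟨(h' _ h3 _ ha.symm).1 h1, fun k => h2 ((h _ h3).2 k), Or.inr h3⟩
  · rintro ⟨h1, h2, h3 | h3⟩
    · exact ⟨(h _ h3).2 h1, fun k => h2 ((h' _ h3 _ ha).1 k), Or.inl h3⟩
    · exact ⟨(h' _ h3 _ ha.symm).2 h1, fun k => h2 ((h _ h3).1 k), Or.inr h3⟩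

/-- An edge touching both sets would run between them, so no edge is counted twice. -/
theorem touch_union {D D' : Finset ℕ} (hd : Disjoint D D')
    (h : ∀ x ∈ D, ∀ y ∈ D', ¬ G.Adj x y) (S : Finset ℕ) :
    touch n G (D ∪ D') S = touch n G D S + touch n G D' S := by
  classical
  unfold touch
  rw [← card_union_of_disjoint]
  · congr 1
    ext e
    simp only [mem_filter, mem_union]
    tauto
  · rw [disjoint_left]
    intro e he he'
    rw [mem_filter] at he he'
    obtain ⟨-, ha, -, -, h1⟩ := he
    obtain ⟨-, -, -, -, h2⟩ := he'
    rw [disjoint_left] at hd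
    rcases h1 with h1 | h1 <;> rcases h2 with h2 | h2
    · exact hd h1 h2
    · exact h _ h1 _ h2 ha
    · exact h _ h1 _ h2 ha.symm
    · exact hd h1 h2

theorem touch_biUnion {s : Finset ℕ} {D : ℕ → Finset ℕ}
    (hd : ∀ c ∈ s, ∀ c' ∈ s, c ≠ c' → Disjoint (D c) (D c'))
    (h : ∀ c ∈ s, ∀ c' ∈ s, c ≠ c' → ∀ x ∈ D c, ∀ y ∈ D c', ¬ G.Adj x y) (S : Finset ℕ) :
    touch n G (s.biUnion D) S = ∑ c ∈ s, touch n G (D c) S := by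
  induction s using Finset.induction_on with
  | empty => simp [touch_empty]
  | insert a s ha ih =>
    have hne : ∀ c ∈ s, a ≠ c := fun c hc e => ha (e ▸ hc)
    rw [biUnion_insert, sum_insert ha, touch_union, ih]
    · exact fun c hc c' hc' => hd c (mem_insert_of_mem hc) c' (mem_insert_of_mem hc')
    · exact fun c hc c' hc' => h c (mem_insert_of_mem hc) c' (mem_insert_of_mem hc')
    · rw [disjoint_biUnion_right]
      exact fun c hc => hd a (mem_insert_self a s) c (mem_insert_of_mem hc) (hne c hc)
    · intro x hx y hy
      obtain ⟨c, hc, hy⟩ := mem_biUnion.1 hy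
      exact h a (mem_insert_self a s) c (mem_insert_of_mem hc) (hne c hc) x hx y hy

open Classical in
theorem touch_insert {v : ℕ} {U : Finset ℕ} (hv : v < n) (hvU : v ∉ U) (S : Finset ℕ) :
    touch n G (insert v U) S = touch n G U S +
      ((range n).filter fun y => (G.Adj v y ∧ y ∉ U) ∧ ¬ (y ∈ S ↔ v ∈ S)).card := by
  -- A cut edge is counted as the pair that starts in `S`, so the side of `v` fixes the orientation
  -- of the new edges, which join `v` to vertices outside `U`.
  have hinj : Function.Injective fun y => if v ∈ S then (v, y) else (y, v) := by
    intro y y' h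
    by_cases hS : v ∈ S <;> simpa [hS] using h
  rw [← card_image_of_injective _ hinj]
  unfold touch
  rw [← card_union_of_disjoint]
  · congr 1
    ext ⟨x, y⟩
    simp only [mem_filter, mem_union, mem_image, mem_product, mem_range, mem_insert]
    constructor
    · rintro ⟨⟨hx, hy⟩, ha, h1, h2, h3⟩
      by_cases h4 : x ∈ U ∨ y ∈ U
      · exact Or.inl ⟨⟨hx, hy⟩, ha, h1, h2, h4⟩
      · push Not at h4
        right
        rcases h3 with (rfl | h3) | (rfl | h3)
        · exact ⟨y, ⟨hy, ⟨ha, h4.2⟩, by tauto⟩, by simp [h1]⟩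
        · exact absurd h3 h4.1
        · exact ⟨x, ⟨hx, ⟨ha.symm, h4.1⟩, by tauto⟩, by simp [h2]⟩
        · exact absurd h3 h4.2
    · rintro (⟨hxy, ha, h1, h2, h3⟩ | ⟨z, ⟨hz, ⟨ha, hzU⟩, hzS⟩, e⟩)
      · exact ⟨hxy, ha, h1, h2, by tauto⟩
      · by_cases hS : v ∈ S
        · rw [if_pos hS, Prod.mk.injEq] at e
          obtain ⟨rfl, rfl⟩ := e
          exact ⟨⟨hv, hz⟩, ha, hS, by tauto, by tauto⟩
        · rw [if_neg hS, Prod.mk.injEq] at e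
          obtain ⟨rfl, rfl⟩ := e
          exact ⟨⟨hz, hv⟩, ha.symm, by tauto, hS, by tauto⟩
  · rw [disjoint_left]
    rintro ⟨x, y⟩ h h'
    simp only [mem_filter, mem_image, mem_product] at h h'
    obtain ⟨-, -, -, -, h1⟩ := h
    obtain ⟨z, ⟨-, ⟨-, hz⟩, -⟩, e⟩ := h'
    by_cases hS : v ∈ S
    · rw [if_pos hS, Prod.mk.injEq] at e
      obtain ⟨rfl, rfl⟩ := e
      tauto
    · rw [if_neg hS, Prod.mk.injEq] at e
      obtain ⟨rfl, rfl⟩ := e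
      tauto

end Touching

open Classical in
/-- The neighbours of `v` that are not eliminated. -/
noncomputable def nbhd (n : ℕ) (G : SimpleGraph ℕ) (E : Finset ℕ) (v : ℕ) : Finset ℕ :=
  (range n).filter fun u => G.Adj v u ∧ u ∉ E

open Classical in
/-- The active vertices whose tables are used in the elimination of `v`. -/
noncomputable def children (G : SimpleGraph ℕ) (Act : Finset ℕ) (v : ℕ) : Finset ℕ :=
  Act.filter (G.Adj v)

open Classical in
/-- The table entry for `v` that results from the set `X` of vertices on one side, encoded as the
value times `2 ^ n` plus the digits of the set of eliminated vertices on this side. -/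
noncomputable def entry (n : ℕ) (G : SimpleGraph ℕ) (E Act : Finset ℕ) (T : ℕ → Finset ℕ → ℕ)
    (v : ℕ) (X : Finset ℕ) : ℕ :=
  2 ^ n * ((nbhd n G E v).filter fun y => ¬ (y ∈ X ↔ v ∈ X)).card + (if v ∈ X then 2 ^ v else 0) +
    ∑ c ∈ children G Act v, T c (X ∩ nbhd n G E c)

/-- The better one of the two entries for the two sides of `v`. -/
noncomputable def bestEntry (n : ℕ) (G : SimpleGraph ℕ) (E Act : Finset ℕ) (T : ℕ → Finset ℕ → ℕ)
    (v : ℕ) (A : Finset ℕ) : ℕ :=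
  max (entry n G E Act T v A) (entry n G E Act T v (insert v A))

/-- The neighbours of `v` that are not eliminated form a clique. -/
def IsSimplicial (n : ℕ) (G : SimpleGraph ℕ) (E : Finset ℕ) (v : ℕ) : Prop :=
  ∀ x ∈ nbhd n G E v, ∀ y ∈ nbhd n G E v, ClosedAdj G x y

/-- The tables `T` after the elimination of `E`: the table of the active vertex `c` describes the
best ways to distribute the set `D c` of eliminated vertices, depending on the distribution of the
neighbours of `c` that are not eliminated. -/
structure IsTable (n : ℕ) (G : SimpleGraph ℕ) (E Act : Finset ℕ) (T : ℕ → Finset ℕ → ℕ)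
    (D : ℕ → Finset ℕ) : Prop where
  union : Act.biUnion D = E
  disj : ∀ c ∈ Act, ∀ c' ∈ Act, c ≠ c' → Disjoint (D c) (D c')
  not_adj : ∀ c ∈ Act, ∀ c' ∈ Act, c ≠ c' → ∀ x ∈ D c, ∀ y ∈ D c', ¬ G.Adj x y
  boundary : ∀ c ∈ Act, ∀ x ∈ D c, ∀ y, y ∉ E → G.Adj x y → G.Adj c y
  clique : ∀ c ∈ Act, IsSimplicial n G E c
  sound : ∀ c ∈ Act, ∀ A ⊆ nbhd n G E c, ∃ X ⊆ D c, ∃ z,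
    T c A = 2 ^ n * z + bits X ∧ z ≤ touch n G (D c) (X ∪ A)
  complete : ∀ c ∈ Act, ∀ S ⊆ range n, IsCanonical G S →
    2 ^ n * touch n G (D c) S ≤ T c (S ∩ nbhd n G E c)

section Elimination

variable {n : ℕ} {G : SimpleGraph ℕ} {E Act : Finset ℕ} {T : ℕ → Finset ℕ → ℕ}
  {D : ℕ → Finset ℕ} {v : ℕ}

theorem mem_nbhd {u : ℕ} : u ∈ nbhd n G E v ↔ u < n ∧ G.Adj v u ∧ u ∉ E := by
  classical
  rw [nbhd, mem_filter, mem_range]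

theorem mem_children {c : ℕ} : c ∈ children G Act v ↔ c ∈ Act ∧ G.Adj v c := by
  classical
  rw [children, mem_filter]

theorem nbhd_subset_range : nbhd n G E v ⊆ range n := fun _ h => mem_range.2 (mem_nbhd.1 h).1

namespace IsTable

theorem subset (h : IsTable n G E Act T D) {c : ℕ} (hc : c ∈ Act) : D c ⊆ E :=
  h.union ▸ subset_biUnion_of_mem D hc

/-- The eliminated vertices that are described by the new table of `v`. -/
theorem touch_insert_children (h : IsTable n G E Act T D)
    (hv : v < n) (hvE : v ∉ E) (S : Finset ℕ) :
    touch n G (insert v ((children G Act v).biUnion D)) S =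
      open Classical in ((nbhd n G E v).filter fun y => ¬ (y ∈ S ↔ v ∈ S)).card +
      ∑ c ∈ children G Act v, touch n G (D c) S := by
  classical
  have hsub : (children G Act v).biUnion D ⊆ E := by
    rw [← h.union]
    exact biUnion_subset_biUnion_of_subset_left _ (filter_subset _ _)
  have hch : ∀ c ∈ children G Act v, c ∈ Act := fun c hc => (mem_children.1 hc).1
  rw [touch_insert hv (fun k => hvE (hsub k)), add_comm, touch_biUnion]
  · congr 2
    ext y
    rw [mem_filter, mem_filter, mem_nbhd, mem_range, ← and_assoc]
    refine and_congr_left fun _ => and_congr_right fun _ => and_congr_right fun hvy => ?_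
    -- An eliminated neighbour `y` of `v` lies in some `D c`; by `boundary`, `v` is then adjacent to
    -- `c`, so `c` is a child and `y` is already covered.
    refine ⟨fun hy hyE => hy ?_, fun hy k => hy (hsub k)⟩
    rw [← h.union, mem_biUnion] at hyE
    obtain ⟨c, hc, hyc⟩ := hyE
    exact mem_biUnion.2 ⟨c, mem_children.2 ⟨hc, (h.boundary c hc y hyc v hvE hvy.symm).symm⟩, hyc⟩
  · exact fun c hc c' hc' => h.disj c (hch c hc) c' (hch c' hc')
  · exact fun c hc c' hc' => h.not_adj c (hch c hc) c' (hch c' hc')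

/-- The vertices that the table of a child refers to. -/
theorem nbhd_child_subset (h : IsTable n G E Act T D) (hv : v < n) (hvE : v ∉ E) {c : ℕ}
    (hc : c ∈ children G Act v) : nbhd n G E c ⊆ insert v (nbhd n G E v) := by
  intro y hy
  rw [mem_children] at hc
  have hvc : v ∈ nbhd n G E c := mem_nbhd.2 ⟨hv, hc.2.symm, hvE⟩
  rcases h.clique c hc.1 v hvc y hy with hvy | rfl
  · exact mem_insert_of_mem (mem_nbhd.2 ⟨(mem_nbhd.1 hy).1, hvy, (mem_nbhd.1 hy).2.2⟩)
  · exact mem_insert_self _ _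

/-- The witnesses of the children are glued together, with `v` added if it belongs to `X`. They are
disjoint, so their binary codes add up without carries; there are no edges between different `D c`,
so the values add up as well. -/
theorem entry_sound (h : IsTable n G E Act T D) (hG : ∀ u w, G.Adj u w → u < n)
    (hv : v < n) (hvE : v ∉ E) {X A : Finset ℕ} (hA : A ⊆ nbhd n G E v)
    (hX : X = A ∨ X = insert v A) :
    ∃ Y ⊆ insert v ((children G Act v).biUnion D), ∃ z,
      entry n G E Act T v X = 2 ^ n * z + bits Y ∧
        z ≤ touch n G (insert v ((children G Act v).biUnion D)) (Y ∪ A) := by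
  classical
  have hvA : v ∉ A := fun k => G.irrefl (mem_nbhd.1 (hA k)).2.1
  have hXA : ∀ y, y ≠ v → (y ∈ X ↔ y ∈ A) := by
    intro y hy
    rcases hX with rfl | rfl
    · rfl
    · simp [hy]
  have hAE : ∀ y ∈ A, y ∉ E := fun y hy => (mem_nbhd.1 (hA hy)).2.2
  have hch : ∀ c ∈ children G Act v, c ∈ Act := fun c hc => (mem_children.1 hc).1
  have hex : ∀ c, ∃ Yc z, c ∈ children G Act v → Yc ⊆ D c ∧
      T c (X ∩ nbhd n G E c) = 2 ^ n * z + bits Yc ∧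
      z ≤ touch n G (D c) (Yc ∪ (X ∩ nbhd n G E c)) := by
    intro c
    by_cases hc : c ∈ children G Act v
    · obtain ⟨Yc, h1, z, h2⟩ := h.sound c (hch c hc) (X ∩ nbhd n G E c) inter_subset_right
      exact ⟨Yc, z, fun _ => ⟨h1, h2⟩⟩
    · exact ⟨∅, 0, fun k => absurd k hc⟩
  choose W z hW using hex
  have hWE : ∀ c ∈ children G Act v, W c ⊆ E := fun c hc => (hW c hc).1.trans (h.subset (hch c hc))
  have hdisj : ∀ c ∈ children G Act v, ∀ c' ∈ children G Act v, c ≠ c' → Disjoint (W c) (W c') :=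
    fun c hc c' hc' e => (h.disj c (hch c hc) c' (hch c' hc') e).mono (hW c hc).1 (hW c' hc').1
  have hvW : v ∉ (children G Act v).biUnion W := by
    intro k
    obtain ⟨c, hc, hk⟩ := mem_biUnion.1 k
    exact hvE (hWE c hc hk)
  obtain ⟨Y, hY⟩ : ∃ Y, Y = (if v ∈ X then {v} else ∅) ∪ (children G Act v).biUnion W := ⟨_, rfl⟩
  have hvY : v ∈ Y ↔ v ∈ X := by
    by_cases k : v ∈ X <;> simp [hY, k]; simpa using hvW
  have hYW : ∀ y, y ≠ v → (y ∈ Y ↔ ∃ c ∈ children G Act v, y ∈ W c) := by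
    intro y hy
    by_cases k : v ∈ X <;> simp [hY, k, hy]
  refine ⟨Y, ?_, ((nbhd n G E v).filter fun y => ¬ (y ∈ X ↔ v ∈ X)).card +
    ∑ c ∈ children G Act v, z c, ?_, ?_⟩
  · intro y hy
    by_cases k : y = v
    · exact k ▸ mem_insert_self _ _
    · obtain ⟨c, hc, hyc⟩ := (hYW y k).1 hy
      exact mem_insert_of_mem (mem_biUnion.2 ⟨c, hc, (hW c hc).1 hyc⟩)
  · have hbits : bits Y = (if v ∈ X then 2 ^ v else 0) + ∑ c ∈ children G Act v, bits (W c) := by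
      unfold bits
      rw [hY, sum_union, sum_biUnion hdisj]
      · by_cases k : v ∈ X <;> simp [k]
      · by_cases k : v ∈ X
        · rw [if_pos k, disjoint_singleton_left]
          exact hvW
        · rw [if_neg k]
          exact disjoint_empty_left _
    have hsum : ∑ c ∈ children G Act v, T c (X ∩ nbhd n G E c) =
        2 ^ n * ∑ c ∈ children G Act v, z c + ∑ c ∈ children G Act v, bits (W c) := by
      rw [mul_sum, ← sum_add_distrib]
      exact sum_congr rfl fun c hc => (hW c hc).2.1
    rw [entry, hsum, hbits]
    ring
  · rw [h.touch_insert_children hv hvE]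
    refine add_le_add (le_of_eq ?_) (sum_le_sum fun c hc => (hW c hc).2.2.trans (le_of_eq ?_))
    · congr 1
      refine filter_congr fun y hy => ?_
      have hyv : y ≠ v := fun k => G.irrefl (k ▸ (mem_nbhd.1 hy).2.1 : G.Adj v v)
      have hyY : y ∉ Y := fun k => by
        obtain ⟨c, hc, hyc⟩ := (hYW y hyv).1 k
        exact (mem_nbhd.1 hy).2.2 (hWE c hc hyc)
      rw [mem_union, mem_union, hvY, hXA y hyv]
      tauto
    -- Seen from `D c`, the glued set agrees with the witness of `c`: eliminated neighbours of `D c`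
    -- belong to no other `D c'`, and the remaining ones are neighbours of `c` by `boundary`.
    · refine touch_congr (fun x hx => ?_) fun x hx y hxy => ?_
      · have hxE : x ∈ E := h.subset (hch c hc) hx
        have hxv : x ≠ v := fun k => hvE (k ▸ hxE)
        rw [mem_union, mem_union, hYW x hxv]
        constructor
        · rintro (k | k)
          · exact Or.inl ⟨c, hc, k⟩
          · exact absurd hxE (mem_nbhd.1 (mem_inter.1 k).2).2.2
        · rintro (⟨c', hc', k⟩ | k)
          · by_cases e : c = c'
            · exact Or.inl (e ▸ k)
            · exact absurd ((hW c' hc').1 k)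
                (disjoint_left.1 (h.disj c (hch c hc) c' (hch c' hc') e) hx)
          · exact absurd hxE (hAE x k)
      · rw [mem_union, mem_union, mem_inter]
        by_cases hyE : y ∈ E
        · have hyv : y ≠ v := fun k => hvE (k ▸ hyE)
          rw [hYW y hyv]
          constructor
          · rintro (k | k)
            · exact Or.inl ⟨c, hc, k⟩
            · exact absurd hyE (mem_nbhd.1 k.2).2.2
          · rintro (⟨c', hc', k⟩ | k)
            · by_cases e : c = c'
              · exact Or.inl (e ▸ k)
              · exact absurd hxy
                  (h.not_adj c (hch c hc) c' (hch c' hc') e x hx y ((hW c' hc').1 k))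
            · exact absurd hyE (hAE y k)
        · have hyn : y ∈ nbhd n G E c :=
            mem_nbhd.2 ⟨hG _ _ hxy.symm, h.boundary c (hch c hc) x hx y hyE hxy, hyE⟩
          have hyW : y ∉ W c := fun k => hyE (hWE c hc k)
          by_cases hyv : y = v
          · rw [hyv] at hyW hyn ⊢
            rw [hvY]
            tauto
          · rw [hYW y hyv, hXA y hyv]
            constructor
            · rintro (k | k)
              · exact absurd k hyW
              · exact Or.inr k.1
            · rintro (⟨c', hc', k⟩ | k)
              · exact absurd (hWE c' hc' k) hyE
              · exact Or.inr ⟨k, hyn⟩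

theorem bestEntry_sound (h : IsTable n G E Act T D) (hG : ∀ u w, G.Adj u w → u < n)
    (hv : v < n) (hvE : v ∉ E) {A : Finset ℕ} (hA : A ⊆ nbhd n G E v) :
    ∃ Y ⊆ insert v ((children G Act v).biUnion D), ∃ z,
      bestEntry n G E Act T v A = 2 ^ n * z + bits Y ∧
        z ≤ touch n G (insert v ((children G Act v).biUnion D)) (Y ∪ A) := by
  rcases max_choice (entry n G E Act T v A) (entry n G E Act T v (insert v A)) with e | e
  · rw [bestEntry, e]
    exact h.entry_sound hG hv hvE hA (Or.inl rfl)
  · rw [bestEntry, e]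
    exact h.entry_sound hG hv hvE hA (Or.inr rfl)

/-- The value is at most `n * n < 4 ^ n` and the witness is below `2 ^ n`. This keeps all memory
cells within `3 * n + 1` bits. -/
theorem bestEntry_lt (h : IsTable n G E Act T D) (hG : ∀ u w, G.Adj u w → u < n)
    (hE : E ⊆ range n) (hv : v < n) (hvE : v ∉ E) {A : Finset ℕ} (hA : A ⊆ nbhd n G E v) :
    bestEntry n G E Act T v A < 2 ^ (3 * n) := by
  classical
  obtain ⟨Y, hY, z, e, hz⟩ := h.bestEntry_sound hG hv hvE hA
  have hYn : Y ⊆ range n := by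
    refine hY.trans (insert_subset (mem_range.2 hv) (Subset.trans ?_ hE))
    rw [← h.union]
    exact biUnion_subset_biUnion_of_subset_left _ (filter_subset _ _)
  have h1 := bits_lt hYn
  have h2 := hz.trans (touch_le _ _)
  have h3 : n * n < 2 ^ n * 2 ^ n := Nat.mul_lt_mul'' Nat.lt_two_pow_self Nat.lt_two_pow_self
  calc bestEntry n G E Act T v A < 2 ^ n * z + 2 ^ n := by rw [e]; omega
    _ = 2 ^ n * (z + 1) := by ring
    _ ≤ 2 ^ n * (2 ^ n * 2 ^ n) := Nat.mul_le_mul_left _ (by omega)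
    _ = 2 ^ (3 * n) := by rw [← pow_add, ← pow_add]; congr 1; omega

/-- One of the two candidates puts `v` on the same side as `S` does. The neighbourhoods of the
children lie in that of `v` together with `v`, so this candidate consults the children exactly at
the traces of `S`, where their entries are good enough. -/
theorem bestEntry_complete (h : IsTable n G E Act T D)
    (hv : v < n) (hvE : v ∉ E) {S : Finset ℕ} (hS : S ⊆ range n) (hcan : IsCanonical G S) :
    2 ^ n * touch n G (insert v ((children G Act v).biUnion D)) S ≤
      bestEntry n G E Act T v (S ∩ nbhd n G E v) := by
  classical
  obtain ⟨X, hX, hXS⟩ : ∃ X, entry n G E Act T v X ≤ bestEntry n G E Act T v (S ∩ nbhd n G E v) ∧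
      ∀ y ∈ insert v (nbhd n G E v), (y ∈ X ↔ y ∈ S) := by
    have hvN : v ∉ nbhd n G E v := fun k => G.irrefl (mem_nbhd.1 k).2.1
    by_cases hvS : v ∈ S
    · refine ⟨insert v (S ∩ nbhd n G E v), le_max_right _ _, fun y hy => ?_⟩
      rcases mem_insert.1 hy with rfl | hy
      · simp [hvS]
      · have : y ≠ v := fun k => hvN (k ▸ hy)
        simp [hy, this]
    · refine ⟨S ∩ nbhd n G E v, le_max_left _ _, fun y hy => ?_⟩
      rcases mem_insert.1 hy with rfl | hy
      · simp [hvS]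
      · simp [hy]
  refine le_trans ?_ hX
  rw [h.touch_insert_children hv hvE, entry, mul_add, mul_sum]
  refine add_le_add (le_trans (le_of_eq ?_) (Nat.le_add_right _ _)) (sum_le_sum fun c hc => ?_)
  · congr 2
    refine filter_congr fun y hy => ?_
    rw [hXS y (mem_insert_of_mem hy), hXS v (mem_insert_self _ _)]
  · have : X ∩ nbhd n G E c = S ∩ nbhd n G E c := by
      ext y
      rw [mem_inter, mem_inter]
      exact and_congr_left fun hy => hXS y (h.nbhd_child_subset hv hvE hc hy)
    rw [this]
    exact h.complete c (mem_children.1 hc).1 S hS hcan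

open Classical in
/-- The elimination of a simplicial vertex. -/
theorem step (h : IsTable n G E Act T D) (hG : ∀ u w, G.Adj u w → u < n)
    (hv : v < n) (hvE : v ∉ E) (hsimp : IsSimplicial n G E v) {T' : ℕ → Finset ℕ → ℕ}
    (hold : ∀ c ∈ Act, ∀ A, T' c A = T c A)
    (hnew : ∀ A ⊆ nbhd n G E v, T' v A = 0 ∨ T' v A = bestEntry n G E Act T v A)
    (hcode : ∀ code < 2 ^ (leaders G (nbhd n G E v)).card * (n + 1),
      T' v (trace n G (nbhd n G E v) code) =
        bestEntry n G E Act T v (trace n G (nbhd n G E v) code)) (hActE : Act ⊆ E) :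
    IsTable n G (insert v E) (insert v (Act.filter fun c => ¬ G.Adj v c)) T'
      (Function.update D v (insert v ((children G Act v).biUnion D))) := by
  have hvAct : v ∉ Act := fun k => hvE (hActE k)
  have hmem : ∀ c ∈ Act.filter fun c => ¬ G.Adj v c, c ∈ Act ∧ ¬ G.Adj v c ∧ c ≠ v := by
    intro c hc
    rw [mem_filter] at hc
    exact ⟨hc.1, hc.2, fun e => hvAct (e ▸ hc.1)⟩
  have hD : ∀ c ∈ Act.filter fun c => ¬ G.Adj v c,
      Function.update D v (insert v ((children G Act v).biUnion D)) c = D c :=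
    fun c hc => Function.update_of_ne (hmem c hc).2.2 _ _
  have hDv : Function.update D v (insert v ((children G Act v).biUnion D)) v =
      insert v ((children G Act v).biUnion D) := Function.update_self _ _ _
  -- Active vertices that are not adjacent to `v` keep their neighbourhoods, and with them their
  -- tables; the adjacent ones are absorbed by `v`.
  have hN : ∀ c, ¬ G.Adj v c → nbhd n G (insert v E) c = nbhd n G E c := by
    intro c hc
    ext y
    rw [mem_nbhd, mem_nbhd, mem_insert]
    refine and_congr_right fun _ => and_congr_right fun hy => ?_
    have : y ≠ v := fun e => hc (e ▸ hy.symm)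
    tauto
  have hNv := hN v (G.irrefl)
  have hdisj : ∀ c ∈ Act.filter fun c => ¬ G.Adj v c,
      Disjoint (insert v ((children G Act v).biUnion D)) (D c) := by
    intro c hc
    obtain ⟨h1, h2, -⟩ := hmem c hc
    rw [disjoint_insert_left, disjoint_biUnion_left]
    refine ⟨fun k => hvE (h.subset h1 k), fun c' hc' => ?_⟩
    rw [mem_children] at hc'
    exact h.disj c' hc'.1 c h1 fun e => h2 (e ▸ hc'.2)
  have hcross : ∀ c ∈ Act.filter fun c => ¬ G.Adj v c,
      ∀ x ∈ insert v ((children G Act v).biUnion D), ∀ y ∈ D c, ¬ G.Adj x y := by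
    intro c hc x hx y hy hxy
    obtain ⟨h1, h2, -⟩ := hmem c hc
    rcases mem_insert.1 hx with rfl | hx
    · exact h2 (h.boundary c h1 y hy x hvE hxy.symm).symm
    · obtain ⟨c', hc', hx⟩ := mem_biUnion.1 hx
      rw [mem_children] at hc'
      exact h.not_adj c' hc'.1 c h1 (fun e => h2 (e ▸ hc'.2)) x hx y hy hxy
  constructor
  · rw [biUnion_insert, hDv, biUnion_congr rfl hD, ← h.union, insert_union]
    congr 1
    ext x
    simp only [mem_union, mem_biUnion, mem_children, mem_filter]
    constructor
    · rintro (⟨c, hc, hx⟩ | ⟨c, hc, hx⟩)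
      · exact ⟨c, hc.1, hx⟩
      · exact ⟨c, hc.1, hx⟩
    · rintro ⟨c, hc, hx⟩
      by_cases e : G.Adj v c
      · exact Or.inl ⟨c, ⟨hc, e⟩, hx⟩
      · exact Or.inr ⟨c, ⟨hc, e⟩, hx⟩
  · intro c hc c' hc' hne
    rcases mem_insert.1 hc with rfl | hc <;> rcases mem_insert.1 hc' with rfl | hc'
    · exact absurd rfl hne
    · rw [hDv, hD c' hc']
      exact hdisj c' hc'
    · rw [hDv, hD c hc]
      exact (hdisj c hc).symm
    · rw [hD c hc, hD c' hc']
      exact h.disj c (hmem c hc).1 c' (hmem c' hc').1 hne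
  · intro c hc c' hc' hne
    rcases mem_insert.1 hc with rfl | hc <;> rcases mem_insert.1 hc' with rfl | hc'
    · exact absurd rfl hne
    · rw [hDv, hD c' hc']
      exact hcross c' hc'
    · rw [hDv, hD c hc]
      exact fun x hx y hy hxy => hcross c hc y hy x hx hxy.symm
    · rw [hD c hc, hD c' hc']
      exact h.not_adj c (hmem c hc).1 c' (hmem c' hc').1 hne
  · intro c hc x hx y hy hxy
    have hyE : y ∉ E := fun k => hy (mem_insert_of_mem k)
    rcases mem_insert.1 hc with rfl | hc
    · rw [hDv] at hx
      rcases mem_insert.1 hx with rfl | hx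
      · exact hxy
      · obtain ⟨c', hc', hx⟩ := mem_biUnion.1 hx
        -- An edge leaving the part of a child ends in the neighbourhood of that child, hence at `v`
        -- or at a neighbour of `v`.
        have hcy := h.boundary c' (mem_children.1 hc').1 x hx y hyE hxy
        have := h.nbhd_child_subset hv hvE hc' (mem_nbhd.2 ⟨hG _ _ hxy.symm, hcy, hyE⟩)
        rcases mem_insert.1 this with rfl | hy'
        · exact absurd (mem_insert_self _ _) hy
        · exact (mem_nbhd.1 hy').2.1
    · rw [hD c hc] at hx
      exact h.boundary c (hmem c hc).1 x hx y hyE hxy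
  · intro c hc
    unfold IsSimplicial
    rcases mem_insert.1 hc with rfl | hc
    · rw [hNv]
      exact hsimp
    · rw [hN c (hmem c hc).2.1]
      exact h.clique c (hmem c hc).1
  · intro c hc A hA
    rcases mem_insert.1 hc with rfl | hc
    · rw [hNv] at hA
      rw [hDv]
      rcases hnew A hA with e | e
      -- An entry that was never written is zero, which soundly encodes the empty witness with value
      -- zero.
      · exact ⟨∅, empty_subset _, 0, by simp [e, bits], Nat.zero_le _⟩
      · rw [e]
        exact h.bestEntry_sound hG hv hvE hA
    · rw [hN c (hmem c hc).2.1] at hA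
      rw [hD c hc, hold c (hmem c hc).1]
      exact h.sound c (hmem c hc).1 A hA
  · intro c hc S hS hcan
    rcases mem_insert.1 hc with rfl | hc
    -- The remaining neighbours of `v` form a clique, so the trace of a canonical set on them has a
    -- code, and its entry was computed.
    · obtain ⟨code, hlt, hcode'⟩ := exists_trace_eq hG nbhd_subset_range hS hsimp hcan
      rw [hNv, hDv, ← hcode', hcode code hlt, hcode']
      exact h.bestEntry_complete hv hvE hS hcan
    · rw [hN c (hmem c hc).2.1, hD c hc, hold c (hmem c hc).1]
      exact h.complete c (hmem c hc).1 S hS hcan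

theorem initial (T : ℕ → Finset ℕ → ℕ) (D : ℕ → Finset ℕ) : IsTable n G ∅ ∅ T D := by
  constructor <;> simp

/-- The sum of the tables of the remaining active vertices encodes a maximum cut. -/
theorem final (h : IsTable n G (range n) Act T D) (hG : ∀ u w, G.Adj u w → u < n) :
    ∃ X ⊆ range n, (∑ c ∈ Act, T c ∅) % 2 ^ n = bits X ∧
      ∀ S ⊆ range n, cutCard n G S ≤ cutCard n G X := by
  classical
  have hN : ∀ c, nbhd n G (range n) c = ∅ := by
    intro c
    refine eq_empty_of_forall_notMem fun y hy => ?_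
    rw [mem_nbhd, mem_range] at hy
    exact hy.2.2 hy.1
  have hex : ∀ c, ∃ Yc z, c ∈ Act → Yc ⊆ D c ∧
      T c ∅ = 2 ^ n * z + bits Yc ∧ z ≤ touch n G (D c) Yc := by
    intro c
    by_cases hc : c ∈ Act
    · obtain ⟨Yc, h1, z, h2⟩ := h.sound c hc ∅ (empty_subset _)
      rw [union_empty] at h2
      exact ⟨Yc, z, fun _ => ⟨h1, h2⟩⟩
    · exact ⟨∅, 0, fun k => absurd k hc⟩
  choose W z hW using hex
  have hX : Act.biUnion W ⊆ range n := by
    rw [← h.union]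
    exact biUnion_mono fun c hc => (hW c hc).1
  have hbits : bits (Act.biUnion W) = ∑ c ∈ Act, bits (W c) :=
    sum_biUnion fun c hc c' hc' e => (h.disj c hc c' hc' e).mono (hW c hc).1 (hW c' hc').1
  have hsum : ∑ c ∈ Act, T c ∅ = 2 ^ n * ∑ c ∈ Act, z c + bits (Act.biUnion W) := by
    rw [hbits, mul_sum, ← sum_add_distrib]
    exact sum_congr rfl fun c hc => (hW c hc).2.1
  have hlt := bits_lt hX
  have hcut : ∀ S, cutCard n G S = ∑ c ∈ Act, touch n G (D c) S := by
    intro S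
    rw [← touch_range, ← h.union, touch_biUnion h.disj h.not_adj]
  have hz : ∑ c ∈ Act, z c ≤ cutCard n G (Act.biUnion W) := by
    rw [hcut]
    refine sum_le_sum fun c hc => (hW c hc).2.2.trans (le_of_eq ?_)
    have key : ∀ y, (∀ c' ∈ Act, y ∈ D c' → c = c') → (y ∈ W c ↔ y ∈ Act.biUnion W) := by
      intro y hy
      refine ⟨fun k => mem_biUnion.2 ⟨c, hc, k⟩, fun k => ?_⟩
      obtain ⟨c', hc', k⟩ := mem_biUnion.1 k
      rw [hy c' hc' ((hW c' hc').1 k)]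
      exact k
    refine touch_congr (fun x hx => key x fun c' hc' hx' => ?_)
      fun x hx y hxy => key y fun c' hc' hy => ?_
    · by_contra e
      exact disjoint_left.1 (h.disj c hc c' hc' e) hx hx'
    · by_contra e
      exact h.not_adj c hc c' hc' e x hx y hy hxy
  refine ⟨_, hX, ?_, ?_⟩
  · rw [hsum, Nat.mul_add_mod, Nat.mod_eq_of_lt hlt]
  -- For a canonical maximum cut, completeness gives `2 ^ n * cutCard n G S₀ ≤ ∑ T c ∅`, and the
  -- right side is below `2 ^ n * (∑ z c + 1)`. Hence its size is at most `∑ z c`, and so at most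
  -- the cut of the union of the witnesses.
  · obtain ⟨S₀, hS₀, hcan, hmax⟩ := exists_isCanonical_max hG
    have h1 : 2 ^ n * cutCard n G S₀ ≤ ∑ c ∈ Act, T c ∅ := by
      rw [hcut, mul_sum]
      refine sum_le_sum fun c hc => ?_
      have := h.complete c hc S₀ hS₀ hcan
      rwa [hN, inter_empty] at this
    have h2 : 2 ^ n * cutCard n G S₀ < 2 ^ n * (∑ c ∈ Act, z c + 1) := by
      rw [mul_add]
      omega
    have h3 := lt_of_mul_lt_mul_left h2 (Nat.zero_le _)
    intro S hS
    have := hmax S hS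
    omega

end IsTable

end Elimination

/-! ### Computing with graphs and sets of vertices -/

namespace Ctx

variable {Γ : Type} {C : Ctx Γ}

/-- A set of numbers below `n` whose binary code is computable in polynomial time. -/
structure ComputableSet (C : Ctx Γ) (S : Γ → Finset ℕ) : Prop where
  subset : ∀ γ, C.ok γ → S γ ⊆ range (C.n γ)
  bits : C.Computable fun γ => bits (S γ)

/-- The memory contains the adjacency matrix of `G`. -/
structure Reads (C : Ctx Γ) (G : Γ → SimpleGraph ℕ) : Prop where
  lt : ∀ γ, C.ok γ → ∀ u w, (G γ).Adj u w → u < C.n γ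
  mem_eq : ∀ γ, C.ok γ → ∀ u w, u < C.n γ → w < C.n γ →
    C.mem γ (u * C.n γ + w) = ind ((G γ).Adj u w)

theorem Reads.ext {G : Γ → SimpleGraph ℕ} (h : C.Reads G) : C.ext.Reads fun p => G p.1 :=
  ⟨fun p hp => h.lt p.1 hp.1, fun p hp => h.mem_eq p.1 hp.1⟩

theorem ComputableSet.fst {S : Γ → Finset ℕ} (hS : C.ComputableSet S) :
    C.ext.ComputableSet fun p => S p.1 :=
  ⟨fun p hp => hS.subset p.1 hp.1, hS.bits.fst⟩

theorem Decides.mem {S : Γ → Finset ℕ} (hS : C.ComputableSet S) {F : Γ → ℕ} (hF : C.Computable F) :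
    C.Decides fun γ => F γ ∈ S γ := by
  -- The position `F - (F - n)` is the minimum of `F` and `n`; capping it meets the bound of
  -- `Decides.testBit` and is harmless, as `F < n` is tested too.
  refine ((Decides.lt hF Computable.n).and (Decides.testBit hS.bits
    (hF.sub (hF.sub Computable.n)) fun γ _ => by omega)).congr fun γ hγ => ?_
  constructor
  · rintro ⟨h1, h2⟩
    rwa [show F γ - (F γ - C.n γ) = F γ by omega, testBit_bits] at h2
  · intro h
    have h1 := mem_range.1 (hS.subset γ hγ h)
    refine ⟨h1, ?_⟩
    rwa [show F γ - (F γ - C.n γ) = F γ by omega, testBit_bits]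

theorem ComputableSet.of_decides {S : Γ → Finset ℕ} {q : Γ → ℕ → Prop}
    (hq : C.ext.Decides fun p => q p.1 p.2)
    (h : ∀ γ, C.ok γ → ∀ u, u ∈ S γ ↔ u < C.n γ ∧ q γ u) : C.ComputableSet S := by
  classical
  refine ⟨fun γ hγ u hu => mem_range.2 ((h γ hγ u).1 hu).1, ?_⟩
  refine (Computable.sum_filter (F := fun _ u => 2 ^ u) hq (Computable.two_pow (C := C.ext)
    Computable.snd fun p hp => hp.2.le)).congr fun γ hγ => ?_
  unfold MaxCutBubbles.bits
  refine sum_congr ?_ fun _ _ => rfl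
  ext u
  rw [mem_filter, mem_range, h γ hγ]

theorem Computable.sum_mem {S : Γ → Finset ℕ} (hS : C.ComputableSet S) {F : Γ → ℕ → ℕ}
    (hF : C.ext.Computable fun p => F p.1 p.2) : C.Computable fun γ => ∑ i ∈ S γ, F γ i := by
  classical
  refine (Computable.sum_filter (q := fun γ i => i ∈ S γ) (Decides.mem hS.fst Computable.snd)
    hF).congr fun γ hγ => sum_congr ?_ fun _ _ => rfl
  ext u
  rw [mem_filter]
  exact and_iff_right_of_imp fun h => hS.subset γ hγ h

theorem ComputableSet.card {S : Γ → Finset ℕ} (hS : C.ComputableSet S) :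
    C.Computable fun γ => (S γ).card :=
  (Computable.sum_mem (F := fun _ _ => 1) hS (Computable.const 1)).congr fun γ _ => by simp

theorem Decides.forall_mem {S : Γ → Finset ℕ} (hS : C.ComputableSet S) {q : Γ → ℕ → Prop}
    (hq : C.ext.Decides fun p => q p.1 p.2) : C.Decides fun γ => ∀ i ∈ S γ, q γ i :=
  (Decides.forall (q := fun γ i => i ∈ S γ → q γ i)
    ((Decides.mem hS.fst Computable.snd).imp hq)).congr fun γ hγ =>
    ⟨fun h i hi => h i (mem_range.1 (hS.subset γ hγ hi)) hi, fun h i _ hi => h i hi⟩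

theorem Decides.exists_mem {S : Γ → Finset ℕ} (hS : C.ComputableSet S) {q : Γ → ℕ → Prop}
    (hq : C.ext.Decides fun p => q p.1 p.2) : C.Decides fun γ => ∃ i ∈ S γ, q γ i :=
  (Decides.exists (q := fun γ i => i ∈ S γ ∧ q γ i)
    ((Decides.mem hS.fst Computable.snd).and hq)).congr fun γ hγ =>
    ⟨fun ⟨i, _, hi⟩ => ⟨i, hi⟩, fun ⟨i, hi⟩ => ⟨i, mem_range.1 (hS.subset γ hγ hi.1), hi⟩⟩

theorem ComputableSet.filter {S : Γ → Finset ℕ} (hS : C.ComputableSet S) {q : Γ → ℕ → Prop}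
    [∀ γ, DecidablePred (q γ)] (hq : C.ext.Decides fun p => q p.1 p.2) :
    C.ComputableSet fun γ => (S γ).filter (q γ) :=
  .of_decides (q := fun γ i => i ∈ S γ ∧ q γ i) ((Decides.mem hS.fst Computable.snd).and hq)
    fun γ hγ u => by
      rw [mem_filter]
      exact ⟨fun h => ⟨mem_range.1 (hS.subset γ hγ h.1), h⟩, fun h => h.2⟩

theorem ComputableSet.inter {S S' : Γ → Finset ℕ} (hS : C.ComputableSet S)
    (hS' : C.ComputableSet S') : C.ComputableSet fun γ => S γ ∩ S' γ :=
  .of_decides (q := fun γ i => i ∈ S γ ∧ i ∈ S' γ)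
    ((Decides.mem hS.fst Computable.snd).and (Decides.mem hS'.fst Computable.snd))
    fun γ hγ u => by
      rw [mem_inter]
      exact ⟨fun h => ⟨mem_range.1 (hS.subset γ hγ h.1), h⟩, fun h => h.2⟩

theorem ComputableSet.insert {S : Γ → Finset ℕ} (hS : C.ComputableSet S) {F : Γ → ℕ}
    (hF : C.Computable F) (hlt : ∀ γ, C.ok γ → F γ < C.n γ) :
    C.ComputableSet fun γ => insert (F γ) (S γ) :=
  .of_decides (q := fun γ i => i = F γ ∨ i ∈ S γ)
    ((Decides.eq Computable.snd hF.fst).or (Decides.mem hS.fst Computable.snd))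
    fun γ hγ u => by
      rw [mem_insert]
      refine ⟨fun h => ⟨?_, h⟩, fun h => h.2⟩
      rcases h with rfl | h
      · exact hlt γ hγ
      · exact mem_range.1 (hS.subset γ hγ h)

/-! ### Deciding graph properties from the adjacency matrix -/

section

variable {G : Γ → SimpleGraph ℕ}

theorem Decides.adj (h : C.Reads G) {F F' : Γ → ℕ} (hF : C.Computable F) (hF' : C.Computable F') :
    C.Decides fun γ => (G γ).Adj (F γ) (F' γ) := by
  -- The range tests are needed because, for indices not below `n`, the address need not hold the
  -- wanted matrix entry.
  refine (((Decides.lt hF Computable.n).and (Decides.lt hF' Computable.n)).and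
    (Decides.eq (((hF.mul Computable.n).add hF').load) (Computable.const 1))).congr fun γ hγ => ?_
  constructor
  · rintro ⟨⟨h1, h2⟩, h3⟩
    rw [h.mem_eq γ hγ _ _ h1 h2] at h3
    by_contra hn
    rw [ind_false hn] at h3
    exact absurd h3 (by norm_num)
  · intro ha
    have h1 := h.lt γ hγ _ _ ha
    have h2 := h.lt γ hγ _ _ ha.symm
    refine ⟨⟨h1, h2⟩, ?_⟩
    rw [h.mem_eq γ hγ _ _ h1 h2, ind_true ha]

theorem Decides.closedAdj (h : C.Reads G) {F F' : Γ → ℕ} (hF : C.Computable F)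
    (hF' : C.Computable F') : C.Decides fun γ => ClosedAdj (G γ) (F γ) (F' γ) :=
  (Decides.adj h hF hF').or (Decides.eq hF hF')

/-- Numbers from `n` on are isolated, so the unbounded quantifier in `SameNbhd` can be cut off at
`n` and checked by a loop. -/
theorem sameNbhd_iff {n : ℕ} {G : SimpleGraph ℕ} (hG : ∀ u w, G.Adj u w → u < n) {u w : ℕ}
    (hu : u < n) : SameNbhd G u w ↔ w < n ∧ ∀ x < n, (ClosedAdj G u x ↔ ClosedAdj G w x) := by
  constructor
  · intro h
    refine ⟨?_, fun x _ => h x⟩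
    rcases h.closedAdj with h | rfl
    · exact hG _ _ h.symm
    · exact hu
  · rintro ⟨hw, h⟩ x
    by_cases hx : x < n
    · exact h x hx
    · have key : ∀ y < n, ¬ ClosedAdj G y x := by
        rintro y hy (h | rfl)
        · exact hx (hG _ _ h.symm)
        · exact hx hy
      exact iff_of_false (key u hu) (key w hw)

theorem Decides.sameNbhd (h : C.Reads G) {F F' : Γ → ℕ} (hF : C.Computable F)
    (hF' : C.Computable F') (hlt : ∀ γ, C.ok γ → F γ < C.n γ) :
    C.Decides fun γ => SameNbhd (G γ) (F γ) (F' γ) :=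
  ((Decides.lt hF' Computable.n).and
    (Decides.forall (q := fun γ x => ClosedAdj (G γ) (F γ) x ↔ ClosedAdj (G γ) (F' γ) x)
      ((Decides.closedAdj h.ext hF.fst Computable.snd).iff
        (Decides.closedAdj h.ext hF'.fst Computable.snd)))).congr
    fun γ hγ => (sameNbhd_iff (h.lt γ hγ) (hlt γ hγ)).symm

theorem ComputableSet.nbhd (h : C.Reads G) {E : Γ → Finset ℕ} (hE : C.ComputableSet E) {F : Γ → ℕ}
    (hF : C.Computable F) : C.ComputableSet fun γ => nbhd (C.n γ) (G γ) (E γ) (F γ) :=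
  .of_decides (q := fun γ u => (G γ).Adj (F γ) u ∧ u ∉ E γ)
    ((Decides.adj h.ext hF.fst Computable.snd).and (Decides.mem hE.fst Computable.snd).not)
    fun _ _ _ => mem_nbhd

theorem ComputableSet.leaders (h : C.Reads G) {K : Γ → Finset ℕ} (hK : C.ComputableSet K) :
    C.ComputableSet fun γ => leaders (G γ) (K γ) := by
  classical
  exact hK.filter (q := fun γ w => ∀ w' ∈ K γ, SameNbhd (G γ) w w' → w ≤ w')
    (Decides.forall_mem hK.fst (q := fun p w' => SameNbhd (G p.1) p.2 w' → p.2 ≤ w')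
      ((Decides.sameNbhd h.ext.ext Computable.snd.fst Computable.snd fun p hp => hp.1.2).imp
        (Decides.le Computable.snd.fst Computable.snd)))

theorem Computable.rank (h : C.Reads G) {K : Γ → Finset ℕ} (hK : C.ComputableSet K) {F : Γ → ℕ}
    (hF : C.Computable F) : C.Computable fun γ => rank (G γ) (K γ) (F γ) :=
  ((hK.leaders h).filter (q := fun γ l => l < F γ) (Decides.lt Computable.snd hF.fst)).card

theorem rank_le {n : ℕ} {G : SimpleGraph ℕ} {K : Finset ℕ} (hK : K ⊆ range n) (l : ℕ) :
    MaxCutBubbles.rank G K l ≤ n := by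
  classical
  have h1 : (MaxCutBubbles.leaders G K).filter (fun l' => l' < l) ⊆ range n :=
    (filter_subset _ _).trans ((filter_subset _ _).trans hK)
  exact (card_le_card h1).trans (card_range n).le

theorem ComputableSet.trace (h : C.Reads G) {K : Γ → Finset ℕ} (hK : C.ComputableSet K) {F : Γ → ℕ}
    (hF : C.Computable F) : C.ComputableSet fun γ => trace (C.n γ) (G γ) (K γ) (F γ) := by
  classical
  have hn1 : C.Computable fun γ => C.n γ + 1 := Computable.n.add (Computable.const 1)
  have ht := hF.mod hn1
  have hm := hF.div hn1
  refine hK.filter (q := fun γ u => if SameNbhd (G γ) u (F γ % (C.n γ + 1)) then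
    u ≤ F γ % (C.n γ + 1) else ∃ l ∈ MaxCutBubbles.leaders (G γ) (K γ), SameNbhd (G γ) u l ∧
      (F γ / (C.n γ + 1)).testBit (MaxCutBubbles.rank (G γ) (K γ) l) = true) ?_
  have h1 : C.ext.Decides fun p => SameNbhd (G p.1) p.2 (F p.1 % (C.n p.1 + 1)) :=
    Decides.sameNbhd h.ext Computable.snd ht.fst fun p hp => hp.2
  have h2 : C.ext.Decides fun p => p.2 ≤ F p.1 % (C.n p.1 + 1) := Decides.le Computable.snd ht.fst
  have h3 : C.ext.Decides fun p => ∃ l ∈ MaxCutBubbles.leaders (G p.1) (K p.1),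
      SameNbhd (G p.1) p.2 l ∧
      (F p.1 / (C.n p.1 + 1)).testBit (MaxCutBubbles.rank (G p.1) (K p.1) l) = true :=
    Decides.exists_mem (hK.leaders h).fst
      (q := fun p l => SameNbhd (G p.1) p.2 l ∧
        (F p.1 / (C.n p.1 + 1)).testBit (MaxCutBubbles.rank (G p.1) (K p.1) l) = true)
      ((Decides.sameNbhd h.ext.ext Computable.snd.fst Computable.snd fun p hp => hp.1.2).and
        (Decides.testBit hm.fst.fst (Computable.rank h.ext.ext hK.fst.fst Computable.snd)
          fun p hp => rank_le (hK.subset p.1.1 hp.1.1) _))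
  exact ((h1.and h2).or (h1.not.and h3)).congr fun p _ => by
    by_cases hs : SameNbhd (G p.1) p.2 (F p.1 % (C.n p.1 + 1))
    · rw [if_pos hs]
      tauto
    · rw [if_neg hs]
      tauto

theorem Decides.isSimplicial (h : C.Reads G) {E : Γ → Finset ℕ} (hE : C.ComputableSet E)
    {F : Γ → ℕ} (hF : C.Computable F) :
    C.Decides fun γ => IsSimplicial (C.n γ) (G γ) (E γ) (F γ) :=
  have hN := ComputableSet.nbhd h hE hF
  Decides.forall_mem hN (q := fun γ x => ∀ y ∈ MaxCutBubbles.nbhd (C.n γ) (G γ) (E γ) (F γ),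
      ClosedAdj (G γ) x y)
    (Decides.forall_mem hN.fst (q := fun p y => ClosedAdj (G p.1) p.2 y)
      (Decides.closedAdj h.ext.ext Computable.snd.fst Computable.snd))

end

end Ctx

/-- The address of the entry for the set `A` in the table of `c`. -/
def tableAddr (n c : ℕ) (A : Finset ℕ) : ℕ :=
  (bits A + n) * n + c

/-- The tables that are stored in the memory. -/
def tables (n : ℕ) (mem : ℕ → ℕ) (c : ℕ) (A : Finset ℕ) : ℕ :=
  mem (tableAddr n c A)

/-! ### Computing table entries -/

namespace Ctx

variable {Γ : Type} {C : Ctx Γ} {G : Γ → SimpleGraph ℕ}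

theorem Computable.tableAddr {F : Γ → ℕ} (hF : C.Computable F) {A : Γ → Finset ℕ}
    (hA : C.ComputableSet A) : C.Computable fun γ => tableAddr (C.n γ) (F γ) (A γ) :=
  ((hA.bits.add Computable.n).mul Computable.n).add hF

theorem Computable.tables {F : Γ → ℕ} (hF : C.Computable F) {A : Γ → Finset ℕ}
    (hA : C.ComputableSet A) : C.Computable fun γ => tables (C.n γ) (C.mem γ) (F γ) (A γ) :=
  (hF.tableAddr hA).load

theorem Computable.entry (h : C.Reads G) {E Act X : Γ → Finset ℕ} (hE : C.ComputableSet E)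
    (hAct : C.ComputableSet Act) (hX : C.ComputableSet X) {F : Γ → ℕ} (hF : C.Computable F)
    (hlt : ∀ γ, C.ok γ → F γ < C.n γ) : C.Computable fun γ =>
      entry (C.n γ) (G γ) (E γ) (Act γ) (MaxCutBubbles.tables (C.n γ) (C.mem γ)) (F γ) (X γ) := by
  classical
  have hFX : C.Decides fun γ => F γ ∈ X γ := Decides.mem hX hF
  have h1 : C.ComputableSet fun γ => (nbhd (C.n γ) (G γ) (E γ) (F γ)).filter
      fun y => ¬ (y ∈ X γ ↔ F γ ∈ X γ) :=
    (ComputableSet.nbhd h hE hF).filter (q := fun γ y => ¬ (y ∈ X γ ↔ F γ ∈ X γ))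
      ((Decides.mem hX.fst Computable.snd).iff hFX.fst).not
  have h2 : C.Computable fun γ => if F γ ∈ X γ then 2 ^ F γ else 0 :=
    Computable.ite hFX (hF.two_pow fun γ hγ => (hlt γ hγ).le) (Computable.const 0)
  have h3 : C.ComputableSet fun γ => children (G γ) (Act γ) (F γ) :=
    hAct.filter (q := fun γ => (G γ).Adj (F γ)) (Decides.adj h.ext hF.fst Computable.snd)
  have h4 : C.Computable fun γ => ∑ c ∈ children (G γ) (Act γ) (F γ),
      MaxCutBubbles.tables (C.n γ) (C.mem γ) c (X γ ∩ nbhd (C.n γ) (G γ) (E γ) c) :=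
    Computable.sum_mem h3 (Computable.tables (C := C.ext) Computable.snd
      (hX.fst.inter (ComputableSet.nbhd h.ext hE.fst Computable.snd)))
  exact (((Computable.n.two_pow fun _ _ => le_rfl).mul h1.card).add h2).add h4

theorem Computable.bestEntry (h : C.Reads G) {E Act A : Γ → Finset ℕ} (hE : C.ComputableSet E)
    (hAct : C.ComputableSet Act) (hA : C.ComputableSet A) {F : Γ → ℕ} (hF : C.Computable F)
    (hlt : ∀ γ, C.ok γ → F γ < C.n γ) : C.Computable fun γ =>
      bestEntry (C.n γ) (G γ) (E γ) (Act γ) (MaxCutBubbles.tables (C.n γ) (C.mem γ)) (F γ) (A γ) :=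
  (Computable.entry h hE hAct hA hF hlt).max (Computable.entry h hE hAct (hA.insert hF hlt) hF hlt)

open Classical in
/-- The least vertex that is not eliminated and simplicial. -/
theorem Computable.leastSimplicial (h : C.Reads G) {E : Γ → Finset ℕ} (hE : C.ComputableSet E) :
    C.Computable fun γ => ((range (C.n γ)).filter fun i => ∀ j < C.n γ, j ≤ i →
      ¬ (j ∉ E γ ∧ IsSimplicial (C.n γ) (G γ) (E γ) j)).card :=
  Computable.card_filter (q := fun γ i => ∀ j < C.n γ, j ≤ i →
      ¬ (j ∉ E γ ∧ IsSimplicial (C.n γ) (G γ) (E γ) j))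
    (Decides.forall (C := C.ext) (q := fun p j => j ≤ p.2 →
      ¬ (j ∉ E p.1 ∧ IsSimplicial (C.n p.1) (G p.1) (E p.1) j))
      ((Decides.le Computable.snd Computable.snd.fst).imp
        ((Decides.mem hE.fst.fst Computable.snd).not.and
          (Decides.isSimplicial h.ext.ext hE.fst.fst Computable.snd)).not))

end Ctx

-- The numbers with no solution up to and including them are exactly those below the least solution,
-- so a count replaces a search.
open Classical in
theorem card_filter_eq_least {n : ℕ} {q : ℕ → Prop} (h : ∃ v < n, q v) :
    ∃ v < n, q v ∧ ((range n).filter fun i => ∀ j < n, j ≤ i → ¬ q j).card = v := by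
  refine ⟨Nat.find h, (Nat.find_spec h).1, (Nat.find_spec h).2, ?_⟩
  have : ((range n).filter fun i => ∀ j < n, j ≤ i → ¬ q j) = range (Nat.find h) := by
    ext i
    rw [mem_filter, mem_range, mem_range]
    constructor
    · rintro ⟨hi, hq⟩
      by_contra hle
      exact hq _ (Nat.find_spec h).1 (not_lt.1 hle) (Nat.find_spec h).2
    · intro hi
      refine ⟨hi.trans (Nat.find_spec h).1, fun j hj hji hq => ?_⟩
      exact Nat.find_min h (hji.trans_lt hi) ⟨hj, hq⟩
  rw [this, card_range]

/-! ### The program -/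

/-- What the registers and the memory hold during the run of the program: the graph, the sets of
eliminated and of active vertices, the vertex that is eliminated, and a set of its neighbours with
its number. -/
structure Snapshot where
  n : ℕ
  G : SimpleGraph ℕ
  E : Finset ℕ
  Act : Finset ℕ
  v : ℕ
  code : ℕ
  A : Finset ℕ
  mem : ℕ → ℕ

namespace Snapshot

/-- All numbers have at most `3 * n + 1` bits. -/
structure Fits (γ : Snapshot) : Prop where
  E_subset : γ.E ⊆ range γ.n
  Act_subset : γ.Act ⊆ range γ.n
  v_le : γ.v ≤ γ.n
  size_code_le : γ.code.size ≤ 3 * γ.n + 1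
  A_subset : γ.A ⊆ range γ.n
  size_mem_le : ∀ x, (γ.mem x).size ≤ 3 * γ.n + 1

/-- The memory contains the adjacency matrix. -/
structure HasMatrix (γ : Snapshot) : Prop where
  lt : ∀ u w, γ.G.Adj u w → u < γ.n
  mem_eq : ∀ u w, u < γ.n → w < γ.n → γ.mem (u * γ.n + w) = ind (γ.G.Adj u w)

/-- The state `s` is as described by the snapshot. -/
structure Rep (γ : Snapshot) (s : RamState) : Prop where
  n : s.reg 0 = γ.n
  E : s.reg 1 = bits γ.E
  Act : s.reg 2 = bits γ.Act
  v : s.reg 3 = γ.v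
  code : s.reg 4 = γ.code
  A : s.reg 5 = bits γ.A
  mem : s.mem = γ.mem

theorem Rep.of_agree {γ : Snapshot} {s s' : RamState} (h : γ.Rep s) (hm : s'.mem = s.mem)
    (hr : ∀ j < 10, s'.reg j = s.reg j) : γ.Rep s' :=
  ⟨(hr 0 (by norm_num)).trans h.n, (hr 1 (by norm_num)).trans h.E,
    (hr 2 (by norm_num)).trans h.Act, (hr 3 (by norm_num)).trans h.v,
    (hr 4 (by norm_num)).trans h.code, (hr 5 (by norm_num)).trans h.A, hm.trans h.mem⟩

theorem size_bits_le {n : ℕ} {S : Finset ℕ} (h : S ⊆ range n) : (bits S).size ≤ n :=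
  Nat.size_le.2 (bits_lt h)

/-- The context of the snapshots that satisfy a condition. -/
def ctx (good : Snapshot → Prop) : Ctx Snapshot where
  ok γ := γ.Fits ∧ good γ
  size γ := 3 * γ.n + 1
  n := n
  mem := mem
  len := 5
  var j γ := match j with
    | 0 => bits γ.E
    | 1 => bits γ.Act
    | 2 => γ.v
    | 3 => γ.code
    | _ => bits γ.A
  n_le γ _ := by omega
  size_mem_le γ h := h.1.size_mem_le
  size_var_le γ h j _ := match j with
    | 0 => (size_bits_le h.1.E_subset).trans (by omega)
    | 1 => (size_bits_le h.1.Act_subset).trans (by omega)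
    | 2 => (size_le_self _).trans (h.1.v_le.trans (by omega))
    | 3 => h.1.size_code_le
    | _ + 4 => (size_bits_le h.1.A_subset).trans (by omega)

variable {good : Snapshot → Prop}

theorem Rep.holds {γ : Snapshot} {s : RamState} (h : γ.Rep s) {k : ℕ} (hk : 6 ≤ k) :
    (ctx good).Holds (fun j => j + 1) k γ s where
  pos := by omega
  reg_zero := h.n
  mem_eq := h.mem
  loc_lt j hj := by
    have : j < 5 := hj
    omega
  reg_loc j hj := by
    have : j < 5 := hj
    match j with
    | 0 => exact h.E
    | 1 => exact h.Act
    | 2 => exact h.v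
    | 3 => exact h.code
    | 4 => exact h.A

theorem computable_v : (ctx good).Computable v :=
  Ctx.Computable.var (C := ctx good) 2 (show 2 < 5 by norm_num)

theorem computable_code : (ctx good).Computable code :=
  Ctx.Computable.var (C := ctx good) 3 (show 3 < 5 by norm_num)

theorem computableSet_E : (ctx good).ComputableSet E :=
  ⟨fun _ h => h.1.E_subset, Ctx.Computable.var (C := ctx good) 0 (show 0 < 5 by norm_num)⟩

theorem computableSet_Act : (ctx good).ComputableSet Act :=
  ⟨fun _ h => h.1.Act_subset, Ctx.Computable.var (C := ctx good) 1 (show 1 < 5 by norm_num)⟩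

theorem computableSet_A : (ctx good).ComputableSet A :=
  ⟨fun _ h => h.1.A_subset, Ctx.Computable.var (C := ctx good) 4 (show 4 < 5 by norm_num)⟩

theorem reads (h : ∀ γ, good γ → γ.HasMatrix) : (ctx good).Reads G :=
  ⟨fun γ hγ => (h γ hγ.2).lt, fun γ hγ => (h γ hγ.2).mem_eq⟩

/-- The bound holds for every larger exponent too, so that all pieces of the program can share one.
The base `3 * n + 3` is the size of the context plus two. -/
theorem exists_prog {F : Snapshot → ℕ} (hF : (ctx good).Computable F) :
    ∃ (P : ℕ → RamProg) (c : ℕ), ∀ c' ≥ c, ∀ γ s k, 6 ≤ k → γ.Fits → good γ → γ.Rep s →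
      (F γ).size ≤ (3 * γ.n + 3) ^ c' ∧ Evaluates (P k) s k ((3 * γ.n + 3) ^ c') (F γ) := by
  obtain ⟨⟨a, ha⟩, P, T, ⟨b, hb⟩, hP⟩ := hF
  refine ⟨fun k => P (fun j => j + 1) k, a + b, fun c' hc γ s k hk h1 h2 h3 => ⟨?_, ?_⟩⟩
  · exact (ha γ ⟨h1, h2⟩).trans (Nat.pow_le_pow_right (Nat.succ_pos _) (by omega))
  · obtain ⟨t, s', h4, h5, h6⟩ := hP _ k γ s ⟨h1, h2⟩ (h3.holds hk)
    exact ⟨t, s', h4, (h5.trans (hb γ ⟨h1, h2⟩)).trans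
      (Nat.pow_le_pow_right (Nat.succ_pos _) (by omega)), h6⟩

end Snapshot

/-- A loop that counts down. -/
theorem exists_runs_loop {r : ℕ} {P : RamProg} {I : ℕ → RamState → Prop} {U : ℕ}
    (hr : ∀ k s, I k s → s.reg r = k)
    (hstep : ∀ k s, I (k + 1) s → ∃ t s', P.Runs s t s' ∧ t ≤ U ∧ I k s') :
    ∀ k s, I k s → ∃ t s', (RamProg.loop r P).Runs s t s' ∧ t ≤ (k + 1) * (U + 1 + k.size) ∧
      I 0 s' := by
  intro k
  induction k with
  | zero =>
    intro s hs
    refine ⟨_, s, .loopDone (hr 0 s hs), ?_, hs⟩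
    rw [hr 0 s hs]
    omega
  | succ k ih =>
    intro s hs
    obtain ⟨t₁, s₁, r₁, c₁, h₁⟩ := hstep k s hs
    obtain ⟨t₂, s₂, r₂, c₂, h₂⟩ := ih s₁ h₁
    refine ⟨_, s₂, .loopStep (by rw [hr _ s hs]; omega) r₁ r₂, ?_, h₂⟩
    rw [hr _ s hs]
    have h3 : k.size ≤ (k + 1).size := Nat.size_le_size (Nat.le_succ k)
    have h4 : (k + 1) * (U + 1 + k.size) ≤ (k + 1) * (U + 1 + (k + 1).size) :=
      Nat.mul_le_mul_left _ (by omega)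
    have h5 : (k + 1 + 1) * (U + 1 + (k + 1).size) =
      (U + 1 + (k + 1).size) + (k + 1) * (U + 1 + (k + 1).size) := by ring
    omega

/-- Evaluates an expression and copies its value to register `r`. -/
def assignProg (r : ℕ) (Q : ℕ → RamProg) : RamProg :=
  .seq (Q 10) (Ctx.copyProg r 10)

theorem exists_runs_assignProg {Q : ℕ → RamProg} {s : RamState} {T x : ℕ} {r : ℕ} (hr : r < 10)
    (h : Evaluates (Q 10) s 10 T x) : ∃ t s', (assignProg r Q).Runs s t s' ∧
      t ≤ T + 2 + x.size ∧ s'.mem = s.mem ∧ s'.reg r = x ∧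
      ∀ j < 10, j ≠ r → s'.reg j = s.reg j := by
  obtain ⟨t, s', h1, h2, h3, h4, h5⟩ := h
  refine ⟨_, _, .seq h1 (Ctx.runs_copyProg r 10 (by omega) s'), ?_, h3, ?_, fun j hj hjr => ?_⟩
  · rw [h5]
    omega
  · rw [← h5]
    exact Function.update_self _ _ _
  · exact (Function.update_of_ne hjr _ _).trans (h4 j hj)

/-! ### The memory during the elimination of a vertex -/

theorem tableAddr_inj {n c c' : ℕ} {A A' : Finset ℕ} (hc : c < n) (hc' : c' < n)
    (h : tableAddr n c A = tableAddr n c' A') : c = c' ∧ A = A' := by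
  have h1 := congrArg (· % n) h
  have h2 := congrArg (· / n) h
  simp only [tableAddr] at h1 h2
  rw [add_comm, Nat.add_mul_mod_self_right, Nat.mod_eq_of_lt hc, add_comm,
    Nat.add_mul_mod_self_right, Nat.mod_eq_of_lt hc'] at h1
  rw [add_comm, Nat.add_mul_div_right _ _ (by omega), Nat.div_eq_of_lt hc, add_comm _ c',
    Nat.add_mul_div_right _ _ (by omega), Nat.div_eq_of_lt hc'] at h2
  exact ⟨h1, bits_injective (by omega)⟩

/-- The summand `n` in `tableAddr` places all tables behind the adjacency matrix, which therefore
survives until the output is written. -/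
theorem le_tableAddr (n c : ℕ) (A : Finset ℕ) : n * n ≤ tableAddr n c A :=
  (Nat.mul_le_mul_right n (Nat.le_add_left n _)).trans (Nat.le_add_right _ _)

theorem matrix_index_lt {n u w : ℕ} (hu : u < n) (hw : w < n) : u * n + w < n * n := by
  calc u * n + w < (u + 1) * n := by rw [add_mul]; omega
    _ ≤ n * n := Nat.mul_le_mul_right n hu

/-- How the memory changes from `m₀` to `m` during the elimination of `v`, when the entries with
numbers from `r` on have been computed. -/
structure Progress (n : ℕ) (G : SimpleGraph ℕ) (E Act : Finset ℕ) (v : ℕ) (m₀ m : ℕ → ℕ)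
    (r : ℕ) : Prop where
  other : ∀ x, (∀ A ⊆ nbhd n G E v, x ≠ tableAddr n v A) → m x = m₀ x
  entry : ∀ A ⊆ nbhd n G E v,
    tables n m v A = 0 ∨ tables n m v A = bestEntry n G E Act (tables n m₀) v A
  done : ∀ code, r ≤ code → code < 2 ^ (leaders G (nbhd n G E v)).card * (n + 1) →
    tables n m v (trace n G (nbhd n G E v) code) =
      bestEntry n G E Act (tables n m₀) v (trace n G (nbhd n G E v) code)

section Progress

variable {n : ℕ} {G : SimpleGraph ℕ} {E Act : Finset ℕ} {v : ℕ} {m₀ m : ℕ → ℕ} {r : ℕ}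

theorem Progress.tables_eq (h : Progress n G E Act v m₀ m r) (hv : v < n) {c : ℕ} (hc : c < n)
    (hcv : c ≠ v) (A : Finset ℕ) : tables n m c A = tables n m₀ c A :=
  h.other _ fun _ _ e => hcv (tableAddr_inj hc hv e).1

/-- An entry for `v` consults only tables of neighbours of `v`, never that of `v` itself, so the
writes of the running loop do not influence later entries. -/
theorem Progress.bestEntry_eq (h : Progress n G E Act v m₀ m r) (hv : v < n)
    (hAct : Act ⊆ range n) (A : Finset ℕ) :
    bestEntry n G E Act (tables n m) v A = bestEntry n G E Act (tables n m₀) v A := by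
  have key : ∀ X, MaxCutBubbles.entry n G E Act (tables n m) v X =
      MaxCutBubbles.entry n G E Act (tables n m₀) v X := by
    intro X
    unfold MaxCutBubbles.entry
    congr 1
    refine sum_congr rfl fun c hc => ?_
    rw [mem_children] at hc
    exact h.tables_eq hv (mem_range.1 (hAct hc.1)) (G.ne_of_adj hc.2).symm _
  rw [bestEntry, key, key, bestEntry]

theorem Progress.update (h : Progress n G E Act v m₀ m (r + 1)) (hv : v < n)
    (hAct : Act ⊆ range n) :
    Progress n G E Act v m₀ (Function.update m (tableAddr n v (trace n G (nbhd n G E v) r))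
      (bestEntry n G E Act (tables n m) v (trace n G (nbhd n G E v) r))) r := by
  rw [h.bestEntry_eq hv hAct]
  set A₀ := trace n G (nbhd n G E v) r with hA₀
  have hA₀' : A₀ ⊆ nbhd n G E v := trace_subset r
  have hself : tables n (Function.update m (tableAddr n v A₀)
      (bestEntry n G E Act (tables n m₀) v A₀)) v A₀ = bestEntry n G E Act (tables n m₀) v A₀ :=
    Function.update_self _ _ _
  have hne : ∀ A, A ≠ A₀ → tables n (Function.update m (tableAddr n v A₀)
      (bestEntry n G E Act (tables n m₀) v A₀)) v A = tables n m v A :=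
    fun A hA => Function.update_of_ne (fun e => hA (tableAddr_inj hv hv e).2) _ _
  refine ⟨fun x hx => ?_, fun A hA => ?_, fun code h1 h2 => ?_⟩
  · rw [Function.update_of_ne (hx A₀ hA₀')]
    exact h.other x hx
  · by_cases e : A = A₀
    · rw [e, hself]
      exact Or.inr rfl
    · rw [hne A e]
      exact h.entry A hA
  -- Several codes may describe the same set; the value written is then the same each time.
  · by_cases e : trace n G (nbhd n G E v) code = A₀
    · rw [e, hself]
    · rw [hne _ e]
      refine h.done code ?_ h2
      rcases h1.eq_or_lt with rfl | h1
      · exact absurd rfl e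
      · exact h1

end Progress

/-- The snapshots between the elimination of vertices. -/
structure Snapshot.Stage (γ : Snapshot) : Prop where
  fits : γ.Fits
  matrix : γ.HasMatrix
  act_subset : γ.Act ⊆ γ.E
  table : ∃ D, IsTable γ.n γ.G γ.E γ.Act (tables γ.n γ.mem) D
  fresh : ∀ u < γ.n, u ∉ γ.E → ∀ X, tables γ.n γ.mem u X = 0

namespace Snapshot.Stage

variable {γ : Snapshot} {m : ℕ → ℕ} {r : ℕ}

/-- The codes are processed downwards, so at the start none is done; by `fresh` the table of the new
vertex is still zero. -/
theorem progress_start (h : γ.Stage) (hv : γ.v < γ.n) (hvE : γ.v ∉ γ.E) :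
    Progress γ.n γ.G γ.E γ.Act γ.v γ.mem γ.mem
      (2 ^ (leaders γ.G (nbhd γ.n γ.G γ.E γ.v)).card * (γ.n + 1)) :=
  ⟨fun _ _ => rfl, fun A _ => Or.inl (h.fresh _ hv hvE A), fun _ h1 h2 => absurd h2 (not_lt.2 h1)⟩

theorem size_mem_le (h : γ.Stage) (hv : γ.v < γ.n) (hvE : γ.v ∉ γ.E)
    (hm : Progress γ.n γ.G γ.E γ.Act γ.v γ.mem m r) (x : ℕ) : (m x).size ≤ 3 * γ.n + 1 := by
  by_cases hx : ∀ A ⊆ nbhd γ.n γ.G γ.E γ.v, x ≠ tableAddr γ.n γ.v A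
  · rw [hm.other x hx]
    exact h.fits.size_mem_le x
  · push Not at hx
    obtain ⟨A, hA, rfl⟩ := hx
    rcases hm.entry A hA with e | e
    · rw [show m (tableAddr γ.n γ.v A) = 0 from e]
      simp
    · rw [show m (tableAddr γ.n γ.v A) = _ from e]
      obtain ⟨D, hD⟩ := h.table
      exact (Nat.size_le.2 (hD.bestEntry_lt h.matrix.lt h.fits.E_subset hv hvE hA)).trans
        (by omega)

theorem matrix_of_progress (h : γ.Stage) (hm : Progress γ.n γ.G γ.E γ.Act γ.v γ.mem m r) :
    ∀ u w, u < γ.n → w < γ.n → m (u * γ.n + w) = ind (γ.G.Adj u w) := by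
  intro u w hu hw
  rw [hm.other]
  · exact h.matrix.mem_eq u w hu hw
  · intro A _ e
    have h1 := le_tableAddr γ.n γ.v A
    have h2 := matrix_index_lt hu hw
    omega

open Classical in
theorem next (h : γ.Stage) (hv : γ.v < γ.n) (hvE : γ.v ∉ γ.E)
    (hsimp : IsSimplicial γ.n γ.G γ.E γ.v) (hm : Progress γ.n γ.G γ.E γ.Act γ.v γ.mem m 0)
    {code : ℕ} (hcode : code.size ≤ 3 * γ.n + 1) {A : Finset ℕ} (hA : A ⊆ range γ.n) :
    Snapshot.Stage ⟨γ.n, γ.G, insert γ.v γ.E, insert γ.v (γ.Act.filter fun c => ¬ γ.G.Adj γ.v c),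
      γ.v, code, A, m⟩ where
  fits :=
    { E_subset := insert_subset (mem_range.2 hv) h.fits.E_subset
      Act_subset := insert_subset (mem_range.2 hv)
        ((filter_subset _ _).trans h.fits.Act_subset)
      v_le := hv.le
      size_code_le := hcode
      A_subset := hA
      size_mem_le := h.size_mem_le hv hvE hm }
  matrix := ⟨h.matrix.lt, h.matrix_of_progress hm⟩
  act_subset := insert_subset_insert _ ((filter_subset _ _).trans h.act_subset)
  table := by
    obtain ⟨D, hD⟩ := h.table
    refine ⟨_, hD.step h.matrix.lt hv hvE hsimp (fun c hc A => ?_) hm.entry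
      (fun code hcode => hm.done code (Nat.zero_le _) hcode) h.act_subset⟩
    exact hm.tables_eq hv (mem_range.1 (h.fits.Act_subset hc))
      (fun e => hvE (h.act_subset (e ▸ hc))) A
  fresh u hu huE X := by
    have huv : u ≠ γ.v := fun e => huE (e ▸ mem_insert_self _ _)
    have h1 : tables γ.n m u X = tables γ.n γ.mem u X := hm.tables_eq hv hu huv X
    rw [h1]
    exact h.fresh u hu (fun k => huE (mem_insert_of_mem k)) X

end Snapshot.Stage

/-- Computes one entry of the table of the vertex in register `3`. -/
def entryProg (Ptrace Paddr Pval : ℕ → RamProg) : RamProg :=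
  .seq (.arith .sub 4 4 7) (.seq (assignProg 5 Ptrace)
    (.seq (Paddr 10) (.seq (Pval 11) (.store 10 11))))

/-- Eliminates one vertex. -/
def eliminateProg (Pv Pcount Ptrace Paddr Pval PAct PE : ℕ → RamProg) : RamProg :=
  .seq (assignProg 3 Pv) (.seq (assignProg 4 Pcount)
    (.seq (.loop 4 (entryProg Ptrace Paddr Pval)) (.seq (assignProg 2 PAct)
      (.seq (assignProg 1 PE) (.arith .sub 6 6 7)))))

/-- Writes the indicator of one vertex. -/
def writeProg (Pbit : ℕ → RamProg) : RamProg :=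
  .seq (.arith .sub 3 3 7) (.seq (Pbit 10) (.store 3 10))

/-- Eliminates all vertices, reads off a maximum cut, and writes it to the memory. -/
def maxCutProg (Pv Pcount Ptrace Paddr Pval PAct PE Pset Pbit : ℕ → RamProg) : RamProg :=
  .seq (Ctx.copyProg 6 0) (.seq (.const 7 1)
    (.seq (.loop 6 (eliminateProg Pv Pcount Ptrace Paddr Pval PAct PE))
      (.seq (assignProg 5 Pset) (.seq (Ctx.copyProg 3 0) (.loop 3 (writeProg Pbit))))))

/-- The program `Q` computes `F` in registers `10` and above at cost at most `(3 * n + 3) ^ c`. -/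
def Implements (Q : ℕ → RamProg) (c : ℕ) (good : Snapshot → Prop) (F : Snapshot → ℕ) : Prop :=
  ∀ γ s k, 6 ≤ k → γ.Fits → good γ → γ.Rep s →
    (F γ).size ≤ (3 * γ.n + 3) ^ c ∧ Evaluates (Q k) s k ((3 * γ.n + 3) ^ c) (F γ)

/-- The snapshots during the elimination of a vertex. -/
def Snapshot.Eliminating (γ : Snapshot) : Prop :=
  γ.HasMatrix ∧ γ.v < γ.n

/-! ### Correctness and cost of the program -/

section Correctness

variable {Pv Pcount Ptrace Paddr Pval PAct PE Pset Pbit : ℕ → RamProg} {c : ℕ}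

theorem three_mul_add_le_pow (n : ℕ) (hc : 1 ≤ c) : 3 * n + 3 ≤ (3 * n + 3) ^ c := by
  calc 3 * n + 3 = (3 * n + 3) ^ 1 := (pow_one _).symm
    _ ≤ _ := Nat.pow_le_pow_right (by omega) hc

/-- Register `4` counts the codes that are left and is decremented first, so the codes run down to
zero. Register `7` permanently holds one, register `6` counts vertices, and register `10` keeps the
address while the value is computed from `11` upwards. -/
theorem exists_runs_entryProg (hc : 1 ≤ c)
    (htrace : Implements Ptrace c Snapshot.Eliminating
      fun γ => bits (trace γ.n γ.G (nbhd γ.n γ.G γ.E γ.v) γ.code))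
    (haddr : Implements Paddr c Snapshot.Eliminating fun γ => tableAddr γ.n γ.v γ.A)
    (hval : Implements Pval c Snapshot.Eliminating
      fun γ => bestEntry γ.n γ.G γ.E γ.Act (tables γ.n γ.mem) γ.v γ.A)
    {γ : Snapshot} (hγ : γ.Fits) (hE : γ.Eliminating) {s : RamState} (hs : γ.Rep s)
    (hs7 : s.reg 7 = 1) {r : ℕ} (hr : γ.code = r + 1) :
    ∃ t s', (entryProg Ptrace Paddr Pval).Runs s t s' ∧ t ≤ 10 * (3 * γ.n + 3) ^ c ∧
      s'.reg 6 = s.reg 6 ∧ s'.reg 7 = 1 ∧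
      Snapshot.Rep ⟨γ.n, γ.G, γ.E, γ.Act, γ.v, r, trace γ.n γ.G (nbhd γ.n γ.G γ.E γ.v) r,
        Function.update γ.mem (tableAddr γ.n γ.v (trace γ.n γ.G (nbhd γ.n γ.G γ.E γ.v) r))
          (bestEntry γ.n γ.G γ.E γ.Act (tables γ.n γ.mem) γ.v
            (trace γ.n γ.G (nbhd γ.n γ.G γ.E γ.v) r))⟩ s' := by
  have hU := three_mul_add_le_pow γ.n hc
  set U := (3 * γ.n + 3) ^ c with hUdef
  set A := trace γ.n γ.G (nbhd γ.n γ.G γ.E γ.v) r with hA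
  have hAn : A ⊆ range γ.n := (trace_subset r).trans nbhd_subset_range
  have hrsize : r.size ≤ 3 * γ.n + 1 :=
    (Nat.size_le_size (by omega)).trans hγ.size_code_le
  -- the number of the entry
  have e4 : s.reg 4 - s.reg 7 = r := by rw [hs.code, hs7, hr]; rfl
  have R₁ := RamProg.Runs.arith .sub 4 4 7 s
  simp only [RamOp.apply, e4] at R₁
  set s₁ : RamState := ⟨Function.update s.reg 4 r, s.mem⟩ with hs₁
  let γ₁ : Snapshot := { γ with code := r }
  have h₁ : γ₁.Rep s₁ := ⟨hs.n, hs.E, hs.Act, hs.v, rfl, hs.A, hs.mem⟩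
  have f₁ : γ₁.Fits := ⟨hγ.1, hγ.2, hγ.3, hrsize, hγ.5, hγ.6⟩
  have g₁ : γ₁.Eliminating := ⟨⟨hE.1.1, hE.1.2⟩, hE.2⟩
  -- the set
  obtain ⟨z₂, ev₂⟩ := htrace γ₁ s₁ 10 (by norm_num) f₁ g₁ h₁
  obtain ⟨t₂, s₂, R₂, c₂, m₂, v₂, o₂⟩ := exists_runs_assignProg (r := 5) (by norm_num) ev₂
  let γ₂ : Snapshot := { γ with code := r, A := A }
  have h₂ : γ₂.Rep s₂ :=
    ⟨(o₂ 0 (by norm_num) (by norm_num)).trans h₁.n, (o₂ 1 (by norm_num) (by norm_num)).trans h₁.E,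
      (o₂ 2 (by norm_num) (by norm_num)).trans h₁.Act,
      (o₂ 3 (by norm_num) (by norm_num)).trans h₁.v,
      (o₂ 4 (by norm_num) (by norm_num)).trans h₁.code, v₂, m₂.trans h₁.mem⟩
  have f₂ : γ₂.Fits := ⟨hγ.1, hγ.2, hγ.3, hrsize, hAn, hγ.6⟩
  have g₂ : γ₂.Eliminating := ⟨⟨hE.1.1, hE.1.2⟩, hE.2⟩
  -- the address
  obtain ⟨z₃, t₃, s₃, R₃, c₃, m₃, o₃, v₃⟩ := haddr γ₂ s₂ 10 (by norm_num) f₂ g₂ h₂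
  have h₃ : γ₂.Rep s₃ := h₂.of_agree m₃ o₃
  -- the value
  obtain ⟨z₄, t₄, s₄, R₄, c₄, m₄, o₄, v₄⟩ := hval γ₂ s₃ 11 (by norm_num) f₂ g₂ h₃
  have h₄ : γ₂.Rep s₄ := h₃.of_agree m₄ fun j hj => o₄ j (by omega)
  have a₄ : s₄.reg 10 = tableAddr γ.n γ.v A := (o₄ 10 (by norm_num)).trans v₃
  have o : ∀ j < 10, j ≠ 5 → s₄.reg j = s₁.reg j := fun j hj hj' =>
    (o₄ j (by omega)).trans ((o₃ j hj).trans (o₂ j hj hj'))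
  have R₅ := RamProg.Runs.store 10 11 s₄
  refine ⟨_, _, .seq R₁ (.seq R₂ (.seq R₃ (.seq R₄ R₅))), ?_, ?_, ?_, ?_⟩
  · have b0 : (s.reg 4).size ≤ 3 * γ.n + 1 := by rw [hs.code]; exact hγ.size_code_le
    have b1 : (s.reg 7).size = 1 := by rw [hs7]; exact Nat.size_one
    rw [a₄, v₄]
    have z₂' : (bits A).size ≤ U := z₂
    have c₂' : t₂ ≤ U + 2 + (bits A).size := c₂
    have z₃' : (tableAddr γ.n γ.v A).size ≤ U := z₃
    have c₃' : t₃ ≤ U := c₃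
    have c₄' : t₄ ≤ U := c₄
    have z₄' : (bestEntry γ.n γ.G γ.E γ.Act (tables γ.n γ.mem) γ.v A).size ≤ U := z₄
    change _ + (_ + (_ + (_ + (1 + (tableAddr γ.n γ.v A).size +
      (bestEntry γ.n γ.G γ.E γ.Act (tables γ.n γ.mem) γ.v A).size)))) ≤ _
    omega
  · exact (o 6 (by norm_num) (by norm_num)).trans rfl
  · exact (o 7 (by norm_num) (by norm_num)).trans hs7
  · refine ⟨h₄.n, h₄.E, h₄.Act, h₄.v, h₄.code, h₄.A, ?_⟩
    change Function.update s₄.mem (s₄.reg 10) (s₄.reg 11) = _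
    rw [a₄, v₄, h₄.mem]

/-- The loop invariant is `Progress` with the counter `k`: all entries with numbers from `k` on are
in place. -/
theorem exists_runs_entryLoop (hc : 1 ≤ c)
    (htrace : Implements Ptrace c Snapshot.Eliminating
      fun γ => bits (trace γ.n γ.G (nbhd γ.n γ.G γ.E γ.v) γ.code))
    (haddr : Implements Paddr c Snapshot.Eliminating fun γ => tableAddr γ.n γ.v γ.A)
    (hval : Implements Pval c Snapshot.Eliminating
      fun γ => bestEntry γ.n γ.G γ.E γ.Act (tables γ.n γ.mem) γ.v γ.A)
    {γ : Snapshot} (hγ : γ.Stage) (hv : γ.v < γ.n) (hvE : γ.v ∉ γ.E)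
    (hcount : γ.code = 2 ^ (leaders γ.G (nbhd γ.n γ.G γ.E γ.v)).card * (γ.n + 1))
    {s : RamState} (hs : γ.Rep s) (hs7 : s.reg 7 = 1) :
    ∃ t s', (RamProg.loop 4 (entryProg Ptrace Paddr Pval)).Runs s t s' ∧
      t ≤ (γ.code + 1) * (12 * (3 * γ.n + 3) ^ c) ∧ s'.reg 6 = s.reg 6 ∧ s'.reg 7 = 1 ∧
      ∃ A m, A ⊆ range γ.n ∧ Progress γ.n γ.G γ.E γ.Act γ.v γ.mem m 0 ∧
        Snapshot.Rep ⟨γ.n, γ.G, γ.E, γ.Act, γ.v, 0, A, m⟩ s' := by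
  have hU := three_mul_add_le_pow γ.n hc
  obtain ⟨t, s', R, ct, -, h6, h7, A, m, hA, hm, hrep⟩ := exists_runs_loop (r := 4)
    (P := entryProg Ptrace Paddr Pval) (U := 10 * (3 * γ.n + 3) ^ c)
    (I := fun k s' => k ≤ γ.code ∧ s'.reg 6 = s.reg 6 ∧ s'.reg 7 = 1 ∧ ∃ A m, A ⊆ range γ.n ∧
      Progress γ.n γ.G γ.E γ.Act γ.v γ.mem m k ∧
      Snapshot.Rep ⟨γ.n, γ.G, γ.E, γ.Act, γ.v, k, A, m⟩ s')
    (fun k s' ⟨_, _, _, _, _, _, _, h⟩ => h.code)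
    (by
      rintro k s₁ ⟨hk, h6, h7, A, m, hA, hm, hrep⟩
      have hf : Snapshot.Fits ⟨γ.n, γ.G, γ.E, γ.Act, γ.v, k + 1, A, m⟩ :=
        ⟨hγ.fits.1, hγ.fits.2, hγ.fits.3, (Nat.size_le_size hk).trans hγ.fits.4, hA,
          hγ.size_mem_le hv hvE hm⟩
      obtain ⟨t, s₂, R, ct, h6', h7', hrep'⟩ := exists_runs_entryProg hc htrace haddr hval hf
        ⟨⟨hγ.matrix.lt, hγ.matrix_of_progress hm⟩, hv⟩ hrep h7 (r := k) rfl
      exact ⟨t, s₂, R, ct, by omega, h6'.trans h6, h7', _, _,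
        (trace_subset k).trans nbhd_subset_range, hm.update hv hγ.fits.Act_subset, hrep'⟩)
    γ.code s ⟨le_rfl, rfl, hs7, γ.A, γ.mem, hγ.fits.A_subset, by
      rw [hcount]
      exact hγ.progress_start hv hvE, hs⟩
  refine ⟨t, s', R, ct.trans (Nat.mul_le_mul_left _ ?_), h6, h7, A, m, hA, hm, hrep⟩
  have := hγ.fits.size_code_le
  omega

end Correctness

theorem Snapshot.Stage.congr {γ γ' : Snapshot} (h : γ.Stage) (hf : γ'.Fits) (hn : γ'.n = γ.n)
    (hG : γ'.G = γ.G) (hE : γ'.E = γ.E) (hAct : γ'.Act = γ.Act) (hm : γ'.mem = γ.mem) :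
    γ'.Stage := by
  obtain ⟨n, G, E, Act, v, code, A, m⟩ := γ
  obtain ⟨n', G', E', Act', v', code', A', m'⟩ := γ'
  dsimp only at hn hG hE hAct hm
  subst hn hG hE hAct hm
  exact ⟨hf, ⟨h.2.1, h.2.2⟩, h.3, h.4, h.5⟩

-- Between the updates of the two vertex sets the snapshot need not be a `Stage`; the pieces
-- therefore ask only for `Fits` and `Eliminating`, and `Stage` is restored at the end.
open Classical in
theorem exists_runs_eliminateProg {Pv Pcount Ptrace Paddr Pval PAct PE : ℕ → RamProg} {c q : ℕ}
    (hc : 1 ≤ c)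
    (hPv : Implements Pv c Snapshot.HasMatrix fun γ => ((range γ.n).filter fun i =>
      ∀ j < γ.n, j ≤ i → ¬ (j ∉ γ.E ∧ IsSimplicial γ.n γ.G γ.E j)).card)
    (hcount : Implements Pcount c Snapshot.Eliminating
      fun γ => 2 ^ (leaders γ.G (nbhd γ.n γ.G γ.E γ.v)).card * (γ.n + 1))
    (htrace : Implements Ptrace c Snapshot.Eliminating
      fun γ => bits (trace γ.n γ.G (nbhd γ.n γ.G γ.E γ.v) γ.code))
    (haddr : Implements Paddr c Snapshot.Eliminating fun γ => tableAddr γ.n γ.v γ.A)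
    (hval : Implements Pval c Snapshot.Eliminating
      fun γ => bestEntry γ.n γ.G γ.E γ.Act (tables γ.n γ.mem) γ.v γ.A)
    (hPAct : Implements PAct c Snapshot.Eliminating
      fun γ => bits (insert γ.v (γ.Act.filter fun c => ¬ γ.G.Adj γ.v c)))
    (hPE : Implements PE c Snapshot.Eliminating fun γ => bits (insert γ.v γ.E))
    {γ : Snapshot} (hγ : γ.Stage)
    (hex : ∃ v < γ.n, v ∉ γ.E ∧ IsSimplicial γ.n γ.G γ.E v)
    (hq : ∀ v, IsSimplicial γ.n γ.G γ.E v → (leaders γ.G (nbhd γ.n γ.G γ.E v)).card ≤ q)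
    {s : RamState} (hs : γ.Rep s) {k : ℕ} (hk : k + 1 ≤ γ.n) (hs6 : s.reg 6 = k + 1)
    (hs7 : s.reg 7 = 1) :
    ∃ t s', (eliminateProg Pv Pcount Ptrace Paddr Pval PAct PE).Runs s t s' ∧
      t ≤ 36 * ((3 * γ.n + 3) ^ c * (2 ^ q * (γ.n + 1))) ∧ s'.reg 6 = k ∧ s'.reg 7 = 1 ∧
      ∃ γ' : Snapshot, γ'.Stage ∧ γ'.Rep s' ∧ γ'.n = γ.n ∧ γ'.G = γ.G ∧
        γ'.E.card = γ.E.card + 1 := by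
  have hU := three_mul_add_le_pow γ.n hc
  obtain ⟨v, hv, ⟨hvE, hsimp⟩, hcard⟩ := card_filter_eq_least hex
  obtain ⟨n, G, E, Act, v₀, code₀, A₀, m₀⟩ := γ
  dsimp only at *
  set U := (3 * n + 3) ^ c with hUdef
  -- the vertex
  obtain ⟨z₁, ev₁⟩ : v.size ≤ U ∧ Evaluates (Pv 10) s 10 U v := by
    have h := hPv _ s 10 (by norm_num) hγ.fits hγ.matrix hs
    dsimp only at h
    convert h using 3 <;> (rw [← hcard]; congr!)
  obtain ⟨t₁, s₁, R₁, c₁, m₁, v₁, o₁⟩ := exists_runs_assignProg (r := 3) (by norm_num) ev₁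
  have f₁ : Snapshot.Fits ⟨n, G, E, Act, v, code₀, A₀, m₀⟩ :=
    ⟨hγ.fits.1, hγ.fits.2, hv.le, hγ.fits.4, hγ.fits.5, hγ.fits.6⟩
  have h₁ : Snapshot.Rep ⟨n, G, E, Act, v, code₀, A₀, m₀⟩ s₁ :=
    ⟨(o₁ 0 (by norm_num) (by norm_num)).trans hs.n, (o₁ 1 (by norm_num) (by norm_num)).trans hs.E,
      (o₁ 2 (by norm_num) (by norm_num)).trans hs.Act, v₁,
      (o₁ 4 (by norm_num) (by norm_num)).trans hs.code,
      (o₁ 5 (by norm_num) (by norm_num)).trans hs.A, m₁.trans hs.mem⟩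
  -- the number of entries
  obtain ⟨z₂, ev₂⟩ := hcount _ s₁ 10 (by norm_num) f₁ ⟨⟨hγ.matrix.1, hγ.matrix.2⟩, hv⟩ h₁
  dsimp only at z₂ ev₂
  set N := 2 ^ (leaders G (nbhd n G E v)).card * (n + 1) with hN
  obtain ⟨t₂, s₂, R₂, c₂, m₂, v₂, o₂⟩ := exists_runs_assignProg (r := 4) (by norm_num) ev₂
  -- There are at most `n` leaders and `n + 1 < 2 ^ (n + 1)`, so the counter of codes has at most `2
  -- * n + 1` bits.
  have hNsize : N.size ≤ 3 * n + 1 := by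
    refine Nat.size_le.2 ?_
    have l1 : (leaders G (nbhd n G E v)).card ≤ n :=
      (card_le_card ((filter_subset _ _).trans nbhd_subset_range)).trans (card_range n).le
    have l2 : n + 1 < 2 ^ (n + 1) := Nat.lt_two_pow_self
    calc N < 2 ^ (leaders G (nbhd n G E v)).card * 2 ^ (n + 1) :=
          Nat.mul_lt_mul_of_pos_left l2 (by positivity)
      _ = 2 ^ ((leaders G (nbhd n G E v)).card + (n + 1)) := (pow_add _ _ _).symm
      _ ≤ _ := Nat.pow_le_pow_right (by norm_num) (by omega)
  have f₂ : Snapshot.Fits ⟨n, G, E, Act, v, N, A₀, m₀⟩ :=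
    ⟨f₁.1, f₁.2, f₁.3, hNsize, f₁.5, f₁.6⟩
  have h₂ : Snapshot.Rep ⟨n, G, E, Act, v, N, A₀, m₀⟩ s₂ :=
    ⟨(o₂ 0 (by norm_num) (by norm_num)).trans h₁.n, (o₂ 1 (by norm_num) (by norm_num)).trans h₁.E,
      (o₂ 2 (by norm_num) (by norm_num)).trans h₁.Act,
      (o₂ 3 (by norm_num) (by norm_num)).trans h₁.v, v₂,
      (o₂ 5 (by norm_num) (by norm_num)).trans h₁.A, m₂.trans h₁.mem⟩
  have S₂ : Snapshot.Stage ⟨n, G, E, Act, v, N, A₀, m₀⟩ := hγ.congr f₂ rfl rfl rfl rfl rfl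
  have w₂ : s₂.reg 7 = 1 :=
    (o₂ 7 (by norm_num) (by norm_num)).trans ((o₁ 7 (by norm_num) (by norm_num)).trans hs7)
  -- the entries
  obtain ⟨t₃, s₃, R₃, c₃, x₃, w₃, A, m, hA, hm, h₃⟩ :=
    exists_runs_entryLoop hc htrace haddr hval S₂ hv hvE rfl h₂ w₂
  dsimp only at c₃ hA hm h₃
  have f₃ : Snapshot.Fits ⟨n, G, E, Act, v, 0, A, m⟩ :=
    ⟨f₁.1, f₁.2, f₁.3, by simp, hA, S₂.size_mem_le hv hvE hm⟩
  have M₃ := S₂.matrix_of_progress hm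
  -- the active vertices
  obtain ⟨z₄, ev₄⟩ := hPAct _ s₃ 10 (by norm_num) f₃ ⟨⟨hγ.matrix.1, M₃⟩, hv⟩ h₃
  obtain ⟨t₄, s₄, R₄, c₄, m₄, v₄, o₄⟩ := exists_runs_assignProg (r := 2) (by norm_num) ev₄
  dsimp only at z₄ c₄ v₄
  set Act' := insert v (Act.filter fun c => ¬ G.Adj v c) with hAct'
  have f₄ : Snapshot.Fits ⟨n, G, E, Act', v, 0, A, m⟩ :=
    ⟨f₃.1, insert_subset (mem_range.2 hv) ((filter_subset _ _).trans f₃.2), f₃.3, f₃.4, f₃.5,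
      f₃.6⟩
  have h₄ : Snapshot.Rep ⟨n, G, E, Act', v, 0, A, m⟩ s₄ :=
    ⟨(o₄ 0 (by norm_num) (by norm_num)).trans h₃.n, (o₄ 1 (by norm_num) (by norm_num)).trans h₃.E,
      v₄, (o₄ 3 (by norm_num) (by norm_num)).trans h₃.v,
      (o₄ 4 (by norm_num) (by norm_num)).trans h₃.code,
      (o₄ 5 (by norm_num) (by norm_num)).trans h₃.A, m₄.trans h₃.mem⟩
  -- the eliminated vertices
  obtain ⟨z₅, ev₅⟩ := hPE _ s₄ 10 (by norm_num) f₄ ⟨⟨hγ.matrix.1, M₃⟩, hv⟩ h₄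
  obtain ⟨t₅, s₅, R₅, c₅, m₅, v₅, o₅⟩ := exists_runs_assignProg (r := 1) (by norm_num) ev₅
  dsimp only at z₅ c₅ v₅
  have h₅ : Snapshot.Rep ⟨n, G, insert v E, Act', v, 0, A, m⟩ s₅ :=
    ⟨(o₅ 0 (by norm_num) (by norm_num)).trans h₄.n, v₅,
      (o₅ 2 (by norm_num) (by norm_num)).trans h₄.Act,
      (o₅ 3 (by norm_num) (by norm_num)).trans h₄.v,
      (o₅ 4 (by norm_num) (by norm_num)).trans h₄.code,
      (o₅ 5 (by norm_num) (by norm_num)).trans h₄.A, m₅.trans h₄.mem⟩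
  have S₅ : Snapshot.Stage ⟨n, G, insert v E, Act', v, 0, A, m⟩ :=
    S₂.next hv hvE hsimp hm (code := 0) (by simp) hA
  have x₅ : s₅.reg 6 = k + 1 :=
    (o₅ 6 (by norm_num) (by norm_num)).trans <| (o₄ 6 (by norm_num) (by norm_num)).trans <|
      x₃.trans <| (o₂ 6 (by norm_num) (by norm_num)).trans <|
        (o₁ 6 (by norm_num) (by norm_num)).trans hs6
  have w₅ : s₅.reg 7 = 1 :=
    (o₅ 7 (by norm_num) (by norm_num)).trans <| (o₄ 7 (by norm_num) (by norm_num)).trans w₃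
  have R₆ := RamProg.Runs.arith .sub 6 6 7 s₅
  simp only [RamOp.apply, x₅, w₅, Nat.add_sub_cancel] at R₆
  refine ⟨_, _, .seq R₁ (.seq R₂ (.seq R₃ (.seq R₄ (.seq R₅ R₆)))), ?_, ?_, ?_,
    ⟨n, G, insert v E, Act', v, 0, A, m⟩, S₅, ?_, rfl, rfl, ?_⟩
  · have b1 : (k + 1).size ≤ n := (size_le_self _).trans hk
    have b2 : (1 : ℕ).size = 1 := Nat.size_one
    have b3 : 1 ≤ 2 ^ q * (n + 1) := Nat.succ_le_of_lt (by positivity)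
    have b4 : N ≤ 2 ^ q * (n + 1) := Nat.mul_le_mul_right _
      (Nat.pow_le_pow_right (by norm_num) (hq v hsimp))
    -- The loop over the codes takes `24` of the factor `36`; the remaining `12` pays for the
    -- straight-line pieces.
    have b5 : (N + 1) * (12 * U) ≤ 24 * (U * (2 ^ q * (n + 1))) :=
      calc (N + 1) * (12 * U) ≤ (2 * (2 ^ q * (n + 1))) * (12 * U) :=
            Nat.mul_le_mul_right _ (by omega)
        _ = _ := by ring
    have b6 : U ≤ U * (2 ^ q * (n + 1)) := Nat.le_mul_of_pos_right U b3
    have b7 : t₃ ≤ 24 * (U * (2 ^ q * (n + 1))) := c₃.trans b5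
    rw [b2]
    omega
  · exact Function.update_self (6 : ℕ) k s₅.reg
  · exact (Function.update_of_ne (show 7 ≠ 6 by norm_num) k s₅.reg).trans w₅
  · exact ⟨h₅.n, h₅.E, h₅.Act, h₅.v, h₅.code, h₅.A, h₅.mem⟩
  · exact card_insert_of_notMem hvE

/-- The output overwrites the start of the matrix, which is no longer needed: the set to be written
is held in register `5`. -/
theorem exists_runs_writeLoop {Pbit : ℕ → RamProg} {c : ℕ} (hc : 1 ≤ c)
    (hbit : Implements Pbit c (fun _ => True) fun γ => ind (γ.v ∈ γ.A))
    {γ : Snapshot} (hγ : γ.Fits) (hv : γ.v = γ.n) {s : RamState} (hs : γ.Rep s)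
    (hs7 : s.reg 7 = 1) :
    ∃ t s', (RamProg.loop 3 (writeProg Pbit)).Runs s t s' ∧
      t ≤ (γ.n + 1) * (6 * (3 * γ.n + 3) ^ c) ∧ ∀ u < γ.n, s'.mem u = ind (u ∈ γ.A) := by
  have hU := three_mul_add_le_pow γ.n hc
  obtain ⟨n, G, E, Act, v, code, A, m⟩ := γ
  dsimp only at *
  subst hv
  obtain ⟨t, s', R, ct, -, -, m', hw, -, hrep⟩ := exists_runs_loop (r := 3) (P := writeProg Pbit)
    (U := 5 * (3 * v + 3) ^ c)
    (I := fun k s => k ≤ v ∧ s.reg 7 = 1 ∧ ∃ m', (∀ u < v, k ≤ u → m' u = ind (u ∈ A)) ∧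
      (∀ x, (m' x).size ≤ 3 * v + 1) ∧ Snapshot.Rep ⟨v, G, E, Act, k, code, A, m'⟩ s)
    (fun k s ⟨_, _, _, _, _, h⟩ => h.v)
    (by
      rintro k s ⟨hk, h7, m', hw, hz, h⟩
      have e3 : s.reg 3 = k + 1 := h.v
      have R₁ := RamProg.Runs.arith .sub 3 3 7 s
      simp only [RamOp.apply, e3, h7, Nat.add_sub_cancel] at R₁
      have h₁ : Snapshot.Rep ⟨v, G, E, Act, k, code, A, m'⟩
          ⟨Function.update s.reg 3 k, s.mem⟩ :=
        ⟨h.n, h.E, h.Act, rfl, h.code, h.A, h.mem⟩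
      obtain ⟨z₂, t₂, s₂, R₂, c₂, m₂, o₂, v₂⟩ := hbit ⟨v, G, E, Act, k, code, A, m'⟩ _ 10
        (by norm_num) ⟨hγ.1, hγ.2, by dsimp only; omega, hγ.4, hγ.5, hz⟩ trivial h₁
      dsimp only at z₂ v₂ c₂
      have h₂ := h₁.of_agree m₂ o₂
      have e3' : s₂.reg 3 = k := h₂.v
      have R₃ := RamProg.Runs.store 3 10 s₂
      rw [e3', v₂] at R₃
      have hi : (ind (k ∈ A)).size ≤ 1 := (size_le_self _).trans (ind_le_one _)
      refine ⟨_, _, .seq R₁ (.seq R₂ R₃), ?_, by omega,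
        (o₂ 7 (by norm_num)).trans
          ((Function.update_of_ne (show 7 ≠ 3 by norm_num) k s.reg).trans h7),
        Function.update m' k (ind (k ∈ A)), fun u hu hku => ?_, fun x => ?_, ?_⟩
      · have b1 : (k + 1).size ≤ v := (size_le_self _).trans hk
        have b2 : (1 : ℕ).size = 1 := Nat.size_one
        have b3 : k.size ≤ v := (size_le_self _).trans (by omega)
        rw [b2]
        omega
      · rcases hku.eq_or_lt with rfl | hku
        · exact Function.update_self _ _ _
        · rw [Function.update_of_ne hku.ne']
          exact hw u hu hku
      · by_cases hx : x = k
        · rw [hx, Function.update_self]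
          omega
        · rw [Function.update_of_ne hx]
          exact hz x
      · refine ⟨h₂.n, h₂.E, h₂.Act, h₂.v, h₂.code, h₂.A, ?_⟩
        change Function.update s₂.mem k _ = _
        rw [h₂.mem])
    v s ⟨le_rfl, hs7, m, fun u h1 h2 => absurd h1 (not_lt.2 h2), hγ.6, hs⟩
  refine ⟨t, s', R, ct.trans (Nat.mul_le_mul_left _ ?_), fun u hu => ?_⟩
  · have := size_le_self v
    omega
  · rw [hrep.mem]
    exact hw u hu (Nat.zero_le _)

/-- A program that computes maximum cuts by the elimination of simplicial vertices. -/
theorem exists_program : ∃ (P : RamProg) (C c : ℕ), ∀ (n : ℕ) (G : SimpleGraph ℕ) (q : ℕ)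
    (m : ℕ → ℕ), (∀ u w, G.Adj u w → u < n) →
    (∀ u w, u < n → w < n → m (u * n + w) = ind (G.Adj u w)) →
    (∀ x, n * n ≤ x → m x = 0) → (∀ x, m x ≤ 1) →
    (∀ E ⊆ range n, E ≠ range n → ∃ v < n, v ∉ E ∧ IsSimplicial n G E v) →
    (∀ E v, IsSimplicial n G E v → (leaders G (nbhd n G E v)).card ≤ q) →
    ∃ t s, P.Runs ⟨fun r => if r = 0 then n else 0, m⟩ t s ∧ t ≤ C * 2 ^ q * (n + 1) ^ c ∧
      ∃ X ⊆ range n, (∀ v < n, s.mem v = ind (v ∈ X)) ∧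
        ∀ S ⊆ range n, cutCard n G S ≤ cutCard n G X := by
  classical
  have hr : (Snapshot.ctx Snapshot.HasMatrix).Reads Snapshot.G := Snapshot.reads fun _ h => h
  have hr' : (Snapshot.ctx Snapshot.Eliminating).Reads Snapshot.G := Snapshot.reads fun _ h => h.1
  have hv' : ∀ γ, (Snapshot.ctx Snapshot.Eliminating).ok γ → γ.v < γ.n := fun _ h => h.2.2
  have hnb := Ctx.ComputableSet.nbhd hr' Snapshot.computableSet_E Snapshot.computable_v
  obtain ⟨Pv, c₁, h₁⟩ := Snapshot.exists_prog
    (Ctx.Computable.leastSimplicial hr Snapshot.computableSet_E)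
  obtain ⟨Pcount, c₂, h₂⟩ := Snapshot.exists_prog
    (((hnb.leaders hr').card.two_pow fun γ hγ =>
      (card_le_card ((filter_subset _ _).trans nbhd_subset_range)).trans (card_range _).le).mul
        (Ctx.Computable.n.add (Ctx.Computable.const 1)))
  obtain ⟨Ptrace, c₃, h₃⟩ := Snapshot.exists_prog (hnb.trace hr' Snapshot.computable_code).bits
  obtain ⟨Paddr, c₄, h₄⟩ := Snapshot.exists_prog (good := Snapshot.Eliminating)
    (Snapshot.computable_v.tableAddr Snapshot.computableSet_A)
  obtain ⟨Pval, c₅, h₅⟩ := Snapshot.exists_prog (Ctx.Computable.bestEntry hr'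
    Snapshot.computableSet_E Snapshot.computableSet_Act Snapshot.computableSet_A
    Snapshot.computable_v hv')
  obtain ⟨PAct, c₆, h₆⟩ := Snapshot.exists_prog
    ((Snapshot.computableSet_Act.filter (q := fun γ c => ¬ γ.G.Adj γ.v c)
      (Ctx.Decides.adj hr'.ext Snapshot.computable_v.fst Ctx.Computable.snd).not).insert
        Snapshot.computable_v hv').bits
  obtain ⟨PE, c₇, h₇⟩ := Snapshot.exists_prog
    (Snapshot.computableSet_E.insert Snapshot.computable_v hv').bits
  obtain ⟨Pset, c₈, h₈⟩ := Snapshot.exists_prog (good := fun _ => True)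
    (F := fun γ => (∑ c ∈ γ.Act, tables γ.n γ.mem c ∅) % 2 ^ γ.n)
    ((Ctx.Computable.sum_mem (F := fun γ c => tables γ.n γ.mem c ∅) Snapshot.computableSet_Act
      (Ctx.Computable.tables (C := (Snapshot.ctx fun _ => True).ext) Ctx.Computable.snd
        ⟨fun _ _ => empty_subset _, Ctx.Computable.const (bits ∅)⟩)).mod
      (Ctx.Computable.n.two_pow fun _ _ => le_rfl))
  obtain ⟨Pbit, c₉, h₉⟩ := Snapshot.exists_prog (good := fun _ => True)
    (Ctx.Decides.mem Snapshot.computableSet_A Snapshot.computable_v)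
  set c := c₁ + c₂ + c₃ + c₄ + c₅ + c₆ + c₇ + c₈ + c₉ + 1 with hc
  refine ⟨maxCutProg Pv Pcount Ptrace Paddr Pval PAct PE Pset Pbit, 60 * 3 ^ c, c + 2,
    fun n G q m hG hm hm0 hm1 hex hq => ?_⟩
  have hc1 : 1 ≤ c := by omega
  have hU := three_mul_add_le_pow n hc1
  set U := (3 * n + 3) ^ c with hUdef
  set M := 2 ^ q * (n + 1) with hM
  set s₀ : RamState := ⟨fun r => if r = 0 then n else 0, m⟩ with hs₀
  have R₁ := Ctx.runs_copyProg 6 0 (by norm_num) s₀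
  have R₂ := RamProg.Runs.const 7 1 (⟨Function.update s₀.reg 6 (s₀.reg 0), s₀.mem⟩ : RamState)
  set s₂ : RamState := ⟨Function.update (Function.update s₀.reg 6 (s₀.reg 0)) 7 1, s₀.mem⟩
    with hs₂
  have S₂ : Snapshot.Stage ⟨n, G, ∅, ∅, 0, 0, ∅, m⟩ :=
    { fits := ⟨empty_subset _, empty_subset _, Nat.zero_le _, by simp, empty_subset _, fun x =>
        (size_le_self _).trans ((hm1 x).trans (by simp))⟩
      matrix := ⟨hG, hm⟩
      act_subset := subset_rfl
      table := ⟨fun _ => ∅, IsTable.initial _ _⟩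
      fresh := fun u _ _ X => hm0 _ (le_tableAddr n u X) }
  have h₂' : Snapshot.Rep ⟨n, G, ∅, ∅, 0, 0, ∅, m⟩ s₂ := ⟨rfl, rfl, rfl, rfl, rfl, rfl, rfl⟩
  -- Register `6` holds the number of vertices not yet eliminated, hence the invariant `γ.E.card + k
  -- = n`; at zero all vertices are eliminated.
  obtain ⟨t₃, s₃, R₃, k₃, -, w₃, γ, Sγ, hγ, hn, hGγ, hEγ⟩ := exists_runs_loop (r := 6)
    (P := eliminateProg Pv Pcount Ptrace Paddr Pval PAct PE) (U := 36 * (U * M))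
    (I := fun k s => s.reg 6 = k ∧ s.reg 7 = 1 ∧ ∃ γ : Snapshot, γ.Stage ∧ γ.Rep s ∧ γ.n = n ∧
      γ.G = G ∧ γ.E.card + k = n) (fun k s h => h.1)
    (by
      rintro k s ⟨h6, h7, γ, Sγ, hγ, rfl, rfl, hE⟩
      have hne : γ.E ≠ range γ.n := fun e => by
        rw [e, card_range] at hE
        omega
      obtain ⟨t, s', R, k', h6', h7', γ', S', hγ', e1, e2, e3⟩ := exists_runs_eliminateProg hc1
        (h₁ c (by omega)) (h₂ c (by omega)) (h₃ c (by omega)) (h₄ c (by omega))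
        (h₅ c (by omega)) (h₆ c (by omega)) (h₇ c (by omega)) Sγ
        (hex _ Sγ.fits.E_subset hne) (hq _) hγ (k := k) (by omega) h6 h7
      exact ⟨t, s', R, k', h6', h7', γ', S', hγ', e1, e2, by omega⟩)
    n s₂ ⟨rfl, rfl, _, S₂, h₂', rfl, rfl, by simp⟩
  subst hn hGγ
  have hE : γ.E = range γ.n := eq_of_subset_of_card_le Sγ.fits.E_subset
    (by rw [card_range]; omega)
  obtain ⟨D, hD⟩ := Sγ.table
  rw [hE] at hD
  obtain ⟨X, hX, hXbits, hXmax⟩ := hD.final hG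
  obtain ⟨z₄, ev₄⟩ := h₈ c (by omega) γ s₃ 10 (by norm_num) Sγ.fits trivial hγ
  rw [hXbits] at z₄ ev₄
  obtain ⟨t₄, s₄, R₄, k₄, m₄, v₄, o₄⟩ := exists_runs_assignProg (r := 5) (by norm_num) ev₄
  have R₅ := Ctx.runs_copyProg 3 0 (by norm_num) s₄
  set s₅ : RamState := ⟨Function.update s₄.reg 3 (s₄.reg 0), s₄.mem⟩ with hs₅
  have e0 : s₄.reg 0 = γ.n := (o₄ 0 (by norm_num) (by norm_num)).trans hγ.n
  have h₅' : Snapshot.Rep ⟨γ.n, γ.G, γ.E, γ.Act, γ.n, γ.code, X, γ.mem⟩ s₅ :=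
    ⟨e0, (o₄ 1 (by norm_num) (by norm_num)).trans hγ.E,
      (o₄ 2 (by norm_num) (by norm_num)).trans hγ.Act, e0,
      (o₄ 4 (by norm_num) (by norm_num)).trans hγ.code, v₄, m₄.trans hγ.mem⟩
  obtain ⟨t₆, s₆, R₆, k₆, hout⟩ := exists_runs_writeLoop hc1 (h₉ c (by omega))
    (γ := ⟨γ.n, γ.G, γ.E, γ.Act, γ.n, γ.code, X, γ.mem⟩)
    ⟨Sγ.fits.1, Sγ.fits.2, le_rfl, Sγ.fits.4, hX, Sγ.fits.6⟩ rfl h₅'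
    ((o₄ 7 (by norm_num) (by norm_num)).trans w₃)
  refine ⟨_, s₆, .seq R₁ (.seq R₂ (.seq R₃ (.seq R₄ (.seq R₅ R₆)))), ?_, X, hX, hout, hXmax⟩
  have b0 : s₀.reg 0 = γ.n := rfl
  have b1 := size_le_self γ.n
  have b2 : (1 : ℕ).size = 1 := Nat.size_one
  have b3 : 1 ≤ M := Nat.succ_le_of_lt (by positivity)
  have b4 : U ≤ U * M := Nat.le_mul_of_pos_right U b3
  have b5 : t₃ ≤ (γ.n + 1) * (37 * (U * M)) := k₃.trans (Nat.mul_le_mul_left _ (by omega))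
  have b6 : (γ.n + 1) * (6 * U) ≤ (γ.n + 1) * (6 * (U * M)) := Nat.mul_le_mul_left _ (by omega)
  have b7 : U * M ≤ (γ.n + 1) * (U * M) := Nat.le_mul_of_pos_left _ (Nat.succ_pos _)
  -- Besides `(3 * n + 3) ^ c`, one factor `n + 1` comes from the thresholds in the codes and one
  -- from the loop over the vertices.
  have b8 : 60 * 3 ^ c * 2 ^ q * (γ.n + 1) ^ (c + 2) = 60 * ((γ.n + 1) * (U * M)) := by
    rw [hUdef, hM, show 3 * γ.n + 3 = 3 * (γ.n + 1) by ring, mul_pow]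
    ring
  have b9 : (γ.n + 1) * (37 * (U * M)) = 37 * ((γ.n + 1) * (U * M)) := by ring
  have b10 : (γ.n + 1) * (6 * (U * M)) = 6 * ((γ.n + 1) * (U * M)) := by ring
  have k₆' : t₆ ≤ (γ.n + 1) * (6 * U) := k₆
  rw [b8, b0, e0, b2]
  omega

/-! ### Graphs given by their adjacency matrices -/

section Fin

variable {n : ℕ} {G : SimpleGraph (Fin n)}

/-- The graph on the natural numbers with the edges of `G`. -/
def natGraph (G : SimpleGraph (Fin n)) : SimpleGraph ℕ :=
  G.map Fin.valEmbedding

theorem natGraph_adj {u w : ℕ} :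
    (natGraph G).Adj u w ↔ ∃ a b : Fin n, G.Adj a b ∧ (a : ℕ) = u ∧ (b : ℕ) = w :=
  SimpleGraph.map_adj _ _ _ _

theorem natGraph_adj_val {a b : Fin n} : (natGraph G).Adj a b ↔ G.Adj a b := by
  rw [natGraph_adj]
  constructor
  · rintro ⟨a', b', h, e1, e2⟩
    rwa [← Fin.ext e1, ← Fin.ext e2]
  · exact fun h => ⟨a, b, h, rfl, rfl⟩

theorem lt_of_natGraph_adj (u w : ℕ) (h : (natGraph G).Adj u w) : u < n := by
  obtain ⟨a, _, _, rfl, _⟩ := natGraph_adj.1 h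
  exact a.2

theorem closedAdj_natGraph_val {a b : Fin n} :
    ClosedAdj (natGraph G) a b ↔ ClosedAdj G a b := by
  unfold ClosedAdj
  rw [natGraph_adj_val, Fin.val_inj]

theorem SameNbhd.natGraph {a b : Fin n} (h : SameNbhd G a b) :
    SameNbhd (MaxCutBubbles.natGraph G) a b := by
  refine (Ctx.sameNbhd_iff lt_of_natGraph_adj a.2).2 ⟨b.2, fun x hx => ?_⟩
  have := h ⟨x, hx⟩
  rwa [← closedAdj_natGraph_val, ← closedAdj_natGraph_val] at this

/-- Every unordered cut edge has exactly one orientation that leaves `S`. -/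
theorem cutSize_eq_cutCard {S : Set (Fin n)} {X : Finset ℕ} (h : ∀ v : Fin n, v ∈ S ↔ (v : ℕ) ∈ X) :
    cutSize G S = cutCard n (natGraph G) X := by
  classical
  have h1 : {e ∈ G.edgeSet | ∃ u ∈ S, ∃ v ∉ S, e = s(u, v)} =
      (fun p : Fin n × Fin n => s(p.1, p.2)) '' {p | G.Adj p.1 p.2 ∧ p.1 ∈ S ∧ p.2 ∉ S} := by
    ext e
    constructor
    · rintro ⟨he, u, hu, v, hv, rfl⟩
      exact ⟨(u, v), ⟨he, hu, hv⟩, rfl⟩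
    · rintro ⟨⟨u, v⟩, ⟨he, hu, hv⟩, rfl⟩
      exact ⟨he, u, hu, v, hv, rfl⟩
  have h2 : (((range n ×ˢ range n).filter fun e =>
      (natGraph G).Adj e.1 e.2 ∧ e.1 ∈ X ∧ e.2 ∉ X : Finset (ℕ × ℕ)) : Set (ℕ × ℕ)) =
      (fun p : Fin n × Fin n => ((p.1 : ℕ), (p.2 : ℕ))) ''
        {p | G.Adj p.1 p.2 ∧ p.1 ∈ S ∧ p.2 ∉ S} := by
    ext ⟨x, y⟩
    simp only [coe_filter, mem_product, mem_range, Set.mem_ofPred_eq, Set.mem_image, Prod.mk.injEq,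
      Prod.exists]
    constructor
    · rintro ⟨⟨hx, hy⟩, hadj, hxX, hyX⟩
      refine ⟨⟨x, hx⟩, ⟨y, hy⟩, ⟨?_, (h _).2 hxX, fun k => hyX ((h _).1 k)⟩, rfl, rfl⟩
      exact natGraph_adj_val.1 hadj
    · rintro ⟨a, b, ⟨hadj, ha, hb⟩, rfl, rfl⟩
      exact ⟨⟨a.2, b.2⟩, natGraph_adj_val.2 hadj, (h _).1 ha, fun k => hb ((h _).2 k)⟩
  rw [cutSize, h1, Set.InjOn.ncard_image, cutCard, ← Set.ncard_coe_finset, h2,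
    Set.ncard_image_of_injective]
  · rintro ⟨a, b⟩ ⟨a', b'⟩ e
    rw [Prod.mk.injEq, Fin.val_inj, Fin.val_inj] at e
    exact Prod.ext e.1 e.2
  · rintro ⟨a, b⟩ ⟨_, ha, hb⟩ ⟨a', b'⟩ ⟨_, ha', hb'⟩ e
    rcases Sym2.eq_iff.1 e with ⟨rfl, rfl⟩ | ⟨rfl, rfl⟩
    · rfl
    · exact absurd ha hb'

theorem mem_graphInput {u w : ℕ} (hu : u < n) (hw : w < n) :
    (graphInput G).mem (u * n + w) = ind ((natGraph G).Adj u w) := by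
  classical
  unfold graphInput ind
  refine if_congr (Iff.intro ?_ ?_) rfl rfl
  · rintro ⟨a, b, h, e⟩
    have e1 := congrArg (· % n) e
    have e2 := congrArg (· / n) e
    rw [add_comm, Nat.add_mul_mod_self_right, Nat.mod_eq_of_lt hw, add_comm,
      Nat.add_mul_mod_self_right, Nat.mod_eq_of_lt b.2] at e1
    rw [add_comm, Nat.add_mul_div_right _ _ (by omega), Nat.div_eq_of_lt hw, add_comm _ (b : ℕ),
      Nat.add_mul_div_right _ _ (by omega), Nat.div_eq_of_lt b.2] at e2
    exact natGraph_adj.2 ⟨a, b, h, by omega, e1.symm⟩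
  · intro h
    obtain ⟨a, b, hab, rfl, rfl⟩ := natGraph_adj.1 h
    exact ⟨a, b, hab, rfl⟩

theorem mem_graphInput_eq_zero {x : ℕ} (hx : n * n ≤ x) : (graphInput G).mem x = 0 := by
  refine if_neg ?_
  rintro ⟨a, b, -, rfl⟩
  exact absurd hx (not_le.2 (matrix_index_lt a.2 b.2))

theorem mem_graphInput_le_one (x : ℕ) : (graphInput G).mem x ≤ 1 := by
  unfold graphInput
  dsimp only
  split_ifs <;> omega

theorem ExtendedBubbleModel.exists_isSimplicial (B : ExtendedBubbleModel (Fin n)) {E : Finset ℕ}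
    (hE : E ⊆ range n) (hne : E ≠ range n) :
    ∃ v < n, v ∉ E ∧ IsSimplicial n (natGraph B.graph) E v := by
  classical
  obtain ⟨w, hw, hwE⟩ := exists_of_ssubset (hE.ssubset_of_ne hne)
  obtain ⟨v, hv, h⟩ := B.exists_simplicial (univ.filter fun v : Fin n => (v : ℕ) ∉ E)
    ⟨⟨w, mem_range.1 hw⟩, mem_filter.2 ⟨mem_univ _, hwE⟩⟩
  refine ⟨v, v.2, (mem_filter.1 hv).2, fun x hx y hy => ?_⟩
  obtain ⟨hx, hvx, hxE⟩ := mem_nbhd.1 hx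
  obtain ⟨hy, hvy, hyE⟩ := mem_nbhd.1 hy
  by_cases hxy : x = y
  · exact Or.inr hxy
  · have := h ⟨x, hx⟩ (mem_filter.2 ⟨mem_univ _, hxE⟩) ⟨y, hy⟩ (mem_filter.2 ⟨mem_univ _, hyE⟩)
      (natGraph_adj_val.1 hvx) (natGraph_adj_val.1 hvy) fun e => hxy (congrArg Fin.val e)
    exact Or.inl (natGraph_adj_val.2 this)

/-- Distinct leaders are never twins and here belong to a clique, so the bound by two columns of the
model applies. -/
theorem ExtendedBubbleModel.card_leaders_le (B : ExtendedBubbleModel (Fin n)) {E : Finset ℕ} {v : ℕ}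
    (h : IsSimplicial n (natGraph B.graph) E v) :
    (leaders (natGraph B.graph) (nbhd n (natGraph B.graph) E v)).card ≤ 2 * B.maxColumn := by
  classical
  set L := leaders (natGraph B.graph) (nbhd n (natGraph B.graph) E v) with hL
  have hLn : ∀ w ∈ L, w ∈ nbhd n (natGraph B.graph) E v ∧
      ∀ w' ∈ nbhd n (natGraph B.graph) E v, SameNbhd (natGraph B.graph) w w' → w ≤ w' :=
    fun w hw => mem_filter.1 hw
  have hcard : L = (univ.filter fun u : Fin n => (u : ℕ) ∈ L).map Fin.valEmbedding := by
    ext w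
    rw [mem_map]
    constructor
    · exact fun hw => ⟨⟨w, (mem_nbhd.1 (hLn w hw).1).1⟩, mem_filter.2 ⟨mem_univ _, hw⟩, rfl⟩
    · rintro ⟨u, hu, rfl⟩
      exact (mem_filter.1 hu).2
  rw [hcard, card_map]
  refine B.card_le_two_mul_maxColumn _ (fun u hu w hw => ?_) fun u hu w hw huw => ?_
  · exact closedAdj_natGraph_val.1
      (h _ (hLn _ (mem_filter.1 hu).2).1 _ (hLn _ (mem_filter.1 hw).2).1)
  · have hu := hLn _ (mem_filter.1 hu).2
    have hw := hLn _ (mem_filter.1 hw).2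
    exact Fin.ext (le_antisymm (hu.2 _ hw.1 huw.natGraph) (hw.2 _ hu.1 huw.symm.natGraph))

end Fin

/-- MaxCut on mixed unit interval graphs is fixed-parameter tractable with respect to `p`. -/
theorem exists_findsMaxCutInTime : ∃ (P : RamProg) (C c : ℕ),
    FindsMaxCutInTime P (fun _ G => IsMixedUnitInterval G)
      (fun n G => C * 4 ^ p G * (n + 1) ^ c) := by
  classical
  obtain ⟨P, C, c, hP⟩ := exists_program
  refine ⟨P, C, c, fun n G hG => ?_⟩
  obtain ⟨B, rfl, hB⟩ := hG.exists_maxColumn_eq_p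
  -- The optimal model serves only the analysis: it guarantees simplicial vertices and bounds the
  -- leaders by `2 * p G`, and `2 ^ (2 * p G) = 4 ^ p G`.
  obtain ⟨t, s, hrun, ht, X, hX, hout, hmax⟩ := hP n (natGraph B.graph) (2 * B.maxColumn)
    (graphInput B.graph).mem lt_of_natGraph_adj (fun u w hu hw => mem_graphInput hu hw)
    (fun x hx => mem_graphInput_eq_zero hx) mem_graphInput_le_one
    (fun E hE hne => B.exists_isSimplicial hE hne) (fun E v h => B.card_leaders_le h)
  refine ⟨t, s, hrun, ?_, fun T => ?_⟩
  · rwa [pow_mul, hB] at ht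
  · have h1 : ∀ v : Fin n, v ∈ vertexSetOutput n s ↔ (v : ℕ) ∈ X := by
      intro v
      change s.mem v = 1 ↔ _
      rw [hout v v.2]
      by_cases h : (v : ℕ) ∈ X
      · rw [ind_true h, iff_true_right h]
      · rw [ind_false h, iff_false_right h]
        exact zero_ne_one
    have h2 : ∀ v : Fin n, v ∈ T ↔
        (v : ℕ) ∈ (univ.filter fun v : Fin n => v ∈ T).map Fin.valEmbedding := by
      intro v
      constructor
      · exact fun hv => mem_map.2 ⟨v, mem_filter.2 ⟨mem_univ _, hv⟩, rfl⟩
      · intro hv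
        obtain ⟨u, hu, e⟩ := mem_map.1 hv
        rw [← Fin.ext e]
        exact (mem_filter.1 hu).2
    rw [cutSize_eq_cutCard h1, cutSize_eq_cutCard h2]
    refine hmax _ fun x hx => ?_
    obtain ⟨u, -, rfl⟩ := mem_map.1 hx
    exact mem_range.2 u.2

end MaxCutBubbles

theorem mainTheorem5 :
    (∃ (P : MaxCutBubbles.RamProg) (C c : ℕ),
      MaxCutBubbles.FindsMaxCutInTime P (fun _ G => MaxCutBubbles.IsMixedUnitInterval G)
        (fun n G => C * 4 ^ MaxCutBubbles.p G * (n + 1) ^ c)) ∧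
    (∀ (V : Type*) [Finite V] (G : SimpleGraph V), MaxCutBubbles.IsMixedUnitInterval G →
      (∃ B : MaxCutBubbles.ExtendedBubbleModel V, B.graph = G) ∧
      (G.Connected → MaxCutBubbles.bw 1 G ≤ MaxCutBubbles.p G) ∧
      (∀ K : G.ConnectedComponent,
        MaxCutBubbles.bw 1 (G.induce K.supp) ≤ MaxCutBubbles.p G)) :=
  ⟨MaxCutBubbles.exists_findsMaxCutInTime, fun _ _ _ hG =>
    ⟨hG.exists_model, fun hc => hG.bw_one_le_p hc, fun K => hG.bw_one_induce_le_p K⟩⟩
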